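/- Let $k$ be a field of characteristic $2$ and let $Q=Q_8$ be the quaternion group of order $8$. Let $\hat P$ be any complete projective resolution of the trivial $kQ$-module $k$ (one exists), let $A=\operatorname{Hom}^*_{kQ}(\hat P,\hat P)$ be its endomorphism differential graded algebra (with $A^n=\prod_j\operatorname{Hom}_{kQ}(\hat P_{j+n},\hat P_j)$ and product given by composition), and let $\hat H^*(Q)=H^*A$ be the Tate cohomology algebra. For a $kQ$-module $M$, $\hat H^*(Q,M)=H^*(\operatorname{Hom}_{kQ}(\hat P,M))$ is a right graded $\hat H^*(Q)$-module by composition; a right graded $\hat H^*(Q)$-module is called realisable if it is isomorphic to $\hat H^*(Q,M)$ for some $kQ$-module $M$. Write $\Lambda[n]^j=\Lambda^{n+j}$ for shifts. Let $\gamma_Q\in HH^{3,-1}(\hat H^*(Q))$ be the canonical class: choose a $k$-linear map $f_1:H^*A\to A$ of degree $0$ selecting a representing cocycle of each class, and a $k$-bilinear map $f_2:H^*A\otimes H^*A\to A$ of degree $-1$ with $df_2(a,b)=f_1(ab)-f_1(a)f_1(b)$; then $\gamma_Q$ is the Hochschild class of the cocycle $m$, where $m(a,b,c)\in H^*A$ is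 the class of $$f_2(a,b)f_1(c)-f_2(a,bc)+f_2(ab,c)-(-1)^{|a|}f_1(a)f_2(b,c).$$ Then: 1. $\gamma_Q\neq 0$ (whatever the choices of $f_1,f_2$). 2. There are classes $x,y\in\hat H^1(Q)$ and $s\in\hat H^4(Q)$ which present $\hat H^*(Q)$ as the $k$-algebra $$k[x,y,s^{\pm1}]/(x^2+y^2=xy,\ x^3=y^3=0,\ x^2y=xy^2).$$ 3. For all $x,y,s$ presenting $\hat H^*(Q)$ in this way, put $C=\begin{pmatrix} y & x+y\\ x& y\end{pmatrix}$. Then (a) the matric Massey product $\langle C,C,C\rangle$ is defined (non-empty) and does not contain $0$. Here $\langle C,C,C\rangle$ is the set of the matrices of cohomology classes of all $TC_3-C_1'U$, where $C_1,C_2,C_3$ are matrices of cocycles of $A$ representing $C$, the matrices $T,U$ over $A$ satisfy $dT=C_1C_2$ and $dU=C_2C_3$, and $C_1'$ is $C_1$ with each entry $e$ multiplied by $(-1)^{|e|}$ (a trivial sign, as $\operatorname{char}k=2$). (b) the cokernel of the map of right graded $\hat H^*(Q)$-modules $$\hat H^*(Q)[-1]\oplus\hat H^*(Q)[-1]\xrightarrow{\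 \begin{pmatrix} y & x+y\\ x& y\end{pmatrix}\ }\hat H^*(Q)\oplus\hat H^*(Q)$$ is not a direct summand of a realisable module. -/

import Mathlib

open CategoryTheory CochainComplex.HomComplex
open scoped DirectSum

universe w u

/-! ## Graded algebras and right graded modules

Everything is `ℤ`-graded and given by its family of homogeneous components. A product lands in
every component whose index is provably the sum of the degrees, so that no transport is needed. -/

/-- A `ℤ`-graded (associative, unital) algebra over `k`. -/
structure GrAlg (k : Type u) [Field k] where
  X : ℤ → Type w
  [acg : ∀ n, AddCommGroup (X n)]
  [mod : ∀ n, Module k (X n)]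
  one : X 0
  mul : ∀ {m n p : ℤ}, m + n = p → X m →ₗ[k] X n →ₗ[k] X p
  one_mul : ∀ {n : ℤ} (h : 0 + n = n) (a : X n), mul h one a = a
  mul_one : ∀ {n : ℤ} (h : n + 0 = n) (a : X n), mul h a one = a
  mul_assoc : ∀ {i j l ij jl p : ℤ} (h₁ : i + j = ij) (h₂ : j + l = jl) (h₃ : ij + l = p)
    (h₄ : i + jl = p) (a : X i) (b : X j) (c : X l),
    mul h₃ (mul h₁ a b) c = mul h₄ a (mul h₂ b c)

attribute [instance] GrAlg.acg GrAlg.mod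

/-- A right graded module over a graded algebra. -/
structure GrMod {k : Type u} [Field k] (Λ : GrAlg.{w} k) where
  X : ℤ → Type w
  [acg : ∀ n, AddCommGroup (X n)]
  [mod : ∀ n, Module k (X n)]
  act : ∀ {m n p : ℤ}, m + n = p → X m →ₗ[k] Λ.X n →ₗ[k] X p
  act_one : ∀ {n : ℤ} (h : n + 0 = n) (a : X n), act h a Λ.one = a
  act_mul : ∀ {i j l ij jl p : ℤ} (h₁ : i + j = ij) (h₂ : j + l = jl) (h₃ : ij + l = p)
    (h₄ : i + jl = p) (a : X i) (b : Λ.X j) (c : Λ.X l),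
    act h₃ (act h₁ a b) c = act h₄ a (Λ.mul h₂ b c)

attribute [instance] GrMod.acg GrMod.mod

/-- Morphisms (of degree `0`) of right graded modules. -/
structure GrHom {k : Type u} [Field k] {Λ : GrAlg.{w} k} (M N : GrMod Λ) where
  f : ∀ n : ℤ, M.X n →ₗ[k] N.X n
  map_act : ∀ {m n p : ℤ} (h : m + n = p) (a : M.X m) (b : Λ.X n),
    f p (M.act h a b) = N.act h (f m a) b

namespace GrMod

variable {k : Type u} [Field k] {Λ : GrAlg.{w} k}

/-- `M` is isomorphic to `N` as a graded module. -/
def IsIsoTo (M N : GrMod Λ) : Prop :=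
  ∃ (f : GrHom M N) (g : GrHom N M), (∀ n a, g.f n (f.f n a) = a) ∧ ∀ n b, f.f n (g.f n b) = b

/-- `M` is (isomorphic to) a direct summand of `N`: there are maps `M → N → M` of graded modules
whose composite is the identity. -/
def IsSummandOf (M N : GrMod Λ) : Prop :=
  ∃ (i : GrHom M N) (r : GrHom N M), ∀ n a, r.f n (i.f n a) = a

/-- The free right module `⨁ i, Λ[-p i]`; its component of degree `n` is `⨁ i, Λ^(n - p i)`. -/
def free {ι : Type} (Λ : GrAlg.{w} k) (p : ι → ℤ) : GrMod Λ where
  X n := ∀ i, Λ.X (n - p i)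
  act {m n q} h := LinearMap.mk₂ k
    (fun v b i => Λ.mul (show (m - p i) + n = q - p i by omega) (v i) b)
    (by intros; ext; simp) (by intros; ext; simp) (by intros; ext; simp) (by intros; ext; simp)
  act_one h v := by
    ext i
    exact Λ.mul_one _ (v i)
  act_mul h₁ h₂ h₃ h₄ v b c := by
    ext i
    exact Λ.mul_assoc _ h₂ _ _ (v i) b c

/-- The cokernel of a morphism of graded modules, formed in each degree. -/
def coker {M N : GrMod Λ} (f : GrHom M N) : GrMod Λ where
  X n := N.X n ⧸ LinearMap.range (f.f n)
  act {m n q} h := Submodule.liftQ (LinearMap.range (f.f m))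
    (LinearMap.mk₂ k (fun a b => (LinearMap.range (f.f q)).mkQ (N.act h a b))
      (by intros; simp) (by intros; simp) (by intros; simp) (by intros; simp)) (by
        rintro _ ⟨a, rfl⟩
        rw [LinearMap.mem_ker]
        ext b
        simp only [LinearMap.mk₂_apply, Submodule.mkQ_apply, LinearMap.zero_apply,
          Submodule.Quotient.mk_eq_zero]
        exact ⟨M.act h a b, f.map_act h a b⟩)
  act_one {n} h a := by
    obtain ⟨a, rfl⟩ := Submodule.mkQ_surjective _ a
    exact congrArg (Submodule.mkQ _) (N.act_one h a)
  act_mul h₁ h₂ h₃ h₄ a b c := by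
    obtain ⟨a, rfl⟩ := Submodule.mkQ_surjective _ a
    exact congrArg (Submodule.mkQ _) (N.act_mul h₁ h₂ h₃ h₄ a b c)

end GrMod

namespace GrAlg

variable {k : Type u} [Field k] (Λ : GrAlg.{w} k)

/-- Transport along an equality of degrees. -/
def cast {m n : ℤ} (h : m = n) : Λ.X m →ₗ[k] Λ.X n := h ▸ LinearMap.id

/-- Homogeneous matrices representing the morphisms `⨁ j, Λ[-q j] ⟶ ⨁ i, Λ[-p i]`. -/
abbrev HMat {ι κ : Type} (p : ι → ℤ) (q : κ → ℤ) : Type w := ∀ (i : ι) (j : κ), Λ.X (q j - p i)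

variable {Λ}

/-- The morphism of free right modules given by left multiplication with a matrix. -/
def HMat.toHom {ι κ : Type} [Fintype κ] {p : ι → ℤ} {q : κ → ℤ} (M : Λ.HMat p q) :
    GrHom (GrMod.free Λ q) (GrMod.free Λ p) where
  f n :=
    { toFun := fun v i => ∑ j, Λ.mul (show (q j - p i) + (n - q j) = n - p i by omega) (M i j) (v j)
      map_add' := fun v v' => by
        funext i
        change ∑ j, Λ.mul _ (M i j) (v j + v' j) = _
        simp only [map_add, Finset.sum_add_distrib]
        rfl
      map_smul' := fun c v => by
        funext i
        change ∑ j, Λ.mul _ (M i j) (c • v j) = _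
        simp only [map_smul, ← Finset.smul_sum]
        rfl }
  map_act {m n q'} h v b := by
    funext i
    change ∑ j, Λ.mul _ (M i j) (Λ.mul _ (v j) b) = Λ.mul _ (∑ j, Λ.mul _ (M i j) (v j)) b
    rw [map_sum, LinearMap.sum_apply]
    exact Finset.sum_congr rfl fun j _ => (Λ.mul_assoc _ _ _ _ _ _ _).symm

/-! ### The direct sum of the components as a `k`-algebra -/

theorem mk_eq_mk {m n p : ℤ} (hm : m = p) (hn : n = p) (a : Λ.X m) (b : Λ.X n)
    (h : Λ.cast hm a = Λ.cast hn b) : GradedMonoid.mk (A := Λ.X) m a = GradedMonoid.mk n b := by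
  subst hm
  subst hn
  exact congrArg (GradedMonoid.mk _) h

theorem cast_mul {m n p q : ℤ} (h : m + n = p) (e : p = q) (a : Λ.X m) (b : Λ.X n) :
    Λ.cast e (Λ.mul h a b) = Λ.mul (h.trans e) a b := by
  subst e
  rfl

instance gmul : GradedMonoid.GMul Λ.X where
  mul a b := Λ.mul rfl a b

instance gone : GradedMonoid.GOne Λ.X where
  one := Λ.one

theorem smul_one_mul {n : ℤ} (h : 0 + n = n) (r : k) (a : Λ.X n) :
    Λ.mul h (r • Λ.one) a = r • a := by
  rw [map_smul, LinearMap.smul_apply, Λ.one_mul]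

theorem mul_smul_one {n : ℤ} (h : n + 0 = n) (r : k) (a : Λ.X n) :
    Λ.mul h a (r • Λ.one) = r • a := by
  rw [map_smul, Λ.mul_one]

instance gring : DirectSum.GRing Λ.X where
  mul_zero a := map_zero _
  zero_mul b := LinearMap.map_zero₂ _ b
  mul_add a b c := map_add _ b c
  add_mul a b c := LinearMap.map_add₂ _ a b c
  one_mul := by
    rintro ⟨n, a⟩
    refine mk_eq_mk (zero_add n) rfl _ _ ?_
    exact (cast_mul _ _ _ _).trans (Λ.one_mul _ a)
  mul_one := by
    rintro ⟨n, a⟩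
    refine mk_eq_mk (add_zero n) rfl _ _ ?_
    exact (cast_mul _ _ _ _).trans (Λ.mul_one _ a)
  mul_assoc := by
    rintro ⟨m, a⟩ ⟨n, b⟩ ⟨p, c⟩
    refine mk_eq_mk (add_assoc m n p) rfl _ _ ?_
    exact (cast_mul _ _ _ _).trans (Λ.mul_assoc rfl rfl _ rfl a b c)
  natCast n := n • Λ.one
  natCast_zero := zero_smul _ _
  natCast_succ n := succ_nsmul _ _
  intCast n := n • Λ.one
  intCast_ofNat n := natCast_zsmul _ _
  intCast_negSucc_ofNat n := negSucc_zsmul _ _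

instance galgebra : DirectSum.GAlgebra k Λ.X where
  toFun := (LinearMap.toSpanSingleton k (Λ.X 0) Λ.one).toAddMonoidHom
  map_one := one_smul k Λ.one
  map_mul r s := by
    refine mk_eq_mk rfl (zero_add 0) _ _ ?_
    refine Eq.trans ?_ (cast_mul _ _ _ _).symm
    exact ((smul_one_mul _ r (s • Λ.one)).trans (smul_smul r s Λ.one)).symm
  commutes := by
    rintro r ⟨n, a⟩
    refine mk_eq_mk (zero_add n) (add_zero n) _ _ ?_
    refine (cast_mul _ _ _ _).trans (Eq.trans ?_ (cast_mul _ _ _ _).symm)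
    exact (smul_one_mul _ r a).trans (mul_smul_one _ r a).symm
  smul_def := by
    rintro r ⟨n, a⟩
    refine mk_eq_mk rfl (zero_add n) _ _ ?_
    refine Eq.trans ?_ (cast_mul _ _ _ _).symm
    exact (smul_one_mul _ r a).symm

/-! ### The Hochschild cohomology groups `HH^{3,t}` -/

variable (Λ)

/-- Hochschild cochains of bidegree `(2, t)` with values in `Λ`. -/
def C2 (t : ℤ) : Type _ := ∀ i j : ℤ, Λ.X i →ₗ[k] Λ.X j →ₗ[k] Λ.X (i + j + t)

/-- Hochschild cochains of bidegree `(3, t)` with values in `Λ`. -/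
def C3 (t : ℤ) : Type _ :=
  ∀ i j l : ℤ, Λ.X i →ₗ[k] Λ.X j →ₗ[k] Λ.X l →ₗ[k] Λ.X (i + j + l + t)

instance (t : ℤ) : AddCommGroup (Λ.C2 t) :=
  inferInstanceAs (AddCommGroup (∀ i j : ℤ, Λ.X i →ₗ[k] Λ.X j →ₗ[k] Λ.X (i + j + t)))

instance (t : ℤ) : Module k (Λ.C2 t) :=
  inferInstanceAs (Module k (∀ i j : ℤ, Λ.X i →ₗ[k] Λ.X j →ₗ[k] Λ.X (i + j + t)))

instance (t : ℤ) : AddCommGroup (Λ.C3 t) :=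
  inferInstanceAs (AddCommGroup
    (∀ i j l : ℤ, Λ.X i →ₗ[k] Λ.X j →ₗ[k] Λ.X l →ₗ[k] Λ.X (i + j + l + t)))

instance (t : ℤ) : Module k (Λ.C3 t) :=
  inferInstanceAs (Module k
    (∀ i j l : ℤ, Λ.X i →ₗ[k] Λ.X j →ₗ[k] Λ.X l →ₗ[k] Λ.X (i + j + l + t)))

variable {Λ}

/-- The value of a cochain, in any component whose index equals the expected degree. -/
def C2.app {t : ℤ} (g : Λ.C2 t) {i j p : ℤ} (h : i + j + t = p) (a : Λ.X i) (b : Λ.X j) :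
    Λ.X p := Λ.cast h (g i j a b)

/-- The value of a cochain, in any component whose index equals the expected degree. -/
def C3.app {t : ℤ} (φ : Λ.C3 t) {i j l p : ℤ} (h : i + j + l + t = p) (a : Λ.X i) (b : Λ.X j)
    (c : Λ.X l) : Λ.X p := Λ.cast h (φ i j l a b c)

theorem C2.app_add {t : ℤ} (g g' : Λ.C2 t) {i j p : ℤ} (h : i + j + t = p) (a : Λ.X i)
    (b : Λ.X j) : C2.app (g + g') h a b = C2.app g h a b + C2.app g' h a b :=
  map_add (Λ.cast h) _ _

theorem C2.app_smul {t : ℤ} (r : k) (g : Λ.C2 t) {i j p : ℤ} (h : i + j + t = p) (a : Λ.X i)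
    (b : Λ.X j) : C2.app (r • g) h a b = r • C2.app g h a b :=
  map_smul (Λ.cast h) _ _

theorem C2.app_zero {t : ℤ} {i j p : ℤ} (h : i + j + t = p) (a : Λ.X i)
    (b : Λ.X j) : C2.app (0 : Λ.C2 t) h a b = 0 :=
  map_zero (Λ.cast h)

theorem C3.app_add {t : ℤ} (φ ψ : Λ.C3 t) {i j l p : ℤ} (h : i + j + l + t = p) (a : Λ.X i)
    (b : Λ.X j) (c : Λ.X l) : C3.app (φ + ψ) h a b c = C3.app φ h a b c + C3.app ψ h a b c :=
  map_add (Λ.cast h) _ _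

theorem C3.app_smul {t : ℤ} (r : k) (φ : Λ.C3 t) {i j l p : ℤ} (h : i + j + l + t = p)
    (a : Λ.X i) (b : Λ.X j) (c : Λ.X l) : C3.app (r • φ) h a b c = r • C3.app φ h a b c :=
  map_smul (Λ.cast h) _ _

theorem C3.app_zero {t : ℤ} {i j l p : ℤ} (h : i + j + l + t = p)
    (a : Λ.X i) (b : Λ.X j) (c : Λ.X l) : C3.app (0 : Λ.C3 t) h a b c = 0 :=
  map_zero (Λ.cast h)

variable (Λ)

/-- The Hochschild cocycles of bidegree `(3, t)`: the cochains `φ` satisfying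
`(-1)^{t|a|} a φ(b,c,d) - φ(ab,c,d) + φ(a,bc,d) - φ(a,b,cd) + φ(a,b,c) d = 0`. -/
def hochschildCocycles (t : ℤ) : Submodule k (Λ.C3 t) where
  carrier := {φ | ∀ (i j l m : ℤ) (a : Λ.X i) (b : Λ.X j) (c : Λ.X l) (d : Λ.X m),
    (t * i).negOnePow • Λ.mul (show i + (j + l + m + t) = i + j + l + m + t by ring)
        a (C3.app φ rfl b c d)
      - C3.app φ rfl (Λ.mul rfl a b) c d
      + C3.app φ (by ring) a (Λ.mul rfl b c) d
      - C3.app φ (by ring) a b (Λ.mul rfl c d)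
      + Λ.mul (by ring) (C3.app φ rfl a b c) d = 0}
  zero_mem' := by
    intro i j l m a b c d
    simp [C3.app_zero]
  add_mem' := by
    intro φ ψ hφ hψ i j l m a b c d
    have h := congrArg₂ (· + ·) (hφ i j l m a b c d) (hψ i j l m a b c d)
    simp only [add_zero] at h
    rw [← h]
    simp only [C3.app_add, LinearMap.add_apply, map_add, smul_add]
    abel
  smul_mem' := by
    intro r φ hφ i j l m a b c d
    have h := congrArg (r • ·) (hφ i j l m a b c d)
    simp only [smul_zero] at h
    rw [← h]
    simp only [C3.app_smul, LinearMap.smul_apply, map_smul, smul_add, smul_sub,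
      smul_comm r]

/-- The Hochschild coboundaries of bidegree `(3, t)`: the cochains of the form
`(a, b, c) ↦ (-1)^{t|a|} a g(b,c) - g(ab,c) + g(a,bc) - g(a,b) c`. -/
def hochschildCoboundaries (t : ℤ) : Submodule k (Λ.C3 t) where
  carrier := {φ | ∃ g : Λ.C2 t, ∀ (i j l : ℤ) (a : Λ.X i) (b : Λ.X j) (c : Λ.X l),
    C3.app φ rfl a b c =
      (t * i).negOnePow • Λ.mul (show i + (j + l + t) = i + j + l + t by ring)
          a (C2.app g rfl b c)
        - C2.app g rfl (Λ.mul rfl a b) c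
        + C2.app g (by ring) a (Λ.mul rfl b c)
        - Λ.mul (by ring) (C2.app g rfl a b) c}
  zero_mem' := ⟨0, by
    intro i j l a b c
    simp [C2.app_zero, C3.app_zero]⟩
  add_mem' := by
    rintro φ ψ ⟨g, hg⟩ ⟨g', hg'⟩
    refine ⟨g + g', ?_⟩
    intro i j l a b c
    simp only [C3.app_add, LinearMap.add_apply, hg, hg', C2.app_add, map_add, smul_add]
    abel
  smul_mem' := by
    rintro r φ ⟨g, hg⟩
    refine ⟨r • g, ?_⟩
    intro i j l a b c
    simp only [C3.app_smul, LinearMap.smul_apply, hg, C2.app_smul, map_smul, smul_add, smul_sub,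
      smul_comm r]

/-- The Hochschild cohomology group `HH^{3,t}(Λ) = HH^{3,t}(Λ, Λ)`. -/
abbrev HH3 (t : ℤ) : Type _ :=
  Λ.hochschildCocycles t ⧸ (Λ.hochschildCoboundaries t).submoduleOf (Λ.hochschildCocycles t)

end GrAlg

/-! ## Differential graded algebras and modules, and their cohomology -/

/-- A cochain complex of `k`-vector spaces. -/
structure DGSpace (k : Type u) [Field k] where
  X : ℤ → Type w
  [acg : ∀ n, AddCommGroup (X n)]
  [mod : ∀ n, Module k (X n)]
  d : ∀ {m n : ℤ}, m + 1 = n → X m →ₗ[k] X n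
  d_d : ∀ {l m n : ℤ} (h : l + 1 = m) (h' : m + 1 = n) (a : X l), d h' (d h a) = 0

attribute [instance] DGSpace.acg DGSpace.mod

namespace DGSpace

variable {k : Type u} [Field k] (C : DGSpace.{w} k)

/-- Cocycles of degree `n`. -/
def Z (n : ℤ) : Submodule k (C.X n) := LinearMap.ker (C.d (rfl : n + 1 = n + 1))

/-- Coboundaries of degree `n`. -/
def B (n : ℤ) : Submodule k (C.X n) := LinearMap.range (C.d (sub_add_cancel n 1))

/-- Cohomology in degree `n`. -/
abbrev H (n : ℤ) : Type w := C.Z n ⧸ (C.B n).submoduleOf (C.Z n)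

/-- The cohomology class of a cocycle. -/
def cls {n : ℤ} : C.Z n →ₗ[k] C.H n := ((C.B n).submoduleOf (C.Z n)).mkQ

variable {C}

theorem mem_Z {m n : ℤ} (h : m + 1 = n) {a : C.X m} : a ∈ C.Z m ↔ C.d h a = 0 := by
  subst h
  exact LinearMap.mem_ker

theorem d_mem_B {m n : ℤ} (h : m + 1 = n) (a : C.X m) : C.d h a ∈ C.B n := by
  obtain rfl : m = n - 1 := by omega
  exact ⟨a, rfl⟩

theorem d_mem_Z {m n : ℤ} (h : m + 1 = n) (a : C.X m) : C.d h a ∈ C.Z n :=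
  (mem_Z rfl).2 (C.d_d h rfl a)

theorem mem_B {m n : ℤ} (h : m + 1 = n) {a : C.X n} : a ∈ C.B n ↔ ∃ b, C.d h b = a := by
  obtain rfl : m = n - 1 := by omega
  exact LinearMap.mem_range

theorem cls_surjective {n : ℤ} : Function.Surjective (C.cls (n := n)) :=
  Submodule.mkQ_surjective _

theorem cls_eq_zero {n : ℤ} {a : C.Z n} : C.cls a = 0 ↔ (a : C.X n) ∈ C.B n :=
  Submodule.Quotient.mk_eq_zero _

theorem cls_eq {n : ℤ} {a b : C.Z n} : C.cls a = C.cls b ↔ (a : C.X n) - b ∈ C.B n :=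
  Submodule.Quotient.eq _

/-- A bilinear pairing of complexes satisfying the Leibniz rule. -/
structure Pairing (C D E : DGSpace.{w} k) where
  μ : ∀ {m n p : ℤ}, m + n = p → C.X m →ₗ[k] D.X n →ₗ[k] E.X p
  leibniz : ∀ {m n p m' n' p' : ℤ} (h : m + n = p) (hm : m + 1 = m') (hn : n + 1 = n')
    (hp : p + 1 = p') (h₁ : m' + n = p') (h₂ : m + n' = p') (a : C.X m) (b : D.X n),
    E.d hp (μ h a b) = μ h₁ (C.d hm a) b + m.negOnePow • μ h₂ a (D.d hn b)

namespace Pairing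

variable {C D E : DGSpace.{w} k} (P : Pairing C D E)

theorem mem_Z {m n p : ℤ} (h : m + n = p) {a : C.X m} {b : D.X n} (ha : a ∈ C.Z m)
    (hb : b ∈ D.Z n) : P.μ h a b ∈ E.Z p := by
  rw [DGSpace.mem_Z rfl] at ha hb ⊢
  rw [P.leibniz h rfl rfl rfl (by omega) (by omega), ha, hb]
  simp

theorem left_mem_B {m n p : ℤ} (h : m + n = p) {a : C.X m} {b : D.X n} (ha : a ∈ C.B m)
    (hb : b ∈ D.Z n) : P.μ h a b ∈ E.B p := by
  rw [DGSpace.mem_B (sub_add_cancel m 1)] at ha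
  rw [DGSpace.mem_Z rfl] at hb
  obtain ⟨c, rfl⟩ := ha
  have := P.leibniz (show (m - 1) + n = p - 1 by omega) (sub_add_cancel m 1) rfl
    (sub_add_cancel p 1) h (by omega) c b
  rw [hb] at this
  simp only [map_zero, smul_zero, add_zero] at this
  rw [← this]
  exact d_mem_B _ _

theorem right_mem_B {m n p : ℤ} (h : m + n = p) {a : C.X m} {b : D.X n} (ha : a ∈ C.Z m)
    (hb : b ∈ D.B n) : P.μ h a b ∈ E.B p := by
  rw [DGSpace.mem_B (sub_add_cancel n 1)] at hb
  rw [DGSpace.mem_Z rfl] at ha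
  obtain ⟨c, rfl⟩ := hb
  have := P.leibniz (show m + (n - 1) = p - 1 by omega) rfl (sub_add_cancel n 1)
    (sub_add_cancel p 1) (by omega) h a c
  rw [ha] at this
  simp only [map_zero, LinearMap.zero_apply, zero_add] at this
  have h' : P.μ h a (D.d (sub_add_cancel n 1) c) =
      m.negOnePow • E.d (sub_add_cancel p 1) (P.μ (by omega) a c) := by
    rw [this, smul_smul, Int.units_mul_self, one_smul]
  rw [h', Units.smul_def]
  exact zsmul_mem (d_mem_B _ _) _

/-- The pairing of cocycles. -/
def onZ {m n p : ℤ} (h : m + n = p) : C.Z m →ₗ[k] D.Z n →ₗ[k] E.Z p :=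
  LinearMap.mk₂ k (fun a b => ⟨P.μ h a b, P.mem_Z h a.2 b.2⟩)
    (by intros; ext; simp) (by intros; ext; simp) (by intros; ext; simp) (by intros; ext; simp)

/-- The induced pairing in cohomology. -/
def onH {m n p : ℤ} (h : m + n = p) : C.H m →ₗ[k] D.H n →ₗ[k] E.H p :=
  Submodule.liftQ _
    { toFun := fun a => Submodule.liftQ _ (E.cls ∘ₗ P.onZ h a) (by
        intro b hb
        exact cls_eq_zero.2 (P.right_mem_B h a.2 hb))
      map_add' := fun a a' => by
        ext b
        simp only [map_add]
        rfl
      map_smul' := fun r a => by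
        ext b
        simp only [map_smul]
        rfl } (by
    intro a ha
    rw [LinearMap.mem_ker]
    ext b
    exact cls_eq_zero.2 (P.left_mem_B h ha b.2))

theorem onH_cls {m n p : ℤ} (h : m + n = p) (a : C.Z m) (b : D.Z n) :
    P.onH h (C.cls a) (D.cls b) = E.cls ⟨P.μ h a b, P.mem_Z h a.2 b.2⟩ := rfl

end Pairing

end DGSpace

/-- A differential graded algebra over `k` (cohomological grading). -/
structure DGAlg (k : Type u) [Field k] extends DGSpace.{w} k where
  one : X 0
  mul : ∀ {m n p : ℤ}, m + n = p → X m →ₗ[k] X n →ₗ[k] X p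
  one_mul : ∀ {n : ℤ} (h : 0 + n = n) (a : X n), mul h one a = a
  mul_one : ∀ {n : ℤ} (h : n + 0 = n) (a : X n), mul h a one = a
  mul_assoc : ∀ {i j l ij jl p : ℤ} (h₁ : i + j = ij) (h₂ : j + l = jl) (h₃ : ij + l = p)
    (h₄ : i + jl = p) (a : X i) (b : X j) (c : X l),
    mul h₃ (mul h₁ a b) c = mul h₄ a (mul h₂ b c)
  leibniz : ∀ {m n p m' n' p' : ℤ} (h : m + n = p) (hm : m + 1 = m') (hn : n + 1 = n')
    (hp : p + 1 = p') (h₁ : m' + n = p') (h₂ : m + n' = p') (a : X m) (b : X n),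
    d hp (mul h a b) = mul h₁ (d hm a) b + m.negOnePow • mul h₂ a (d hn b)

/-- A right differential graded module over a differential graded algebra. -/
structure DGMod {k : Type u} [Field k] (A : DGAlg.{w} k) extends DGSpace.{w} k where
  act : ∀ {m n p : ℤ}, m + n = p → X m →ₗ[k] A.X n →ₗ[k] X p
  act_one : ∀ {n : ℤ} (h : n + 0 = n) (a : X n), act h a A.one = a
  act_mul : ∀ {i j l ij jl p : ℤ} (h₁ : i + j = ij) (h₂ : j + l = jl) (h₃ : ij + l = p)
    (h₄ : i + jl = p) (a : X i) (b : A.X j) (c : A.X l),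
    act h₃ (act h₁ a b) c = act h₄ a (A.mul h₂ b c)
  leibniz : ∀ {m n p m' n' p' : ℤ} (h : m + n = p) (hm : m + 1 = m') (hn : n + 1 = n')
    (hp : p + 1 = p') (h₁ : m' + n = p') (h₂ : m + n' = p') (a : X m) (b : A.X n),
    d hp (act h a b) = act h₁ (d hm a) b + m.negOnePow • act h₂ a (A.d hn b)

namespace DGAlg

variable {k : Type u} [Field k] (A : DGAlg.{w} k)

/-- The multiplication as a pairing of complexes. -/
def pairing : DGSpace.Pairing A.toDGSpace A.toDGSpace A.toDGSpace where
  μ := A.mul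
  leibniz := A.leibniz

theorem one_mem_Z : A.one ∈ A.Z 0 := by
  have h := A.leibniz (add_zero 0) (zero_add 1) (zero_add 1) (zero_add 1) (add_zero 1)
    (zero_add 1) A.one A.one
  rw [A.one_mul, A.mul_one, A.one_mul] at h
  rw [DGSpace.mem_Z (zero_add 1)]
  simpa using h

/-- The cohomology algebra `H^*A`. -/
def cohomology : GrAlg.{w} k where
  X n := A.H n
  one := A.cls ⟨A.one, A.one_mem_Z⟩
  mul h := A.pairing.onH h
  one_mul h a := by
    obtain ⟨a, rfl⟩ := DGSpace.cls_surjective a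
    exact congrArg A.cls (Subtype.ext (A.one_mul h a))
  mul_one h a := by
    obtain ⟨a, rfl⟩ := DGSpace.cls_surjective a
    exact congrArg A.cls (Subtype.ext (A.mul_one h a))
  mul_assoc h₁ h₂ h₃ h₄ a b c := by
    obtain ⟨a, rfl⟩ := DGSpace.cls_surjective a
    obtain ⟨b, rfl⟩ := DGSpace.cls_surjective b
    obtain ⟨c, rfl⟩ := DGSpace.cls_surjective c
    exact congrArg A.cls (Subtype.ext (A.mul_assoc h₁ h₂ h₃ h₄ a b c))

/-- The class in `H^*A` of a cocycle of `A`. -/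
def hcls {n : ℤ} : A.Z n →ₗ[k] A.cohomology.X n := A.cls

/-- The cocycle `a` of `A` represents the class `x` of `H^*A`. -/
def Represents {n : ℤ} (a : A.X n) (x : A.cohomology.X n) : Prop :=
  ∃ h : a ∈ A.Z n, A.hcls ⟨a, h⟩ = x

end DGAlg

/-- The right graded `H^*A`-module `H^*M` of a right differential graded `A`-module `M`. -/
def DGMod.cohomology {k : Type u} [Field k] {A : DGAlg.{w} k} (M : DGMod A) :
    GrMod A.cohomology where
  X n := M.H n
  act h := (DGSpace.Pairing.mk M.act M.leibniz : DGSpace.Pairing M.toDGSpace A.toDGSpace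
    M.toDGSpace).onH h
  act_one h a := by
    obtain ⟨a, rfl⟩ := DGSpace.cls_surjective a
    exact congrArg M.cls (Subtype.ext (M.act_one h a))
  act_mul h₁ h₂ h₃ h₄ a b c := by
    obtain ⟨a, rfl⟩ := DGSpace.cls_surjective a
    obtain ⟨b, rfl⟩ := DGSpace.cls_surjective b
    obtain ⟨c, rfl⟩ := DGSpace.cls_surjective c
    exact congrArg M.cls (Subtype.ext (M.act_mul h₁ h₂ h₃ h₄ a b c))

/-! ### The canonical class of a differential graded algebra -/

namespace DGAlg

variable {k : Type u} [Field k] (A : DGAlg.{w} k)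

/-- The choices entering the construction of the canonical class: a `k`-linear selection `f₁` of
representatives of the classes in `H^*A`, and a bilinear map `f₂` of degree `-1` with
`d f₂(x, y) = f₁(xy) - f₁(x) f₁(y)`. -/
structure Choices where
  f₁ : ∀ {n : ℤ}, A.cohomology.X n →ₗ[k] A.X n
  represents_f₁ : ∀ {n : ℤ} (x : A.cohomology.X n), A.Represents (f₁ x) x
  f₂ : ∀ {i j p : ℤ}, i + j - 1 = p → A.cohomology.X i →ₗ[k] A.cohomology.X j →ₗ[k] A.X p
  d_f₂ : ∀ {i j p q : ℤ} (h : i + j - 1 = p) (hp : p + 1 = q) (hq : i + j = q)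
    (x : A.cohomology.X i) (y : A.cohomology.X j),
    A.d hp (f₂ h x y) = f₁ (A.cohomology.mul hq x y) - A.mul hq (f₁ x) (f₁ y)

theorem nonempty_choices : Nonempty A.Choices := by
  have h₁ : ∀ n, ∃ g : A.cohomology.X n →ₗ[k] A.Z n, A.hcls ∘ₗ g = LinearMap.id := fun n =>
    LinearMap.exists_rightInverse_of_surjective _
      (LinearMap.range_eq_top.2 DGSpace.cls_surjective)
  choose g hg using h₁
  have hB : ∀ {m n : ℤ} (h : m + 1 = n), ∃ s : A.X n →ₗ[k] A.X m,
      ∀ b ∈ A.B n, A.d h (s b) = b := by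
    intro m n h
    obtain ⟨s, hs⟩ := LinearMap.exists_rightInverse_of_surjective (A.d h).rangeRestrict
      (LinearMap.range_eq_top.2 (LinearMap.surjective_rangeRestrict _))
    obtain ⟨s', hs'⟩ := s.exists_extend
    refine ⟨s', fun b hb => ?_⟩
    have hb' : b ∈ LinearMap.range (A.d h) := (DGSpace.mem_B h).1 hb
    have e : s' b = s ⟨b, hb'⟩ := LinearMap.congr_fun hs' ⟨b, hb'⟩
    rw [e]
    exact congrArg Subtype.val (LinearMap.congr_fun hs ⟨b, hb'⟩)
  choose s hs using @hB
  let f₁ : ∀ n : ℤ, A.cohomology.X n →ₗ[k] A.X n := fun n => (A.Z n).subtype ∘ₗ g n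
  have hf₁ : ∀ {n : ℤ} (x : A.cohomology.X n), A.hcls (g n x) = x := fun x => LinearMap.congr_fun (hg _) x
  refine ⟨⟨fun {n} => f₁ n, fun {n} x => ⟨(g n x).2, hf₁ x⟩, fun {i j p} h =>
    LinearMap.mk₂ k (fun x y => s (show p + 1 = i + j by omega)
      (f₁ _ (A.cohomology.mul rfl x y) - A.mul rfl (f₁ _ x) (f₁ _ y))) ?_ ?_ ?_ ?_, ?_⟩⟩
  · intro x x' y
    rw [← map_add]
    congr 1
    simp only [map_add, LinearMap.add_apply]
    abel
  · intro c x y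
    rw [← map_smul]
    congr 1
    simp only [map_smul, LinearMap.smul_apply, smul_sub]
  · intro x y y'
    rw [← map_add]
    congr 1
    simp only [map_add]
    abel
  · intro c x y
    rw [← map_smul]
    congr 1
    simp only [map_smul, smul_sub]
  · intro i j p q h hp hq x y
    subst hq
    refine hs hp _ ?_
    have key : A.hcls (g _ (A.cohomology.mul rfl x y)) =
        A.hcls ⟨A.mul rfl (g _ x) (g _ y), A.pairing.mem_Z rfl (g _ x).2 (g _ y).2⟩ := by
      refine (hf₁ _).trans ?_
      conv_lhs => rw [← hf₁ x, ← hf₁ y]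
      rfl
    exact DGSpace.cls_eq.1 key

namespace Choices

variable {A} (c : A.Choices)

/-- The element `f₂(x,y) f₁(z) - f₂(x,yz) + f₂(xy,z) - (-1)^|x| f₁(x) f₂(y,z)` of `A`. -/
def cochain {i j l p : ℤ} (h : i + j + l - 1 = p) (x : A.cohomology.X i) (y : A.cohomology.X j)
    (z : A.cohomology.X l) : A.X p :=
  A.mul (show (i + j - 1) + l = p by omega) (c.f₂ rfl x y) (c.f₁ z)
    - c.f₂ (show i + (j + l) - 1 = p by omega) x (A.cohomology.mul rfl y z)
    + c.f₂ h (A.cohomology.mul rfl x y) z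
    - i.negOnePow • A.mul (show i + (j + l - 1) = p by omega) (c.f₁ x) (c.f₂ rfl y z)

theorem f₁_mem_Z {n : ℤ} (x : A.cohomology.X n) : c.f₁ x ∈ A.Z n := (c.represents_f₁ x).1

theorem d_f₁ {n m : ℤ} (h : n + 1 = m) (x : A.cohomology.X n) : A.d h (c.f₁ x) = 0 :=
  (DGSpace.mem_Z h).1 (c.f₁_mem_Z x)

theorem cochain_mem_Z {i j l p : ℤ} (h : i + j + l - 1 = p) (x : A.cohomology.X i)
    (y : A.cohomology.X j) (z : A.cohomology.X l) : c.cochain h x y z ∈ A.Z p := by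
  have hq : i + j + l = p + 1 := by omega
  rw [DGSpace.mem_Z rfl, cochain]
  simp only [map_sub, map_add, Units.smul_def, map_zsmul]
  rw [A.leibniz (m' := i + j) (n' := l + 1) _ (by omega) rfl rfl hq (by omega),
    A.leibniz (m' := i + 1) (n' := j + l) _ rfl (by omega) rfl (by omega) (by omega),
    c.d_f₂ _ _ (show i + (j + l) = p + 1 by omega), c.d_f₂ _ _ hq, c.d_f₂ _ _ rfl,
    c.d_f₂ _ _ rfl, c.d_f₁, c.d_f₁,
    ← A.cohomology.mul_assoc rfl rfl hq (by omega) x y z]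
  simp only [map_sub, LinearMap.sub_apply, map_zero, smul_zero, add_zero, LinearMap.zero_apply,
    zero_add, ← Units.smul_def, smul_smul, Int.units_mul_self, one_smul,
    A.mul_assoc rfl rfl hq (show i + (j + l) = p + 1 by omega)]
  abel

/-- The secondary multiplication: the trilinear map of degree `-1` on `H^*A` sending `(x, y, z)`
to the class of `f₂(x,y) f₁(z) - f₂(x,yz) + f₂(xy,z) - (-1)^|x| f₁(x) f₂(y,z)`. -/
def m : A.cohomology.C3 (-1) := fun i j l =>
  LinearMap.mk₂ k (fun x y =>
    { toFun := fun z => A.hcls ⟨c.cochain rfl x y z, c.cochain_mem_Z rfl x y z⟩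
      map_add' := fun z z' => by
        refine Eq.trans ?_ (map_add A.hcls _ _)
        refine congrArg A.hcls (Subtype.ext ?_)
        simp only [cochain, map_add, Submodule.coe_add, smul_add]
        abel
      map_smul' := fun r z => by
        refine Eq.trans ?_ (map_smul A.hcls _ _)
        refine congrArg A.hcls (Subtype.ext ?_)
        simp only [cochain, map_smul, Submodule.coe_smul, smul_sub, smul_add,
          smul_comm r, RingHom.id_apply] })
    (fun x x' y => by
      ext z
      refine Eq.trans ?_ (map_add A.hcls _ _)
      refine congrArg A.hcls (Subtype.ext ?_)
      simp only [cochain, map_add, Submodule.coe_add, smul_add, LinearMap.add_apply]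
      abel)
    (fun r x y => by
      ext z
      refine Eq.trans ?_ (map_smul A.hcls _ _)
      refine congrArg A.hcls (Subtype.ext ?_)
      simp only [cochain, map_smul, Submodule.coe_smul, smul_sub, smul_add,
          smul_comm r, LinearMap.smul_apply])
    (fun x y y' => by
      ext z
      refine Eq.trans ?_ (map_add A.hcls _ _)
      refine congrArg A.hcls (Subtype.ext ?_)
      simp only [cochain, map_add, Submodule.coe_add, smul_add, LinearMap.add_apply]
      abel)
    (fun r x y => by
      ext z
      refine Eq.trans ?_ (map_smul A.hcls _ _)
      refine congrArg A.hcls (Subtype.ext ?_)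
      simp only [cochain, map_smul, Submodule.coe_smul, smul_sub, smul_add,
          smul_comm r, LinearMap.smul_apply])


theorem app_m {i j l p : ℤ} (h : i + j + l + -1 = p) (x : A.cohomology.X i)
    (y : A.cohomology.X j) (z : A.cohomology.X l) :
    GrAlg.C3.app c.m h x y z = A.hcls ⟨c.cochain h x y z, c.cochain_mem_Z h x y z⟩ := by
  subst h
  rfl

theorem mul_hcls {m n p : ℤ} (h : m + n = p) (x : A.cohomology.X m) (b : A.Z n) :
    A.cohomology.mul h x (A.hcls b) =
      A.hcls ⟨A.mul h (c.f₁ x) b, A.pairing.mem_Z h (c.f₁_mem_Z x) b.2⟩ := by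
  conv_lhs => rw [← (c.represents_f₁ x).2]
  rfl

theorem hcls_mul {m n p : ℤ} (h : m + n = p) (a : A.Z m) (y : A.cohomology.X n) :
    A.cohomology.mul h (A.hcls a) y =
      A.hcls ⟨A.mul h a (c.f₁ y), A.pairing.mem_Z h a.2 (c.f₁_mem_Z y)⟩ := by
  conv_lhs => rw [← (c.represents_f₁ y).2]
  rfl

theorem f₂_left {i j l q q' p : ℤ} (h₁ : i + j = q) (h₂ : i + j = q') (h : q + l - 1 = p)
    (h' : q' + l - 1 = p) (x : A.cohomology.X i) (y : A.cohomology.X j) (z : A.cohomology.X l) :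
    c.f₂ h (A.cohomology.mul h₁ x y) z = c.f₂ h' (A.cohomology.mul h₂ x y) z := by
  subst h₁
  subst h₂
  rfl

theorem f₂_right {i j l q q' p : ℤ} (h₁ : i + j = q) (h₂ : i + j = q') (h : l + q - 1 = p)
    (h' : l + q' - 1 = p) (x : A.cohomology.X i) (y : A.cohomology.X j) (z : A.cohomology.X l) :
    c.f₂ h z (A.cohomology.mul h₁ x y) = c.f₂ h' z (A.cohomology.mul h₂ x y) := by
  subst h₁
  subst h₂
  rfl

theorem mul_f₂ {i j l q q' p : ℤ} (h₁ : i + j - 1 = q) (h₂ : i + j - 1 = q') (h : l + q = p)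
    (h' : l + q' = p) (x : A.cohomology.X i) (y : A.cohomology.X j) (a : A.X l) :
    A.mul h a (c.f₂ h₁ x y) = A.mul h' a (c.f₂ h₂ x y) := by
  subst h₁
  subst h₂
  rfl

theorem f₂_mul {i j l q q' p : ℤ} (h₁ : i + j - 1 = q) (h₂ : i + j - 1 = q') (h : q + l = p)
    (h' : q' + l = p) (x : A.cohomology.X i) (y : A.cohomology.X j) (a : A.X l) :
    A.mul h (c.f₂ h₁ x y) a = A.mul h' (c.f₂ h₂ x y) a := by
  subst h₁
  subst h₂
  rfl

theorem m_mem : c.m ∈ A.cohomology.hochschildCocycles (-1) := by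
  intro i j l n x y z w
  simp only [app_m]
  rw [c.mul_hcls, c.hcls_mul, Units.smul_def, ← map_zsmul A.hcls, ← map_sub A.hcls,
    ← map_add A.hcls, ← map_sub A.hcls, ← map_add A.hcls]
  refine DGSpace.cls_eq_zero.2 ?_
  rw [DGSpace.mem_B (show i + j + l + n - 2 + 1 = i + j + l + n + -1 by ring)]
  refine ⟨(i + j).negOnePow • A.mul (show (i + j - 1) + (l + n - 1) = i + j + l + n - 2 by ring)
    (c.f₂ rfl x y) (c.f₂ rfl z w), ?_⟩
  rw [Units.smul_def, map_zsmul, ← Units.smul_def,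
    A.leibniz (m' := i + j) (n' := l + n) _ (by ring) (by ring) _
    (by ring) (by ring), c.d_f₂ _ _ rfl, c.d_f₂ _ _ rfl]
  have e₁ : A.mul (show (i + j) + (l + n - 1) = i + j + l + n + -1 by ring)
      (A.mul rfl (c.f₁ x) (c.f₁ y)) (c.f₂ rfl z w) =
    A.mul (show i + (j + (l + n - 1)) = i + j + l + n + -1 by ring) (c.f₁ x)
      (A.mul rfl (c.f₁ y) (c.f₂ rfl z w)) := A.mul_assoc _ _ _ _ _ _ _
  have e₂ : A.mul (show (i + j + l + -1) + n = i + j + l + n + -1 by ring)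
      (A.mul (show (i + j - 1) + l = i + j + l + -1 by ring) (c.f₂ rfl x y) (c.f₁ z)) (c.f₁ w) =
    A.mul (show (i + j - 1) + (l + n) = i + j + l + n + -1 by ring) (c.f₂ rfl x y)
      (A.mul rfl (c.f₁ z) (c.f₁ w)) := A.mul_assoc _ _ _ _ _ _ _
  have e₃ : A.mul (show (i + j + l + -1) + n = i + j + l + n + -1 by ring)
      (A.mul (show i + (j + l - 1) = i + j + l + -1 by ring) (c.f₁ x) (c.f₂ rfl y z)) (c.f₁ w) =
    A.mul (show i + (j + l + n + -1) = i + j + l + n + -1 by ring) (c.f₁ x)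
      (A.mul (show (j + l - 1) + n = j + l + n + -1 by ring) (c.f₂ rfl y z) (c.f₁ w)) :=
    A.mul_assoc _ _ _ _ _ _ _
  have e₄ : c.f₂ (show (i + j + l) + n - 1 = i + j + l + n + -1 by ring)
      (A.cohomology.mul rfl (A.cohomology.mul rfl x y) z) w =
    c.f₂ (show (i + (j + l)) + n - 1 = i + j + l + n + -1 by ring)
      (A.cohomology.mul rfl x (A.cohomology.mul rfl y z)) w := by
    rw [A.cohomology.mul_assoc rfl rfl rfl (by ring)]
    exact c.f₂_left _ _ _ _ _ _ _
  have e₅ : c.f₂ (show i + (j + l + n) - 1 = i + j + l + n + -1 by ring) x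
      (A.cohomology.mul rfl (A.cohomology.mul rfl y z) w) =
    c.f₂ (show i + (j + (l + n)) - 1 = i + j + l + n + -1 by ring) x
      (A.cohomology.mul rfl y (A.cohomology.mul rfl z w)) := by
    rw [A.cohomology.mul_assoc rfl rfl rfl (by ring)]
    exact c.f₂_right _ _ _ _ _ _ _
  have e₆ : A.mul (show i + (j + l + n + -1) = i + j + l + n + -1 by ring) (c.f₁ x)
      (A.mul (show j + (l + n - 1) = j + l + n + -1 by ring) (c.f₁ y) (c.f₂ rfl z w)) =
    A.mul (show i + (j + (l + n - 1)) = i + j + l + n + -1 by ring) (c.f₁ x)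
      (A.mul rfl (c.f₁ y) (c.f₂ rfl z w)) :=
    (A.mul_assoc rfl _ (by ring) _ _ _ _).symm.trans (A.mul_assoc rfl _ _ _ _ _ _)
  have e₇ : A.mul (show i + (j + l + n + -1) = i + j + l + n + -1 by ring) (c.f₁ x)
      (c.f₂ (show j + (l + n) - 1 = j + l + n + -1 by ring) y (A.cohomology.mul rfl z w)) =
    A.mul (show i + (j + (l + n) - 1) = i + j + l + n + -1 by ring) (c.f₁ x)
      (c.f₂ rfl y (A.cohomology.mul rfl z w)) := c.mul_f₂ _ _ _ _ _ _ _
  have e₈ : A.mul (show (i + j + l + -1) + n = i + j + l + n + -1 by ring)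
      (c.f₂ (show i + (j + l) - 1 = i + j + l + -1 by ring) x (A.cohomology.mul rfl y z))
      (c.f₁ w) =
    A.mul (show (i + (j + l) - 1) + n = i + j + l + n + -1 by ring)
      (c.f₂ rfl x (A.cohomology.mul rfl y z)) (c.f₁ w) := c.f₂_mul _ _ _ _ _ _ _
  simp only [Submodule.coe_add, Submodule.coe_sub, Int.negOnePow_add, Int.negOnePow_sub,
    Int.negOnePow_one, neg_one_mul, Int.negOnePow_neg]
  rcases Int.units_eq_one_or i.negOnePow with hi | hi <;>
  rcases Int.units_eq_one_or j.negOnePow with hj | hj <;>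
  simp only [hi, hj, cochain, map_sub, map_add, map_neg, smul_add, smul_sub, LinearMap.sub_apply,
    LinearMap.add_apply, LinearMap.neg_apply, one_smul, neg_smul, Units.neg_smul, _root_.mul_one,
    mul_neg, neg_neg, Units.val_one, Units.val_neg, NegMemClass.coe_neg,
    Int.negOnePow_add, smul_neg, e₁, e₂, e₃, e₄, e₅, e₆, e₇, e₈] <;>
  abel

/-- The class in `HH^{3,-1}(H^*A)` of the secondary multiplication. -/
def gamma : A.cohomology.HH3 (-1) := Submodule.Quotient.mk ⟨c.m, c.m_mem⟩

end Choices
end DGAlg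

/-! ### Matric Massey products -/

/-- The matric Massey product `⟨X, Y, Z⟩` of three composable homogeneous matrices over `H^*A`: the
set of all matrices whose entries are the classes of those of `T Z' - X'[1] U`, where `X'`, `Y'`,
`Z'` are matrices of representatives of `X`, `Y`, `Z` and `d T = X' Y'`, `d U = Y' Z'`. Here
`X'[1]` carries the sign `(-1)^|X'|`, which is trivial in characteristic `2`. -/
def DGAlg.massey {k : Type u} [Field k] (A : DGAlg.{w} k) {ι₀ ι₁ ι₂ ι₃ : Type} [Fintype ι₁]
    [Fintype ι₂] {p : ι₀ → ℤ} {q : ι₁ → ℤ} {r : ι₂ → ℤ} {s : ι₃ → ℤ} (X : A.cohomology.HMat p q)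
    (Y : A.cohomology.HMat q r) (Z : A.cohomology.HMat r s) :
    Set (∀ (a : ι₀) (d : ι₃), A.cohomology.X (s d - p a - 1)) :=
  {B | ∃ (X' : ∀ a b, A.X (q b - p a)) (Y' : ∀ b c, A.X (r c - q b))
      (Z' : ∀ c d, A.X (s d - r c)) (T : ∀ a c, A.X (r c - p a - 1))
      (U : ∀ b d, A.X (s d - q b - 1)),
    (∀ a b, A.Represents (X' a b) (X a b)) ∧ (∀ b c, A.Represents (Y' b c) (Y b c)) ∧
    (∀ c d, A.Represents (Z' c d) (Z c d)) ∧
    (∀ a c, A.d (sub_add_cancel (r c - p a) 1) (T a c) =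
      ∑ b, A.mul (show (q b - p a) + (r c - q b) = r c - p a by ring) (X' a b) (Y' b c)) ∧
    (∀ b d, A.d (sub_add_cancel (s d - q b) 1) (U b d) =
      ∑ c, A.mul (show (r c - q b) + (s d - r c) = s d - q b by ring) (Y' b c) (Z' c d)) ∧
    ∀ a d, A.Represents
      (∑ c, A.mul (show (r c - p a - 1) + (s d - r c) = s d - p a - 1 by ring) (T a c) (Z' c d)
        - ∑ b, (q b - p a).negOnePow •
          A.mul (show (q b - p a) + (s d - q b - 1) = s d - p a - 1 by ring) (X' a b) (U b d))
      (B a d)}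

/-! ## Tate cohomology

We use left modules over the group algebra `kG`; via `g ↦ g⁻¹` these are the same as right modules.
Complexes are indexed cohomologically: the module `P̂_j` of a complete resolution is `K.X (-j)`. -/

section Hom

variable (k : Type u) [Field k] {C : Type*} [Category.{w} C] [Preadditive C] [Linear k C]

/-- Composition `(f g)(v) = f (g v)` of homogeneous maps of complexes; a homogeneous map `K → L` of
degree `n` is an arbitrary family of maps `K^p ⟶ L^(p + n)`. -/
def cochainMul (K L M : CochainComplex C ℤ) {m n p : ℤ} (h : m + n = p) :
    Cochain L M m →ₗ[k] Cochain K L n →ₗ[k] Cochain K M p :=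
  LinearMap.mk₂ k (fun f g => g.comp f ((add_comm n m).trans h))
    (fun f f' g => Cochain.comp_add g f f' _) (fun r f g => Cochain.comp_smul g r f _)
    (fun f g g' => Cochain.add_comp g g' f _) (fun r f g => Cochain.smul_comp r g f _)

variable {k} in
theorem cochainMul_assoc {K L M N : CochainComplex C ℤ} {i j l ij jl p : ℤ} (h₁ : i + j = ij)
    (h₂ : j + l = jl) (h₃ : ij + l = p) (h₄ : i + jl = p) (a : Cochain M N i) (b : Cochain L M j)
    (c : Cochain K L l) :
    cochainMul k K L N h₃ (cochainMul k L M N h₁ a b) c =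
      cochainMul k K M N h₄ a (cochainMul k K L M h₂ b c) :=
  (Cochain.comp_assoc c b a ((add_comm l j).trans h₂) ((add_comm j i).trans h₁)
    (by omega)).symm

variable {k} in
theorem cochainMul_leibniz {K L M : CochainComplex C ℤ} {m n p m' n' p' : ℤ} (h : m + n = p)
    (hm : m + 1 = m') (hn : n + 1 = n') (hp : p + 1 = p') (h₁ : m' + n = p') (h₂ : m + n' = p')
    (a : Cochain L M m) (b : Cochain K L n) :
    δ_hom k K M p p' (cochainMul k K L M h a b) =
      cochainMul k K L M h₁ (δ_hom k L M m m' a) b +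
        m.negOnePow • cochainMul k K L M h₂ a (δ_hom k K L n n' b) :=
  δ_comp b a ((add_comm n m).trans h) _ _ _ hp hn hm

/-- The endomorphism differential graded algebra of a complex. -/
def endDGAlg (K : CochainComplex C ℤ) : DGAlg.{w} k where
  X n := Cochain K K n
  d {m n} _ := δ_hom k K K m n
  d_d _ _ a := δ_δ _ _ _ a
  one := Cochain.ofHom (𝟙 K)
  mul h := cochainMul k K K K h
  one_mul _ a := Cochain.comp_id a
  mul_one _ a := Cochain.id_comp a
  mul_assoc := cochainMul_assoc
  leibniz := cochainMul_leibniz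

/-- For complexes `K` and `M`, the complex of homogeneous maps `K → M` is a right differential
graded module over the endomorphism algebra of `K`, by composition. -/
def homDGMod (K M : CochainComplex C ℤ) : DGMod (endDGAlg k K) where
  X n := Cochain K M n
  d {m n} _ := δ_hom k K M m n
  d_d _ _ a := δ_δ _ _ _ a
  act h := cochainMul k K K M h
  act_one _ a := Cochain.id_comp a
  act_mul := cochainMul_assoc
  leibniz := cochainMul_leibniz

end Hom

/-- A complete projective resolution of the trivial `kG`-module `k`: an acyclic complex of
projective `kG`-modules together with an augmentation `P̂_0 → k` that identifies `k` with the
cokernel of `P̂_1 → P̂_0`. -/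
structure CompleteResolution (k : Type u) [Field k] (G : Type) [Group G] where
  K : CochainComplex (ModuleCat.{u} (MonoidAlgebra k G)) ℤ
  projective : ∀ n, Module.Projective (MonoidAlgebra k G) (K.X n)
  acyclic : K.Acyclic
  ε : K.X 0 →ₗ[MonoidAlgebra k G] (Representation.trivial k G k).asModule
  surjective : Function.Surjective ε
  exact : Function.Exact (K.d (-1) 0) ε

namespace CompleteResolution

variable {k : Type u} [Field k] {G : Type} [Group G] (P : CompleteResolution k G)

/-- The endomorphism differential graded algebra of a complete resolution. -/
noncomputable def dga : DGAlg.{u} k := endDGAlg k P.K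

/-- The Tate cohomology algebra `Ĥ^*(G) = H^*(Hom(P̂, P̂))`. -/
noncomputable def tate : GrAlg.{u} k := P.dga.cohomology

/-- The graded `Ĥ^*(G)`-module `Ĥ^*(G, M) = H^*(Hom(P̂, M))`, where `M` is regarded as a complex
concentrated in degree `0`. -/
noncomputable def tateMod (M : ModuleCat.{u} (MonoidAlgebra k G)) : GrMod P.tate :=
  (homDGMod k P.K ((HomologicalComplex.single _ (ComplexShape.up ℤ) 0).obj M)).cohomology

/-- A graded `Ĥ^*(G)`-module is realisable if it is isomorphic to `Ĥ^*(G, M)` for some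
`kG`-module `M`. -/
def IsRealisable (X : GrMod P.tate) : Prop :=
  ∃ M : ModuleCat.{u} (MonoidAlgebra k G), X.IsIsoTo (P.tateMod M)

end CompleteResolution

/-! ## The quaternion group -/

section Quaternion

variable {k : Type u} [Field k]

/-- The relations `x² + y² = xy`, `x³ = y³ = 0`, `x²y = xy²`, `s s' = 1` in the polynomial ring
`k[x, y, s, s']`, whose variables are numbered `0, 1, 2, 3`. -/
noncomputable def quaternionIdeal (k : Type u) [Field k] : Ideal (MvPolynomial (Fin 4) k) :=
  let x := MvPolynomial.X 0
  let y := MvPolynomial.X 1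
  Ideal.span {x ^ 2 + y ^ 2 - x * y, x ^ 3, y ^ 3, x ^ 2 * y - x * y ^ 2,
    MvPolynomial.X 2 * MvPolynomial.X 3 - 1}

/-- The classes `x`, `y` of degree `1` and `s` of degree `4` present `Λ` as
`k[x, y, s^{±1}] / (x² + y² = xy, x³ = y³ = 0, x²y = xy²)`. -/
def IsQuaternionPresentation (Λ : GrAlg.{w} k) (x y : Λ.X 1) (s : Λ.X 4) : Prop :=
  ∃ Φ : (MvPolynomial (Fin 4) k ⧸ quaternionIdeal k) ≃ₐ[k] (⨁ n, Λ.X n),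
    Φ (Ideal.Quotient.mk _ (MvPolynomial.X 0)) = DirectSum.of Λ.X 1 x ∧
    Φ (Ideal.Quotient.mk _ (MvPolynomial.X 1)) = DirectSum.of Λ.X 1 y ∧
    Φ (Ideal.Quotient.mk _ (MvPolynomial.X 2)) = DirectSum.of Λ.X 4 s

/-- The matrix `((y, x + y), (x, y))` as a morphism `Λ[-n]² ⟶ Λ[-m]²`, where `n = m + 1`. -/
def quaternionMatrix (Λ : GrAlg.{w} k) (x y : Λ.X 1) (m n : ℤ) (h : 1 = n - m) :
    Λ.HMat (fun _ : Fin 2 => m) (fun _ : Fin 2 => n) :=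
  fun i j => Λ.cast h (!![y, x + y; x, y] i j)

end Quaternion

/-! Everything rests on one explicit computation. In characteristic 2 the group Q₈ has a complete
resolution of period 4 with ranks 1, 1, 2, 2, whose differentials have entries in the augmentation
ideal. Because of this minimality a cocycle of degree n of its endomorphism algebra is a coboundary
exactly when its component P̂_n → P̂_0 has augmentation zero on the basis vectors. Classes are thus
read off as vectors over k (`ev`, `ev_d`, `mem_B_of_ev`). Explicit chain maps x, y of degree 1 and
the periodicity s give the presentation (`isQuaternionPresentation`).

For the Massey product, write C = Mx + Ny with scalar matrices M, N. For every presentation there is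
a scalar δ ≠ 0 with M² = N² = δ and NM = δ + MN (`exists_of_isQuaternionPresentation`). If dq = x² +
y² + yx and de = xy + yx, then T₀ = δq + MN e satisfies dT₀ = C². The null-homotopies q and e can be
chosen with known components where they matter, and then T₀C + CT₀ represents δ(M + N)xy. Any other
defining system changes this class by some WC + CV (`exists_of_isMasseySystem`). The matrix D = Nx +
(M + N)y satisfies CD = DC = 0, so F ↦ tr(FD) kills all WC + CV; on δ(M + N)xy it takes the value δ²
x²y, which is nonzero (`Matrix.eq_zero_of_quaternion_relations`). Hence 0 is not in ⟨C, C, C⟩.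

The other negative statements follow formally. If the canonical class were the coboundary of g,
summing over the entries of C would put the Massey class into the form GC + CG (`gamma_ne_zero`). If
the cokernel of C were a summand of the cohomology of a differential graded module, lifting its
generators and relations to cochains would put it into the form WC + CV
(`not_isSummandOf_cohomology`). The modules Ĥ^*(Q, M) are cohomologies of such modules, namely
Hom(P̂, M).

An arbitrary complete resolution is compared with the periodic one by maps f, g where one composite
is the identity and the other is homotopic to it (`exists_retraction`). Here projective modules over
kQ₈ are also injective, so homotopies extend in both directions. Conjugation by f and g carries all
the data over (`nonempty_of_retraction`). -/

/-! ## Extension of homotopies -/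

section IntSequence

variable {F : ℤ → Type*} [∀ p, Inhabited (F p)] {E : ∀ p q : ℤ, p + 1 = q → F p → F q → Prop}

/-- A pair of consecutive terms extends to a sequence indexed by `ℤ`, if every pair of consecutive
terms extends by one step in both directions. -/
theorem exists_int_sequence
    (up : ∀ (p q r : ℤ) (h : p + 1 = q) (h' : q + 1 = r) (a : F p) (b : F q), E p q h a b →
      ∃ c : F r, E q r h' b c)
    (down : ∀ (p q r : ℤ) (h : p + 1 = q) (h' : q + 1 = r) (b : F q) (c : F r), E q r h' b c →
      ∃ a : F p, E p q h a b)
    {p₀ q₀ : ℤ} (h₀ : p₀ + 1 = q₀) (a₀ : F p₀) (b₀ : F q₀) (H : E p₀ q₀ h₀ a₀ b₀) :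
    ∃ f : ∀ p, F p, f p₀ = a₀ ∧ f q₀ = b₀ ∧ ∀ p q h, E p q h (f p) (f q) := by
  -- Stage n solves the problem for the pairs starting in [p₀ - n, p₀ + n]; the terms involved run
  -- from p₀ - n to p₀ + n + 1, and later stages leave them alone.
  let P : ℕ → (∀ p, F p) → Prop := fun n f =>
    ∀ p q h, p₀ - n ≤ p → p ≤ p₀ + n → E p q h (f p) (f q)
  have step : ∀ (n : ℕ) (f : {f // P n f}), ∃ f' : {f // P (n + 1) f},
      ∀ p, p₀ - n ≤ p → p ≤ p₀ + n + 1 → f'.1 p = f.1 p := by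
    rintro n ⟨f, hf⟩
    obtain ⟨c, hc⟩ := up (p₀ + n) (p₀ + n + 1) (p₀ + n + 1 + 1) rfl rfl _ _
      (hf _ _ rfl (by omega) le_rfl)
    obtain ⟨a, ha⟩ := down (p₀ - n - 1) (p₀ - n) (p₀ - n + 1) (by ring) rfl _ _
      (hf _ _ rfl le_rfl (by omega))
    refine ⟨⟨Function.update (Function.update f (p₀ + n + 1 + 1) c) (p₀ - n - 1) a, ?_⟩, ?_⟩
    · intro p q h hp hp'
      push_cast at hp hp'
      by_cases h₁ : p = p₀ - n - 1
      · obtain rfl : q = p₀ - n := by omega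
        subst h₁
        rw [Function.update_self, Function.update_of_ne (by omega),
          Function.update_of_ne (by omega)]
        exact ha
      rw [Function.update_of_ne h₁, Function.update_of_ne (show p ≠ p₀ + n + 1 + 1 by omega),
        Function.update_of_ne (show q ≠ p₀ - n - 1 by omega)]
      by_cases h₂ : p = p₀ + n + 1
      · obtain rfl : q = p₀ + n + 1 + 1 := by omega
        subst h₂
        rw [Function.update_self]
        exact hc
      rw [Function.update_of_ne (by omega)]
      exact hf _ _ _ (by omega) (by omega)
    · intro p hp hp'
      change Function.update _ _ _ _ = _
      rw [Function.update_of_ne (by omega), Function.update_of_ne (by omega)]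
  choose next hnext using step
  have init : P 0 (Function.update (Function.update default p₀ a₀) q₀ b₀) := by
    intro p q h hp hp'
    obtain rfl : p = p₀ := by simp at hp hp'; omega
    subst h h₀
    rw [Function.update_self, Function.update_of_ne (by omega), Function.update_self]
    exact H
  let seq : ∀ n, {f // P n f} := fun n => Nat.rec ⟨_, init⟩ next n
  have stable : ∀ (m n : ℕ), n ≤ m → ∀ p, p₀ - n ≤ p → p ≤ p₀ + n + 1 →
      (seq m).1 p = (seq n).1 p := by
    intro m n hmn
    induction m, hmn using Nat.le_induction with
    | base => intros; rfl
    | succ m hm ih =>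
      intro p hp hp'
      exact (hnext m (seq m) p (by omega) (by omega)).trans (ih p hp hp')
  -- The term at p is final from stage |p - p₀| on, so the diagonal is the limit.
  refine ⟨fun p => (seq (p - p₀).natAbs).1 p, ?_, ?_, ?_⟩
  · refine (stable _ 0 (Nat.zero_le _) _ (by simp) (by simp)).trans ?_
    change Function.update _ _ _ _ = _
    rw [Function.update_of_ne (by omega), Function.update_self]
  · refine (stable _ 0 (Nat.zero_le _) _ (by simp; omega) (by simp; omega)).trans ?_
    exact Function.update_self ..
  · intro p q h
    have e : ∀ r, (r - p₀).natAbs ≤ (p - p₀).natAbs + (q - p₀).natAbs →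
        (seq (r - p₀).natAbs).1 r = (seq ((p - p₀).natAbs + (q - p₀).natAbs)).1 r :=
      fun r hr => (stable _ _ hr r (by omega) (by omega)).symm
    change E p q h ((seq (p - p₀).natAbs).1 p) ((seq (q - p₀).natAbs).1 q)
    rw [e p (by omega), e q (by omega)]
    exact (seq _).2 p q h (by omega) (by omega)

end IntSequence

section Homotopy

variable {C : Type u} [Category.{w} C] [Abelian C] {K L : CochainComplex C ℤ}

theorem exactAt_shortComplex_exact {K : CochainComplex C ℤ} (hK : K.Acyclic) {i j l : ℤ}
    (h : i + 1 = j) (h' : j + 1 = l) :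
    (ShortComplex.mk (K.d i j) (K.d j l) (K.d_comp_d _ _ _)).Exact :=
  (K.exactAt_iff' i j l (by simp; omega) (by simp; omega)).1 (hK j)

/-- In an acyclic situation, a homotopy given in two consecutive degrees extends. -/
theorem exists_delta_eq (hK : K.Acyclic) (hL : L.Acyclic) (pK : ∀ p, Projective (K.X p))
    (iL : ∀ p, Injective (L.X p)) {m n l : ℤ} (hmn : m + 1 = n) (hnl : n + 1 = l)
    (a : Cochain K L n) (ha : δ n l a = 0) {p₀ q₀ r₀ t₀ : ℤ} (h₀ : p₀ + 1 = q₀)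
    (hr : p₀ + m = r₀) (ht : p₀ + n = t₀)
    (u : K.X p₀ ⟶ L.X r₀) (v : K.X q₀ ⟶ L.X t₀)
    (H : a.v p₀ t₀ ht = u ≫ L.d r₀ t₀ + n.negOnePow • K.d p₀ q₀ ≫ v) :
    ∃ h : Cochain K L m, δ m n h = a ∧ h.v p₀ r₀ hr = u ∧ h.v q₀ t₀ (by omega) = v := by
  -- The cocycle condition in components: a commutes with the differentials up to sign.
  have key : ∀ (p q r s t : ℤ) (hq : p + 1 = q) (hs : p + n = s) (hr : r + 1 = s)
      (ht : q + n = t),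
      a.v p s hs ≫ L.d s t = n.negOnePow • K.d p q ≫ a.v q t ht := by
    intro p q r s t hq hs hr ht
    have := Cochain.congr_v ha p t (by omega)
    rw [δ_v n l hnl a p t (by omega) s q (by omega) hq, show l.negOnePow = -n.negOnePow by rw [← hnl, Int.negOnePow_succ]] at this
    simpa [← sub_eq_add_neg, sub_eq_zero] using this
  have : ∀ p, Inhabited (∀ q, p + m = q → (K.X p ⟶ L.X q)) := fun p => ⟨fun _ _ => 0⟩
  obtain ⟨f, hf₁, hf₂, hf⟩ := exists_int_sequence (F := fun p => ∀ q, p + m = q → (K.X p ⟶ L.X q))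
    (E := fun p q h f g => ∀ r s (h₁ : p + m = r) (h₂ : q + m = s),
      a.v p s (by omega) = f r h₁ ≫ L.d r s + n.negOnePow • K.d p q ≫ g s h₂)
    (by
      intro p q r h h' f g hfg
      have e := hfg (p + m) (q + m) rfl rfl
      have k := key p q (p + m) (q + m) (r + m) h (by omega) (by omega) (by omega)
      rw [e, Preadditive.add_comp, Category.assoc, L.d_comp_d, Limits.comp_zero, zero_add,
        Linear.units_smul_comp] at k
      have k' := smul_left_cancel _ k
      rw [Category.assoc] at k'
      -- What remains of a in degree q vanishes on the image of the preceding differential of K.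
      -- Since K is exact and the target injective, it extends along the next differential.
      refine ⟨fun s hs => (exactAt_shortComplex_exact hK h h').descToInjective
        (n.negOnePow • (a.v q s (by omega) - g (q + m) rfl ≫ L.d (q + m) s)) ?_, ?_⟩
      · subst hs
        simp only [Linear.comp_units_smul, Preadditive.comp_sub]
        rw [k', sub_self, smul_zero]
      · rintro _ s rfl rfl
        have := (exactAt_shortComplex_exact hK h h').comp_descToInjective
          (n.negOnePow • (a.v q (r + m) (by omega) - g (q + m) rfl ≫ L.d (q + m) (r + m)))
          (by
            simp only [Linear.comp_units_smul, Preadditive.comp_sub]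
            rw [k', sub_self, smul_zero])
        dsimp only at this
        rw [this, smul_smul, Int.units_mul_self, one_smul]
        abel)
    (by
      intro p q r h h' f g hfg
      have e := hfg (q + m) (r + m) rfl rfl
      have k := key p q (p + m) (q + m) (r + m) h (by omega) (by omega) (by omega)
      rw [e, Preadditive.comp_add, Linear.comp_units_smul, K.d_comp_d_assoc,
        Limits.zero_comp, smul_zero, add_zero, ← Category.assoc, ← Linear.units_smul_comp] at k
      -- The dual step: the remaining part of a takes values in cycles of L, so it lifts through the
      -- preceding differential by projectivity of the source.
      have hw : (a.v p (q + m) (by omega) - n.negOnePow • K.d p q ≫ f (q + m) rfl) ≫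
          L.d (q + m) (r + m) = 0 := by
        rw [Preadditive.sub_comp, k, sub_self]
      have ex := exactAt_shortComplex_exact hL (show (p + m) + 1 = q + m by omega)
        (show (q + m) + 1 = r + m by omega)
      refine ⟨fun s hs => ex.liftFromProjective _ hw ≫ eqToHom (by rw [← hs]), ?_⟩
      rintro _ _ rfl rfl
      have := ex.liftFromProjective_comp _ hw
      dsimp only at this
      dsimp only
      rw [eqToHom_refl, Category.comp_id, this]
      abel)
    h₀ (fun q hq => u ≫ eqToHom (by rw [← hr, ← hq]))
    (fun q hq => v ≫ eqToHom (by congr 1; omega))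
    (by
      intro r s h₁ h₂
      obtain rfl : r = r₀ := by omega
      obtain rfl : s = t₀ := by omega
      simpa using H)
  refine ⟨Cochain.mk fun p q hpq => f p q hpq, ?_, ?_, ?_⟩
  · ext p q hpq
    rw [δ_v m n hmn _ p q hpq (q - 1) (p + 1) rfl rfl]
    exact (hf p (p + 1) rfl (q - 1) q (by omega) (by omega)).symm
  · simp [hf₁]
  · simp [hf₂]

end Homotopy

/-! ## Projective modules over the group algebra of a finite group are injective -/

section Trace

variable {k : Type*} [Field k] {G : Type*} [Group G]

theorem MonoidAlgebra.sum_coeff_smul_of [Fintype G] (r : MonoidAlgebra k G) :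
    ∑ g, r.coeff g • MonoidAlgebra.of k G g = r := by
  conv_rhs => rw [← MonoidAlgebra.sum_coeff_single r]
  rw [Finsupp.sum_fintype _ _ (by simp)]
  simp

/-- Higman's criterion for projective modules. -/
theorem Module.Projective.exists_trace_eq_id [Fintype G] {M : Type*} [AddCommGroup M]
    [Module (MonoidAlgebra k G) M] [Module k M] [IsScalarTower k (MonoidAlgebra k G) M]
    (hM : Module.Projective (MonoidAlgebra k G) M) :
    ∃ θ : M →ₗ[k] M, ∀ m, ∑ g : G, MonoidAlgebra.of k G g •
      θ (MonoidAlgebra.of k G g⁻¹ • m) = m := by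
  obtain ⟨s, hs⟩ := Module.projective_def'.1 hM
  -- On the regular module the k-linear projection to the coefficient of 1 has trace the identity,
  -- because the translate by g picks out the coefficient of g.
  let c : MonoidAlgebra k G →ₗ[k] k :=
    { toFun := fun r => r.coeff 1, map_add' := fun _ _ => rfl, map_smul' := fun _ _ => rfl }
  have hc : ∀ (g : G) (r : MonoidAlgebra k G), c (MonoidAlgebra.of k G g⁻¹ * r) = r.coeff g := by
    intro g r
    change (MonoidAlgebra.single g⁻¹ 1 * r).coeff 1 = _
    rw [MonoidAlgebra.coeff_single_mul_apply]
    simp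
  let sk : M →ₗ[k] (M →₀ MonoidAlgebra k G) :=
    { toFun := s
      map_add' := map_add s
      map_smul' := fun r m => by
        rw [← algebraMap_smul (MonoidAlgebra k G) r m, map_smul, algebraMap_smul]; rfl }
  -- That projection on the free module with basis M, transported to M along the splitting `s`.
  let θ : M →ₗ[k] M := Finsupp.linearCombination k id ∘ₗ Finsupp.mapRange.linearMap c ∘ₗ sk
  have hθ : ∀ m, θ m = (s m).sum fun x r => c r • x := by
    intro m
    change Finsupp.linearCombination k id (Finsupp.mapRange c (map_zero c) (s m)) = _
    rw [Finsupp.linearCombination_apply, Finsupp.sum_mapRange_index (fun x => zero_smul k (id x))]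
    rfl
  refine ⟨θ, fun m => ?_⟩
  have h : ∀ g : G, θ (MonoidAlgebra.of k G g⁻¹ • m) = (s m).sum fun x r => r.coeff g • x := by
    intro g
    rw [hθ, map_smul, Finsupp.sum_smul_index (by simp)]
    simp only [hc]
  simp only [h, Finset.smul_sum, Finsupp.sum]
  rw [Finset.sum_comm]
  have h2 := LinearMap.congr_fun hs m
  rw [LinearMap.comp_apply, Finsupp.linearCombination_apply, LinearMap.id_apply] at h2
  conv_rhs => rw [← h2]
  refine Finset.sum_congr rfl fun x _ => ?_
  change _ = s m x • x
  conv_rhs => rw [← MonoidAlgebra.sum_coeff_smul_of (s m x), Finset.sum_smul]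
  refine Finset.sum_congr rfl fun g _ => ?_
  rw [smul_assoc, smul_algebra_smul_comm]

/-- Over the field k every map extends; averaging over G makes the extension equivariant. No
division by the order of G is needed, since the operator θ of Higman's criterion is inserted before
averaging. -/
theorem Module.Projective.injective_of_finite [Finite G] {M : Type*} [AddCommGroup M]
    [Module (MonoidAlgebra k G) M] (hM : Module.Projective (MonoidAlgebra k G) M) :
    Module.Injective (MonoidAlgebra k G) M := by
  have := Fintype.ofFinite G
  refine ⟨fun X Y _ _ _ _ i hi f => ?_⟩
  let R := MonoidAlgebra k G
  let _ : Module k M := Module.compHom M (algebraMap k R)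
  let _ : Module k X := Module.compHom X (algebraMap k R)
  let _ : Module k Y := Module.compHom Y (algebraMap k R)
  have : IsScalarTower k R M := IsScalarTower.of_algebraMap_smul fun _ _ => rfl
  have : IsScalarTower k R X := IsScalarTower.of_algebraMap_smul fun _ _ => rfl
  have : IsScalarTower k R Y := IsScalarTower.of_algebraMap_smul fun _ _ => rfl
  obtain ⟨θ, hθ⟩ := hM.exists_trace_eq_id
  obtain ⟨r, hr⟩ := LinearMap.exists_leftInverse_of_injective (i.restrictScalars k)
    (LinearMap.ker_eq_bot.2 hi)
  have hr' : ∀ x, r (i x) = x := LinearMap.congr_fun hr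
  -- On the image of `i` the trace of this map is the trace of θ applied to f x, that is, f x.
  let F : Y →ₗ[k] M := θ ∘ₗ f.restrictScalars k ∘ₗ r
  let T : Y →ₗ[k] M := ∑ g : G,
    (Algebra.lsmul k k M (MonoidAlgebra.of k G g)) ∘ₗ F ∘ₗ
      (Algebra.lsmul k k Y (MonoidAlgebra.of k G g⁻¹))
  have hT : ∀ y, T y = ∑ g : G, MonoidAlgebra.of k G g • F (MonoidAlgebra.of k G g⁻¹ • y) := by
    intro y
    simp [T, LinearMap.sum_apply]
  have hTg : ∀ (g : G) y, T (MonoidAlgebra.of k G g • y) = MonoidAlgebra.of k G g • T y := by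
    intro g y
    rw [hT, hT, Finset.smul_sum]
    refine Fintype.sum_equiv (Equiv.mulLeft g⁻¹) _ _ fun h => ?_
    simp only [Equiv.coe_mulLeft, smul_smul, ← map_mul, mul_inv_rev, inv_inv, mul_inv_cancel_left]
  refine ⟨{ toFun := T, map_add' := map_add T, map_smul' := fun c y => ?_ }, fun x => ?_⟩
  · conv_lhs => rw [← MonoidAlgebra.sum_coeff_smul_of c]
    conv_rhs => rw [← MonoidAlgebra.sum_coeff_smul_of c]
    simp only [Finset.sum_smul, map_sum, smul_assoc, map_smul, hTg, RingHom.id_apply]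
  · change T (i x) = f x
    rw [hT]
    conv_rhs => rw [← hθ (f x)]
    refine Finset.sum_congr rfl fun g _ => ?_
    congr 1
    change θ (f (r _)) = _
    rw [← map_smul, hr', map_smul]

end Trace

/-! ## A periodic complete resolution for the quaternion group -/

section ListSum

variable (k : Type*) [Field k] {G : Type*} [Group G]

/-- The sum in the group algebra of the entries of a list of group elements. -/
noncomputable def listSum (l : List G) : MonoidAlgebra k G := (l.map (MonoidAlgebra.of k G)).sum

theorem listSum_append (l l' : List G) : listSum k (l ++ l') = listSum k l + listSum k l' := by
  simp [listSum]

theorem listSum_flatMap {α : Type*} (s : List α) (f : α → List G) :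
    listSum k (s.flatMap f) = (s.map fun x => listSum k (f x)).sum := by
  induction s with
  | nil => simp [listSum]
  | cons x s ih => rw [List.flatMap_cons, listSum_append, ih, List.map_cons, List.sum_cons]

/-- The list of products of the entries of two lists. -/
def listMul (l l' : List G) : List G := l.flatMap fun g => l'.map (g * ·)

theorem listSum_map_mul (g : G) (l : List G) :
    listSum k (l.map (g * ·)) = MonoidAlgebra.of k G g * listSum k l := by
  rw [listSum, listSum, List.map_map, ← List.sum_map_mul_left]
  congr 1
  exact List.map_congr_left fun h _ => map_mul _ _ _

theorem listSum_mul (l l' : List G) :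
    listSum k (listMul l l') = listSum k l * listSum k l' := by
  rw [listMul, listSum_flatMap]
  simp only [listSum_map_mul]
  rw [List.sum_map_mul_right]
  rfl

/-- Equal terms cancel in pairs. This reduces the matrix identities over an arbitrary k of
characteristic 2 to decidable statements about lists of group elements. -/
theorem listSum_eq_zero [CharP k 2] [DecidableEq G] (l : List G) (h : ∀ g ∈ l, Even (l.count g)) :
    listSum k l = 0 := by
  rw [listSum, Finset.sum_list_map_count]
  refine Finset.sum_eq_zero fun g hg => ?_
  obtain ⟨n, hn⟩ := h g (List.mem_toFinset.1 hg)
  rw [hn, ← Nat.cast_smul_eq_nsmul k, ← two_mul, Nat.cast_mul, Nat.cast_ofNat,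
    CharTwo.two_eq_zero, zero_mul, zero_smul]

/-- The augmentation of the group algebra. -/
noncomputable def augmentation : MonoidAlgebra k G →ₐ[k] k := MonoidAlgebra.lift k k G 1

theorem augmentation_of (g : G) : augmentation k (MonoidAlgebra.of k G g) = 1 := by
  simp [augmentation]

theorem augmentation_listSum (l : List G) : augmentation k (listSum k l) = l.length := by
  induction l with
  | nil => simp [listSum]
  | cons g l ih =>
    rw [← List.singleton_append, listSum_append, map_add, ih]
    rw [listSum, List.map_singleton, List.sum_singleton, augmentation_of]
    simp [add_comm]

end ListSum

namespace QuaternionResolution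

open QuaternionGroup

/-- The quaternion group of order `8`. -/
abbrev Q8 := QuaternionGroup 2

/-- A table of entries of matrices. -/
abbrev Table := ℕ → ℕ → List Q8

/-- The product of tables, where the matrices to be multiplied have `m` columns and `m` rows. -/
def Table.mul (m : ℕ) (S T : Table) : Table := fun i j =>
  (List.finRange m).flatMap fun (l : Fin m) => listMul (S i l) (T l j)

/-- The sum of tables. -/
def Table.add (S T : Table) : Table := fun i j => S i j ++ T i j

/-- The matrix given by a table vanishes modulo `2`. -/
def Table.IsZero (T : Table) (m n : ℕ) : Prop :=
  ∀ (i : Fin m) (j : Fin n), ∀ g ∈ T i j, Even ((T i j).count g)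

instance (T : Table) (m n : ℕ) : Decidable (T.IsZero m n) := by
  unfold Table.IsZero
  infer_instance

/-- The ranks of the modules in the resolution. -/
def rk : ZMod 4 → ℕ := ![1, 1, 2, 2]

/-- The entries of a list, and the empty list beyond its end. -/
def ofLists (l : List (List (List Q8))) : Table := fun i j => (l.getD i []).getD j []

/-- The differentials. -/
def diffTable : ZMod 4 → Table :=
  ![ofLists [[[a 0, a 1, a 2, a 3, xa 0, xa 1, xa 2, xa 3]]],
    ofLists [[[a 0, a 1], [a 0, xa 3]]],
    ofLists [[[a 0, a 1], [a 0, xa 0]], [[a 0, xa 3], [a 0, a 1]]],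
    ofLists [[[a 0, a 1]], [[a 0, xa 0]]]]

/-- A chain map of degree `1`. -/
def xTable : ZMod 4 → Table :=
  ![ofLists [[[a 0, a 2, xa 0, xa 2]]],
    ofLists [[[a 0], [a 0]]],
    ofLists [[[a 0], []], [[a 0], [a 1]]],
    ofLists [[[a 0]], [[]]]]

/-- A chain map of degree `1`. -/
def yTable : ZMod 4 → Table :=
  ![ofLists [[[a 0, a 1, a 2, a 3]]],
    ofLists [[[], [a 0]]],
    ofLists [[[], [a 0]], [[a 0], []]],
    ofLists [[[]], [[a 0]]]]

/-- The periodicity. -/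
def idTable : Table := ofLists [[[a 0], []], [[], [a 0]]]

/-- The first component of a homotopy between `x² + y² + yx` (or `xy + yx`) and `0`. -/
def qTable : Table := ofLists [[[], []], [[a 0], []]]

/-- The index of a group element in the enumeration `monomial`. -/
def index : Q8 → ℕ
  | a i => ZMod.val i
  | xa i => 4 + ZMod.val i

/-- An enumeration of the group, of period `8`. -/
def monomial (n : ℕ) : Q8 := if n % 8 < 4 then a n else xa n

/-- A contraction of the resolution modulo `2`: it maps the `m`-th element of the basis
`(8 i + j) ↦ monomial j • eᵢ` to the sum of the elements with numbers in the given list. -/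
def contraction : ZMod 4 → List (List ℕ) :=
  ![[[], [0], [2, 3], [3], [6, 7, 14], [3, 11], [14], [6, 14]],
    [[], [], [], [], [], [], [], [0]],
    [[], [], [2], [], [1, 2, 3, 4, 5], [5], [], [6], [], [1, 2], [], [], [3], [], [], [0]],
    [[], [1, 6, 8, 14], [], [], [6, 11], [3, 13], [], [], [6], [6, 8], [3, 10, 13], [],
      [0, 1, 8, 14], [3], [], [14]]]

/-- The `j`-th component of the value of the contraction on `g • eᵢ`. -/
def contractionTable (c : ZMod 4) (i : ℕ) (g : Q8) (j : ℕ) : List Q8 :=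
  (((contraction c).getD (8 * i + index g) []).filter (· / 8 = j)).map monomial

/-- With a = `a 1` and b = `xa 0`, the map from degree 3 to degree 0 has entries 1 + a and 1 + b, so
its image is the augmentation ideal; the map from degree 0 to degree 1 is the norm element, which
splices consecutive periods. -/
theorem diff_diff : ∀ c : ZMod 4,
    ((diffTable c).mul (rk (c + 1)) (diffTable (c + 1))).IsZero (rk c) (rk (c + 1 + 1)) := by
  decide +kernel

theorem x_diff : ∀ c : ZMod 4,
    (((diffTable c).mul (rk (c + 1)) (xTable (c + 1))).add
      ((xTable c).mul (rk (c + 1)) (diffTable (c + 1)))).IsZero (rk c) (rk (c + 1 + 1)) := by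
  decide +kernel

theorem y_diff : ∀ c : ZMod 4,
    (((diffTable c).mul (rk (c + 1)) (yTable (c + 1))).add
      ((yTable c).mul (rk (c + 1)) (diffTable (c + 1)))).IsZero (rk c) (rk (c + 1 + 1)) := by
  decide +kernel

/-- The relation 1 + dh + hd = 0 modulo 2 on the vector g • eᵢ. The contraction h is only k-linear,
so every group element g has to be tested. -/
theorem contraction_spec : ∀ (c : ZMod 4) (i : Fin (rk c)) (g : Q8) (j : Fin (rk c)),
    let l := (if i = j then [g] else []) ++
      ((List.finRange (rk (c - 1))).flatMap fun (m : Fin _) =>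
        listMul (contractionTable c i g m) (diffTable (c - 1) m j)) ++
      ((List.finRange (rk (c + 1))).flatMap fun (m : Fin _) =>
        (diffTable c i m).flatMap fun g' => contractionTable (c + 1) m (g * g') j)
    ∀ g ∈ l, Even (l.count g) := by
  decide +kernel

/-! ### Linear maps given by tables -/

section Maps

variable (k : Type u) [Field k]

/-- The linear map given by a table of entries of a matrix. -/
noncomputable def tableMap (T : Table) (m n : ℕ) :
    (Fin m → MonoidAlgebra k Q8) →ₗ[MonoidAlgebra k Q8] (Fin n → MonoidAlgebra k Q8) :=
  Matrix.toLinearMapRight' (Matrix.of fun i j => listSum k (T i j))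

theorem tableMap_apply (T : Table) (m n : ℕ) (v : Fin m → MonoidAlgebra k Q8) (j : Fin n) :
    tableMap k T m n v j = ∑ i, v i * listSum k (T i j) := rfl

theorem tableMap_single (T : Table) (m n : ℕ) (i : Fin m) (r : MonoidAlgebra k Q8) (j : Fin n) :
    tableMap k T m n (Pi.single i r) j = r * listSum k (T i j) := by
  rw [tableMap_apply, Fintype.sum_eq_single i]
  · rw [Pi.single_eq_same]
  · intro i' hi
    rw [Pi.single_eq_of_ne hi, zero_mul]

/-- Maps of free left modules multiply row vectors by matrices from the right, so composition
reverses the order of the factors. -/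
theorem tableMap_comp (S T : Table) (m n p : ℕ) :
    tableMap k T n p ∘ₗ tableMap k S m n = tableMap k (S.mul n T) m p := by
  refine LinearMap.pi_ext' fun i => LinearMap.ext_ring ?_
  funext j
  change tableMap k T n p (tableMap k S m n (Pi.single i 1)) j =
    tableMap k (S.mul n T) m p (Pi.single i 1) j
  rw [tableMap_single, tableMap_apply]
  simp only [tableMap_single, one_mul, Table.mul, listSum_flatMap, listSum_mul]
  rw [Fin.sum_univ_def]

theorem tableMap_add (S T : Table) (m n : ℕ) :
    tableMap k (S.add T) m n = tableMap k S m n + tableMap k T m n := by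
  refine LinearMap.ext fun v => funext fun j => ?_
  simp only [tableMap_apply, Table.add, listSum_append, mul_add, Finset.sum_add_distrib,
    LinearMap.add_apply, Pi.add_apply]

variable {k} in
theorem tableMap_eq_zero [CharP k 2] {T : Table} {m n : ℕ} (h : T.IsZero m n) :
    tableMap k T m n = 0 := by
  refine LinearMap.ext fun v => funext fun j => ?_
  rw [tableMap_apply]
  exact Finset.sum_eq_zero fun i _ => by rw [listSum_eq_zero k _ (h i j), mul_zero]

/-- The linear map given by `contractionTable`. -/
noncomputable def contractionMap (c : ZMod 4) (n : ℕ) (v : Fin (rk c) → MonoidAlgebra k Q8) :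
    Fin n → MonoidAlgebra k Q8 :=
  fun j => ∑ i, ∑ g, (v i).coeff g • listSum k (contractionTable c i g j)

theorem contractionMap_add (c : ZMod 4) (n : ℕ) (v w : Fin (rk c) → MonoidAlgebra k Q8) :
    contractionMap k c n (v + w) = contractionMap k c n v + contractionMap k c n w := by
  funext j
  simp [contractionMap, add_smul, Finset.sum_add_distrib]

theorem contractionMap_smul (c : ZMod 4) (n : ℕ) (r : k) (v : Fin (rk c) → MonoidAlgebra k Q8) :
    contractionMap k c n (r • v) = r • contractionMap k c n v := by
  funext j
  simp [contractionMap, Finset.smul_sum, smul_smul]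

theorem contractionMap_single (c : ZMod 4) (n : ℕ) (i : Fin (rk c)) (g : Q8) (j : Fin n) :
    contractionMap k c n (Pi.single i (MonoidAlgebra.of k Q8 g)) j =
      listSum k (contractionTable c i g j) := by
  rw [contractionMap, Fintype.sum_eq_single i, Fintype.sum_eq_single g]
  · simp
  · intro g' hg
    simp [hg.symm]
  · intro i' hi
    simp [Pi.single_eq_of_ne hi]

theorem contractionMap_listSum (c : ZMod 4) (n : ℕ) (L : ℕ → List Q8) (j : Fin n) :
    contractionMap k c n (fun i => listSum k (L i)) j =
      ∑ i : Fin (rk c), listSum k ((L i).flatMap fun g => contractionTable c i g j) := by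
  have h : ∀ (i : Fin (rk c)) (l : List Q8),
      contractionMap k c n (Pi.single i (listSum k l)) j =
        listSum k (l.flatMap fun g => contractionTable c i g j) := by
    intro i l
    induction l with
    | nil =>
      have : contractionMap k c n 0 = 0 := by
        rw [← zero_smul k (0 : Fin (rk c) → MonoidAlgebra k Q8), contractionMap_smul, zero_smul]
      simp [listSum, this]
    | cons g l ih =>
      rw [← List.singleton_append, List.flatMap_append, listSum_append, listSum_append,
        Pi.single_add, contractionMap_add, Pi.add_apply, ih]
      congr 1
      rw [listSum, List.map_singleton, List.sum_singleton, contractionMap_single,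
        List.flatMap_singleton]
  simp only [← h]
  conv_lhs => rw [← Finset.univ_sum_single (fun i : Fin (rk c) => listSum k (L i))]
  let φ : (Fin (rk c) → MonoidAlgebra k Q8) →+ MonoidAlgebra k Q8 :=
    { toFun := fun v => contractionMap k c n v j
      map_zero' := by
        rw [← zero_smul k (0 : Fin (rk c) → MonoidAlgebra k Q8), contractionMap_smul, zero_smul]
        rfl
      map_add' := fun v w => by rw [contractionMap_add]; rfl }
  exact map_sum φ _ _

theorem listSum_singleton (g : Q8) : listSum k [g] = MonoidAlgebra.of k Q8 g := by
  simp [listSum]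

end Maps

/-! ### The periodic complex and its exactness -/

section Complex

variable (k : Type u) [Field k] [CharP k 2]

theorem cast_succ {p q : ℤ} (h : p + 1 = q) : (q : ZMod 4) = (p : ZMod 4) + 1 := by
  subst h
  push_cast
  rfl

open scoped Classical in
/-- A minimal periodic complete resolution of the trivial module. -/
noncomputable def complex : CochainComplex (ModuleCat.{u} (MonoidAlgebra k Q8)) ℤ where
  X p := ModuleCat.of _ (Fin (rk p) → MonoidAlgebra k Q8)
  d p q := if p + 1 = q then ModuleCat.ofHom (tableMap k (diffTable p) (rk p) (rk q)) else 0
  shape p q h := if_neg h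
  d_comp_d' p q r h h' := by
    rw [if_pos (show p + 1 = q from h), if_pos (show q + 1 = r from h'), ← ModuleCat.ofHom_comp, tableMap_comp, tableMap_eq_zero]
    · rfl
    · have := diff_diff p
      rwa [← cast_succ h, ← cast_succ h'] at this

theorem complex_d {p q : ℤ} (h : p + 1 = q) :
    (complex k).d p q = ModuleCat.ofHom (tableMap k (diffTable p) (rk p) (rk q)) := if_pos h

theorem projective (p : ℤ) : Module.Projective (MonoidAlgebra k Q8) ((complex k).X p) :=
  inferInstanceAs (Module.Projective (MonoidAlgebra k Q8) (Fin (rk p) → MonoidAlgebra k Q8))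

/-- Both sides are k-linear in v, so it suffices to take v = g • eᵢ, where the tables have been
checked. Exactness follows: a cycle v is the boundary of its contraction. -/
theorem contraction_homotopy (c : ZMod 4) (v : Fin (rk c) → MonoidAlgebra k Q8) :
    tableMap k (diffTable (c - 1)) (rk (c - 1)) (rk c) (contractionMap k c (rk (c - 1)) v) +
      contractionMap k (c + 1) (rk c) (tableMap k (diffTable c) (rk c) (rk (c + 1)) v) = v := by
  have key : ∀ (i : Fin (rk c)) (g : Q8), ∀ v, v = Pi.single i (MonoidAlgebra.of k Q8 g) →
      tableMap k (diffTable (c - 1)) (rk (c - 1)) (rk c) (contractionMap k c (rk (c - 1)) v) +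
      contractionMap k (c + 1) (rk c) (tableMap k (diffTable c) (rk c) (rk (c + 1)) v) = v := by
    rintro i g _ rfl
    funext j
    have h := listSum_eq_zero k _ (contraction_spec c i g j)
    rw [listSum_append, listSum_append, add_assoc] at h
    have h₁ : listSum k (if i = j then [g] else []) =
        (Pi.single i (MonoidAlgebra.of k Q8 g) : Fin (rk c) → MonoidAlgebra k Q8) j := by
      rw [Pi.single_apply]
      by_cases hij : i = j
      · rw [if_pos hij, if_pos hij.symm, listSum_singleton]
      · rw [if_neg hij, if_neg (Ne.symm hij)]
        rfl
    rw [h₁] at h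
    have hn : ∀ x y : MonoidAlgebra k Q8, x + y = 0 → y = x := by
      intro x y hxy
      have h2 : x + x = 0 := by
        rw [← two_smul k x, CharTwo.two_eq_zero, zero_smul]
      exact add_left_cancel (hxy.trans h2.symm)
    refine Eq.trans ?_ (hn _ _ h)
    rw [Pi.add_apply]
    congr 1
    · rw [tableMap_apply, listSum_flatMap, Fin.sum_univ_def]
      simp only [contractionMap_single, listSum_mul]
    · rw [listSum_flatMap, ← Fin.sum_univ_def]
      have h₃ : tableMap k (diffTable c) (rk c) (rk (c + 1))
          (Pi.single i (MonoidAlgebra.of k Q8 g)) =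
          fun m : Fin (rk (c + 1)) => listSum k ((diffTable c i m).map (g * ·)) := by
        funext m
        rw [tableMap_single, listSum_map_mul]
      rw [h₃, contractionMap_listSum k (c + 1) (rk c) (fun m => (diffTable c i m).map (g * ·))]
      refine Finset.sum_congr rfl fun m _ => ?_
      rw [List.flatMap_map]
  let Φ : (Fin (rk c) → MonoidAlgebra k Q8) →ₗ[k] (Fin (rk c) → MonoidAlgebra k Q8) :=
    { toFun := fun v =>
        tableMap k (diffTable (c - 1)) (rk (c - 1)) (rk c) (contractionMap k c (rk (c - 1)) v) +
          contractionMap k (c + 1) (rk c) (tableMap k (diffTable c) (rk c) (rk (c + 1)) v)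
      map_add' := fun v w => by
        simp only [contractionMap_add, map_add]
        abel
      map_smul' := fun r v => by
        simp only [contractionMap_smul, LinearMap.map_smul_of_tower, RingHom.id_apply, smul_add] }
  have hΦ : Φ = LinearMap.id := by
    refine LinearMap.pi_ext' fun i => MonoidAlgebra.lhom_ext' fun g => LinearMap.ext_ring ?_
    exact key i g _ rfl
  exact LinearMap.congr_fun hΦ v

theorem acyclic : (complex k).Acyclic := by
  intro q
  rw [(complex k).exactAt_iff' (q - 1) q (q + 1) (by simp) (by simp),
    ShortComplex.moduleCat_exact_iff]
  intro v hv
  change Fin (rk q) → MonoidAlgebra k Q8 at v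
  have e : ((q - 1 : ℤ) : ZMod 4) = (q : ZMod 4) - 1 := by push_cast; rfl
  have h := contraction_homotopy k q v
  have hv' : tableMap k (diffTable q) (rk q) (rk ((q : ZMod 4) + 1)) v = 0 := by
    rw [← cast_succ (rfl : q + 1 = q + 1)]
    change (ConcreteCategory.hom ((complex k).d q (q + 1))) v = 0 at hv
    rwa [complex_d k rfl] at hv
  have h0 : contractionMap k ((q : ZMod 4) + 1) (rk q) 0 = 0 := by
    rw [← zero_smul k (0 : Fin (rk ((q : ZMod 4) + 1)) → MonoidAlgebra k Q8),
      contractionMap_smul, zero_smul]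
  rw [hv', h0, add_zero, ← e] at h
  refine ⟨contractionMap k q (rk (q - 1 : ℤ)) v, ?_⟩
  change (ConcreteCategory.hom ((complex k).d (q - 1) q)) _ = _
  rw [complex_d k (by ring)]
  exact h

end Complex

end QuaternionResolution

/-! ## Comparison of complete resolutions -/

namespace CompleteResolution

variable {k : Type u} [Field k] {G : Type} [Group G]

theorem trivial_smul (r : MonoidAlgebra k G) (c : (Representation.trivial k G k).asModule) :
    r • c = (augmentation k r : k) • c := by
  induction r using MonoidAlgebra.induction_linear with
  | zero => rw [zero_smul, map_zero, zero_smul]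
  | add r r' h h' => rw [add_smul, h, h', map_add, add_smul]
  | single g x =>
    have e : MonoidAlgebra.single g x = x • MonoidAlgebra.of k G g := by simp
    rw [e, map_smul, augmentation_of, smul_eq_mul, mul_one, smul_assoc]
    congr 1
    exact Representation.single_smul (ρ := Representation.trivial k G k) 1 g c |>.trans (by simp; rfl)

variable (P Q : CompleteResolution k G)

theorem injective_X [Finite G] (p : ℤ) : Injective (P.K.X p) :=
  (Module.injective_iff_injective_object _ _).1 (P.projective p).injective_of_finite

theorem projective_X (p : ℤ) : Projective (P.K.X p) :=
  (IsProjective.iff_projective _).1 (P.projective p)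

theorem ε_d {q : ℤ} (x : P.K.X q) : P.ε (P.K.d q 0 x) = 0 := by
  by_cases h : q + 1 = 0
  · obtain rfl : q = -1 := by omega
    exact P.exact.apply_apply_eq_zero x
  · rw [P.K.shape q 0 h]
    exact map_zero P.ε

/-- A map to the component of degree `0` which is annihilated by the augmentation lifts along the
differential. -/
theorem exists_lift {X : ModuleCat.{u} (MonoidAlgebra k G)} [Projective X] (b : X ⟶ P.K.X 0)
    (hb : ∀ x, P.ε (b x) = 0) : ∃ u : X ⟶ P.K.X (-1), u ≫ P.K.d (-1) 0 = b := by
  have ex := exactAt_shortComplex_exact P.acyclic (show (-1 : ℤ) + 1 = 0 by rfl)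
    (show (0 : ℤ) + 1 = 1 by rfl)
  have hw : b ≫ P.K.d 0 1 = 0 := by
    ext x
    obtain ⟨y, hy⟩ := (P.exact (b x)).1 (hb x)
    change P.K.d 0 1 (b x) = 0
    rw [← hy]
    exact ConcreteCategory.congr_hom (P.K.d_comp_d (-1) 0 1) y
  exact ⟨ex.liftFromProjective b hw, ex.liftFromProjective_comp b hw⟩

variable {P Q}

/-- A cocycle is a coboundary if its composite with the augmentation vanishes. -/
theorem exists_primitive [Finite G] {m n : ℤ} (hmn : m + 1 = n) (b : Cochain P.K Q.K n)
    (hb : δ n (n + 1) b = 0) {p : ℤ} (hp : p + n = 0) (h : ∀ x, Q.ε (b.v p 0 hp x) = 0) :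
    ∃ c : Cochain P.K Q.K m, δ m n c = b := by
  have := P.projective_X p
  obtain ⟨u, hu⟩ := Q.exists_lift (b.v p 0 hp) h
  -- The lift u alone accounts for the component of b ending in degree 0, so the next component of
  -- the homotopy may start as 0.
  obtain ⟨c, hc, -⟩ := exists_delta_eq P.acyclic Q.acyclic P.projective_X Q.injective_X hmn rfl b hb
    (rfl : p + 1 = p + 1) (show p + m = -1 by omega) hp u 0 (by simp [hu])
  exact ⟨c, hc⟩

/-- A homotopy between a cocycle and zero, with two components given. -/
theorem exists_primitive_of_components [Finite G] {m n : ℤ} (hmn : m + 1 = n)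
    (b : Cochain P.K Q.K n) (hb : δ n (n + 1) b = 0) {p₀ q₀ r₀ t₀ : ℤ} (h₀ : p₀ + 1 = q₀)
    (hr : p₀ + m = r₀) (ht : p₀ + n = t₀)
    (u : P.K.X p₀ ⟶ Q.K.X r₀) (v : P.K.X q₀ ⟶ Q.K.X t₀)
    (H : b.v p₀ t₀ ht = u ≫ Q.K.d r₀ t₀ + n.negOnePow • P.K.d p₀ q₀ ≫ v) :
    ∃ c : Cochain P.K Q.K m, δ m n c = b ∧ c.v p₀ r₀ hr = u ∧ c.v q₀ t₀ (by omega) = v :=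
  exists_delta_eq P.acyclic Q.acyclic P.projective_X Q.injective_X hmn rfl b hb h₀ hr ht u v H

variable (P Q)

/-- There is a map of complete resolutions over the identity of the trivial module. -/
theorem exists_hom [Finite G] : ∃ f : P.K ⟶ Q.K, ∀ x, Q.ε (f.f 0 x) = P.ε x := by
  have := P.projective 0
  obtain ⟨u₀, hu₀⟩ := Module.projective_lifting_property Q.ε P.ε Q.surjective
  replace hu₀ : ∀ x, Q.ε (u₀ x) = P.ε x := LinearMap.congr_fun hu₀
  have := P.projective_X (-1)
  obtain ⟨u, hu⟩ := Q.exists_lift (-(P.K.d (-1) 0 ≫ ModuleCat.ofHom u₀)) (fun x => by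
    change Q.ε (-u₀ (P.K.d (-1) 0 x)) = 0
    rw [map_neg, hu₀, P.ε_d, neg_zero])
  -- The family with u₀ in degree 0 and zero elsewhere is not a chain map. Its coboundary has a
  -- primitive c whose component in degree 0 vanishes, so a - c is a chain map which still equals u₀
  -- there.
  let a : Cochain P.K Q.K 0 := Cochain.single (ModuleCat.ofHom u₀) 0
  have ha : a.v 0 0 (add_zero 0) = ModuleCat.ofHom u₀ := Cochain.single_v _ _ _
  have ha' : a.v (-1) (-1) (add_zero (-1)) = 0 := Cochain.single_v_eq_zero _ _ _ _ _ (by simp)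
  obtain ⟨c, hc, -, hc'⟩ := exists_primitive_of_components (P := P) (Q := Q) (zero_add 1)
    (δ 0 1 a) (δ_δ _ _ _ _) (show (-1 : ℤ) + 1 = 0 by rfl) (show (-1 : ℤ) + 0 = -1 by rfl)
    (show (-1 : ℤ) + 1 = 0 by rfl) u 0 (by
      rw [δ_v 0 1 rfl a (-1) 0 _ (-1) 0 rfl rfl, ha, ha', hu]
      simp)
  refine ⟨Cocycle.homOf (Cocycle.mk (a - c) 1 rfl (by rw [δ_sub, hc, sub_self])), fun x => ?_⟩
  change Q.ε ((a.v 0 0 _ - c.v 0 0 _) x) = _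
  rw [ha, hc', sub_zero]
  exact hu₀ x

variable {P Q}

/-- Endomorphisms of a complete resolution over the identity are homotopic to the identity. -/
theorem exists_homotopy [Finite G] (f : P.K ⟶ P.K) (hf : ∀ x, P.ε (f.f 0 x) = P.ε x) :
    ∃ c : Cochain P.K P.K (-1), δ (-1) 0 c = Cochain.ofHom f - Cochain.ofHom (𝟙 P.K) := by
  refine exists_primitive (p := 0) (by rfl) _ (by simp) rfl fun x => ?_
  change P.ε (((Cochain.ofHom f).v 0 0 _ - (Cochain.ofHom (𝟙 P.K)).v 0 0 _) x) = 0
  rw [Cochain.ofHom_v, Cochain.ofHom_v]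
  change P.ε (f.f 0 x - x) = 0
  rw [map_sub, hf, sub_self]

end CompleteResolution

/-! ## Minimality of the periodic resolution -/

namespace QuaternionResolution

open QuaternionGroup

variable {k : Type u} [Field k]

/-- A 2-group acting in characteristic 2 fixes a nonzero vector of every nonzero module. The
argument climbs the chain of subgroups generated by a², by a, and by a together with b, each of
index 2 in the next. -/
theorem exists_fixed_vector [CharP k 2] {M : Type*} [AddCommGroup M] [Module (MonoidAlgebra k Q8) M]
    (S : Submodule (MonoidAlgebra k Q8) M) {v : M} (hv : v ∈ S) (hv₀ : v ≠ 0) :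
    ∃ w ∈ S, w ≠ 0 ∧ ∀ g, MonoidAlgebra.of k Q8 g • w = w := by
  have two : ∀ m : M, m + m = 0 := fun m => by
    have h2 : algebraMap k (MonoidAlgebra k Q8) 2 = 0 := by
      rw [CharTwo.two_eq_zero (R := k), map_zero]
    rw [← two_smul (MonoidAlgebra k Q8), ← map_ofNat (algebraMap k (MonoidAlgebra k Q8)) 2]
    exact (congrArg (· • m) h2).trans (zero_smul _ m)
  -- If g² fixes w, then gw + w is fixed by g; when it is zero, w itself is fixed. The alternative
  -- is recorded so that invariance under the smaller subgroup can be checked for the new vector.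
  have step : ∀ g : Q8, ∀ w ∈ S, w ≠ 0 → MonoidAlgebra.of k Q8 (g * g) • w = w →
      ∃ w' ∈ S, w' ≠ 0 ∧ MonoidAlgebra.of k Q8 g • w' = w' ∧
        (w' = w ∨ w' = MonoidAlgebra.of k Q8 g • w + w) := by
    intro g w hw hw₀ h
    by_cases hg : MonoidAlgebra.of k Q8 g • w = w
    · exact ⟨w, hw, hw₀, hg, Or.inl rfl⟩
    · refine ⟨MonoidAlgebra.of k Q8 g • w + w, S.add_mem (S.smul_mem _ hw) hw, fun h0 => hg ?_, ?_,
        Or.inr rfl⟩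
      · exact add_right_cancel (h0.trans (two w).symm)
      · rw [smul_add, smul_smul, ← map_mul, h, add_comm]
  obtain ⟨w₁, h₁, h₁', h₁z, -⟩ := step (a 2) v hv hv₀ (by
    rw [show (a 2 * a 2 : Q8) = 1 by decide, map_one, one_smul])
  obtain ⟨w₂, h₂, h₂', h₂a, -⟩ := step (a 1) w₁ h₁ h₁' (by
    rwa [show (a 1 * a 1 : Q8) = a 2 by decide])
  have h₂i : ∀ i : ZMod 4, MonoidAlgebra.of k Q8 (a i) • w₂ = w₂ := by
    intro i
    have : ∀ n : ℕ, MonoidAlgebra.of k Q8 (a 1 ^ n) • w₂ = w₂ := by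
      intro n
      induction n with
      | zero => rw [pow_zero, map_one, one_smul]
      | succ n ih => rw [pow_succ, map_mul, mul_smul, h₂a, ih]
    have e : (a i : Q8) = a 1 ^ i.val := by
      revert i
      decide
    rw [e, this]
  obtain ⟨w₃, h₃, h₃', h₃b, h₃e⟩ := step (xa 0) w₂ h₂ h₂' (by
    rw [show (xa 0 * xa 0 : Q8) = a 2 by decide, h₂i])
  have h₃i : ∀ i : ZMod 4, MonoidAlgebra.of k Q8 (a i) • w₃ = w₃ := by
    intro i
    rcases h₃e with rfl | rfl
    · exact h₂i i
    · rw [smul_add, smul_smul, ← map_mul, show (a i * xa 0 : Q8) = xa 0 * a (-i) by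
        revert i; decide, map_mul, mul_smul, h₂i, h₂i]
  refine ⟨w₃, h₃, h₃', ?_⟩
  rintro (i | i)
  · exact h₃i i
  · rw [show (xa i : Q8) = xa 0 * a i by revert i; decide, map_mul, mul_smul, h₃i, h₃b]

variable (k) in
/-- The norm element. -/
noncomputable def norm : MonoidAlgebra k Q8 := ∑ g : Q8, MonoidAlgebra.of k Q8 g

theorem norm_mul (r : MonoidAlgebra k Q8) : norm k * r = augmentation k r • norm k := by
  induction r using MonoidAlgebra.induction_linear with
  | zero => simp
  | add r r' h h' => rw [mul_add, h, h', map_add, add_smul]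
  | single g x =>
    have e : MonoidAlgebra.single g x = x • MonoidAlgebra.of k Q8 g := by simp
    rw [e, map_smul, augmentation_of, smul_eq_mul, mul_one, mul_smul_comm]
    congr 1
    rw [norm, Finset.sum_mul]
    exact Fintype.sum_equiv (Equiv.mulRight g) _ _ fun h => (map_mul _ _ _).symm

theorem mul_norm (r : MonoidAlgebra k Q8) : r * norm k = augmentation k r • norm k := by
  induction r using MonoidAlgebra.induction_linear with
  | zero => simp
  | add r r' h h' => rw [add_mul, h, h', map_add, add_smul]
  | single g x =>
    have e : MonoidAlgebra.single g x = x • MonoidAlgebra.of k Q8 g := by simp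
    rw [e, map_smul, augmentation_of, smul_eq_mul, mul_one, smul_mul_assoc]
    congr 1
    rw [norm, Finset.mul_sum]
    exact Fintype.sum_equiv (Equiv.mulLeft g) _ _ fun h => (map_mul _ _ _).symm

theorem eq_smul_norm {r : MonoidAlgebra k Q8} (h : ∀ g, MonoidAlgebra.of k Q8 g * r = r) :
    r = r.coeff 1 • norm k := by
  conv_lhs => rw [← MonoidAlgebra.sum_coeff_smul_of r]
  rw [norm, Finset.smul_sum]
  refine Finset.sum_congr rfl fun g _ => ?_
  congr 1
  conv_lhs => rw [← h g]
  change (MonoidAlgebra.single g 1 * r).coeff g = _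
  rw [MonoidAlgebra.coeff_single_mul_apply]
  simp

theorem listSum_norm :
    listSum k [a 0, a 1, a 2, a 3, xa 0, xa 1, xa 2, xa 3] = norm k := by
  rw [listSum, norm, show (Finset.univ : Finset Q8) =
    [a 0, a 1, a 2, a 3, xa 0, xa 1, xa 2, xa 3].toFinset by decide,
    List.sum_toFinset _ (by decide)]

/-- A vector all of whose components have augmentation zero. -/
def IsSmall {n : ℕ} (v : Fin n → MonoidAlgebra k Q8) : Prop := ∀ i, augmentation k (v i) = 0

theorem IsSmall.add {n : ℕ} {v w : Fin n → MonoidAlgebra k Q8} (hv : IsSmall v) (hw : IsSmall w) :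
    IsSmall (v + w) := fun i => by rw [Pi.add_apply, map_add, hv, hw, add_zero]

theorem augmentation_apply {m n : ℕ}
    (f : (Fin m → MonoidAlgebra k Q8) →ₗ[MonoidAlgebra k Q8] (Fin n → MonoidAlgebra k Q8))
    (v : Fin m → MonoidAlgebra k Q8) (j : Fin n) :
    augmentation k (f v j) = ∑ i, augmentation k (v i) * augmentation k (f (Pi.single i 1) j) := by
  conv_lhs => rw [pi_eq_sum_univ' v, map_sum, Finset.sum_apply, map_sum]
  refine Finset.sum_congr rfl fun i _ => ?_
  rw [map_smul, Pi.smul_apply, smul_eq_mul, map_mul]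

theorem IsSmall.map {m n : ℕ} {v : Fin m → MonoidAlgebra k Q8} (hv : IsSmall v)
    (f : (Fin m → MonoidAlgebra k Q8) →ₗ[MonoidAlgebra k Q8] (Fin n → MonoidAlgebra k Q8)) :
    IsSmall (f v) := fun j => by
  rw [augmentation_apply]
  exact Finset.sum_eq_zero fun i _ => by rw [hv i, zero_mul]

/-- An endomorphism that is the identity up to small vectors is bijective. -/
theorem bijective_of_isSmall_sub [CharP k 2] {n : ℕ}
    (f : (Fin n → MonoidAlgebra k Q8) →ₗ[MonoidAlgebra k Q8] (Fin n → MonoidAlgebra k Q8))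
    (hf : ∀ v, IsSmall (f v - v)) : Function.Bijective f := by
  have hinj : Function.Injective f := by
    rw [← LinearMap.ker_eq_bot, Submodule.eq_bot_iff]
    intro v hv
    by_contra hv₀
    obtain ⟨w, hw, hw₀, hg⟩ := exists_fixed_vector _ hv hv₀
    have hwn : w = fun i => (w i).coeff 1 • norm k := funext fun i =>
      eq_smul_norm fun g => congrFun (hg g) i
    apply hw₀
    -- A fixed vector of the kernel is the norm element times a vector w' of scalars. The norm
    -- element kills f w' - w', as its components have augmentation zero; hence f w = w, and w = 0.
    let w' : Fin n → MonoidAlgebra k Q8 := fun i => algebraMap k _ ((w i).coeff 1)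
    have hw' : w = norm k • w' := by
      rw [hwn]
      funext i
      rw [Pi.smul_apply, smul_eq_mul, Algebra.smul_def, Algebra.commutes]
    have h0 : norm k • (f w' - w') = 0 := by
      funext i
      rw [Pi.smul_apply, smul_eq_mul, norm_mul, hf w' i, zero_smul]
      rfl
    rw [smul_sub, ← map_smul, ← hw', LinearMap.mem_ker.1 hw, zero_sub, neg_eq_zero] at h0
    exact h0
  exact ⟨hinj, LinearMap.injective_iff_surjective (f := f.restrictScalars k) |>.1 hinj⟩

theorem augmentation_diff [CharP k 2] {c c' : ZMod 4} (h : c' = c + 1) (i : Fin (rk c))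
    (j : Fin (rk c')) : augmentation k (listSum k (diffTable c i j)) = 0 := by
  have : ∀ (c : ZMod 4) (i : Fin (rk c)) (j : Fin (rk (c + 1))), Even (diffTable c i j).length := by
    decide
  subst h
  obtain ⟨n, hn⟩ := this c i j
  rw [augmentation_listSum, hn, ← two_mul, Nat.cast_mul, Nat.cast_ofNat, CharTwo.two_eq_zero,
    zero_mul]

theorem isSmall_diff [CharP k 2] {c c' : ZMod 4} (h : c' = c + 1)
    (v : Fin (rk c) → MonoidAlgebra k Q8) :
    IsSmall (tableMap k (diffTable c) (rk c) (rk c') v) := fun j => by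
  rw [tableMap_apply, map_sum]
  exact Finset.sum_eq_zero fun i _ => by rw [map_mul, augmentation_diff h, mul_zero]

variable (k) in
/-- The sum of the augmentations of the components. -/
noncomputable def augmentationSum (n : ℕ) : (Fin n → MonoidAlgebra k Q8)
    →ₗ[MonoidAlgebra k Q8] (Representation.trivial k Q8 k).asModule where
  toFun v := (∑ i, augmentation k (v i) : k)
  map_add' v w := by
    simp only [Pi.add_apply, map_add, Finset.sum_add_distrib]
    rfl
  map_smul' r v := by
    refine Eq.trans ?_ (CompleteResolution.trivial_smul r _).symm
    simp only [Pi.smul_apply, smul_eq_mul, map_mul, ← Finset.mul_sum]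
    rfl

theorem augmentationSum_eq_zero {n : ℕ} {v : Fin n → MonoidAlgebra k Q8} (h : IsSmall v) :
    augmentationSum k n v = 0 :=
  show ∑ i, augmentation k (v i) = 0 from Finset.sum_eq_zero fun i _ => h i

variable (k) in
/-- The periodic complete resolution. -/
noncomputable def resolution [CharP k 2] : CompleteResolution k Q8 where
  K := complex k
  projective := projective k
  acyclic := acyclic k
  ε := augmentationSum k 1
  surjective := fun c => by
    refine ⟨fun _ => algebraMap k _ c, ?_⟩
    change ∑ i : Fin 1, augmentation k (algebraMap k (MonoidAlgebra k Q8) c) = c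
    rw [Fin.sum_univ_one]
    exact AlgHom.commutes (augmentation k) (c : k)
  exact := by
    intro v
    change Fin 1 → MonoidAlgebra k Q8 at v
    constructor
    · intro hv
      replace hv : augmentation k (v 0) = 0 := by
        change ∑ i : Fin 1, augmentation k (v i) = 0 at hv
        simpa using hv
      -- The differential leaving degree 0 multiplies by the norm element, hence kills every element
      -- of augmentation zero; exactness of the complex then yields a preimage.
      have ex := exactAt_shortComplex_exact (acyclic k) (show (-1 : ℤ) + 1 = 0 by rfl)
        (show (0 : ℤ) + 1 = 1 by rfl)
      refine (ShortComplex.moduleCat_exact_iff _).1 ex v ?_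
      change ((complex k).d 0 1) v = 0
      rw [complex_d k (by rfl)]
      change tableMap k (diffTable 0) 1 1 v = 0
      funext j
      rw [tableMap_apply, Fin.sum_univ_one]
      obtain rfl : j = 0 := Subsingleton.elim _ _
      change v 0 * listSum k [a 0, a 1, a 2, a 3, xa 0, xa 1, xa 2, xa 3] = 0
      rw [listSum_norm, mul_norm, hv, zero_smul]
    · rintro ⟨x, rfl⟩
      rw [complex_d k (by rfl)]
      exact augmentationSum_eq_zero (isSmall_diff (by rfl) x)

theorem apply_sub_eq {R : Type*} [Ring R] {M N N' : ModuleCat R} (α : M ⟶ N) (β : N ⟶ M)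
    (γ : M ⟶ N') (η : N' ⟶ M) (φ : M ⟶ M) (h : α ≫ β + γ ≫ η = φ - 𝟙 M) (v : M) :
    φ.hom v - v = β.hom (α.hom v) + η.hom (γ.hom v) :=
  (ConcreteCategory.congr_hom h v).symm

/-- Such a φ is homotopic to the identity. By minimality φ - 1 = dh + hd has values of augmentation
zero, which forces bijectivity in each degree. -/
theorem isIso_of_homotopy [CharP k 2] (φ : complex k ⟶ complex k)
    (hφ : ∀ x : (complex k).X 0, augmentationSum k 1 (φ.f 0 x) = augmentationSum k 1 x) :
    IsIso φ := by
  obtain ⟨c, hc⟩ : ∃ c : Cochain (complex k) (complex k) (-1),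
      δ (-1) 0 c = Cochain.ofHom φ - Cochain.ofHom (𝟙 (complex k)) :=
    CompleteResolution.exists_homotopy (P := resolution k) φ hφ
  have hbij : ∀ p, Function.Bijective (φ.f p) := by
    intro p
    refine bijective_of_isSmall_sub (n := rk p) (φ.f p).hom fun v => ?_
    have h := Cochain.congr_v hc p p (add_zero p)
    rw [δ_v (-1) 0 (by rfl) c p p _ (p - 1) (p + 1) rfl rfl, Cochain.sub_v, Cochain.ofHom_v,
      Cochain.ofHom_v, complex_d k (by omega), complex_d k rfl, Int.negOnePow_zero,
      one_smul] at h
    have e := apply_sub_eq _ _ _ _ _ h v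
    refine (congrArg (IsSmall (n := rk p)) e).mpr ?_
    exact IsSmall.add (isSmall_diff (cast_succ (by omega)) _)
      (IsSmall.map (m := rk (p + 1 : ℤ)) (n := rk p) (isSmall_diff (cast_succ rfl) v)
        (c.v (p + 1) p (by omega)).hom)
  have : ∀ p, IsIso (φ.f p) := fun p => (ConcreteCategory.isIso_iff_bijective _).2 (hbij p)
  exact HomologicalComplex.Hom.isIso_of_components _

/-- The periodic resolution is a direct summand of every complete resolution, as a complex. -/
theorem exists_retraction [CharP k 2] (P : CompleteResolution k Q8) :
    ∃ (f : complex k ⟶ P.K) (g : P.K ⟶ complex k), f ≫ g = 𝟙 _ ∧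
      ∃ c : Cochain P.K P.K (-1), δ (-1) 0 c = Cochain.ofHom (g ≫ f) - Cochain.ofHom (𝟙 P.K) := by
  obtain ⟨f, hf⟩ : ∃ f : complex k ⟶ P.K, ∀ x : (complex k).X 0,
    P.ε (f.f 0 x) = augmentationSum k 1 x := (resolution k).exists_hom P
  obtain ⟨g, hg⟩ : ∃ g : P.K ⟶ complex k, ∀ x : P.K.X 0,
    augmentationSum k 1 (g.f 0 x) = P.ε x := P.exists_hom (resolution k)
  have hfg : ∀ x : (complex k).X 0,
      augmentationSum k 1 ((f ≫ g).f 0 x) = augmentationSum k 1 x :=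
    fun x => (hg _).trans (hf x)
  -- The comparison maps compose only to an automorphism of the periodic resolution; composing g
  -- with its inverse makes the retraction strict and still respects the augmentation.
  have := isIso_of_homotopy (f ≫ g) hfg
  have hinv : ∀ x : (complex k).X 0,
      augmentationSum k 1 ((inv (f ≫ g)).f 0 x) = augmentationSum k 1 x := by
    intro x
    refine (hfg _).symm.trans (congrArg _ ?_)
    exact ConcreteCategory.congr_hom
      (congrArg (fun φ => HomologicalComplex.Hom.f φ 0) (IsIso.inv_hom_id (f ≫ g))) x
  refine ⟨f, g ≫ inv (f ≫ g), by rw [← Category.assoc, IsIso.hom_inv_id], ?_⟩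
  refine CompleteResolution.exists_homotopy (P := P) _ fun x => ?_
  exact (hf _).trans ((hinv _).trans (hg x))

end QuaternionResolution

/-! ## Recognition of the quaternion presentation -/

namespace GrAlg

variable {k : Type u} [Field k] {Λ : GrAlg.{w} k}

theorem of_mul {m n p : ℤ} (h : m + n = p) (a : Λ.X m) (b : Λ.X n) :
    DirectSum.of Λ.X p (Λ.mul h a b) = DirectSum.of Λ.X m a * DirectSum.of Λ.X n b := by
  subst h
  exact (DirectSum.of_mul_of a b).symm

theorem of_one : DirectSum.of Λ.X 0 Λ.one = 1 := rfl

theorem of_smul (r : k) {n : ℤ} (a : Λ.X n) :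
    DirectSum.of Λ.X n (r • a) = r • DirectSum.of Λ.X n a :=
  map_smul (DirectSum.lof k ℤ Λ.X n) r a

theorem of_injective (n : ℤ) : Function.Injective (DirectSum.of Λ.X n) :=
  DirectSum.of_injective n

variable (Λ) in
/-- Coordinates on a graded algebra with respect to the basis formed by the monomials
`s^m, x s^m, y s^m, y² s^m, xy s^m, x²y s^m`. -/
structure QuaternionCoordinates (x y : Λ.X 1) (s : Λ.X 4) (t : Λ.X (-4)) where
  ev : ∀ n, Λ.X n →ₗ[k] (Fin 2 → k)
  ev_injective : ∀ n, Function.Injective (ev n)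
  ev_mul_s : ∀ {m n : ℤ} (h : m + 4 = n) (b : Λ.X m), ev n (Λ.mul h b s) = ev m b
  ev_snd : ∀ {n : ℤ}, n % 4 = 0 ∨ n % 4 = 3 → ∀ b : Λ.X n, ev n b 1 = 0
  s_t : Λ.mul (add_neg_cancel 4) s t = Λ.one
  t_s : Λ.mul (neg_add_cancel 4) t s = Λ.one
  s_x : Λ.mul (show (4 : ℤ) + 1 = 5 by rfl) s x = Λ.mul (show (1 : ℤ) + 4 = 5 by rfl) x s
  s_y : Λ.mul (show (4 : ℤ) + 1 = 5 by rfl) s y = Λ.mul (show (1 : ℤ) + 4 = 5 by rfl) y s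
  ev_one : ev 0 Λ.one = ![1, 0]
  ev_x : ev 1 x = ![1, 0]
  ev_y : ev 1 y = ![0, 1]
  ev_xx : ev 2 (Λ.mul (show (1 : ℤ) + 1 = 2 by rfl) x x) = ![1, 1]
  ev_xy : ev 2 (Λ.mul (show (1 : ℤ) + 1 = 2 by rfl) x y) = ![0, 1]
  ev_yx : ev 2 (Λ.mul (show (1 : ℤ) + 1 = 2 by rfl) y x) = ![0, 1]
  ev_yy : ev 2 (Λ.mul (show (1 : ℤ) + 1 = 2 by rfl) y y) = ![1, 0]
  ev_xxy : ev 3 (Λ.mul (show (2 : ℤ) + 1 = 3 by rfl)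
    (Λ.mul (show (1 : ℤ) + 1 = 2 by rfl) x x) y) = ![1, 0]
  ev_xyy : ev 3 (Λ.mul (show (2 : ℤ) + 1 = 3 by rfl)
    (Λ.mul (show (1 : ℤ) + 1 = 2 by rfl) x y) y) = ![1, 0]

namespace QuaternionCoordinates

variable {x y : Λ.X 1} {s : Λ.X 4} {t : Λ.X (-4)} (E : QuaternionCoordinates Λ x y s t)
include E

theorem of_st : DirectSum.of Λ.X 4 s * DirectSum.of Λ.X (-4) t = 1 := by
  rw [← of_mul (add_neg_cancel 4), E.s_t, of_one]

theorem of_ts : DirectSum.of Λ.X (-4) t * DirectSum.of Λ.X 4 s = 1 := by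
  rw [← of_mul (neg_add_cancel 4), E.t_s, of_one]

/-- The unit given by `s`. -/
def unit : (⨁ n, Λ.X n)ˣ where
  val := DirectSum.of Λ.X 4 s
  inv := DirectSum.of Λ.X (-4) t
  val_inv := E.of_st
  inv_val := E.of_ts

theorem of_xy : DirectSum.of Λ.X 1 x * DirectSum.of Λ.X 1 y =
    DirectSum.of Λ.X 1 y * DirectSum.of Λ.X 1 x := by
  rw [← of_mul (show (1 : ℤ) + 1 = 2 by rfl), ← of_mul (show (1 : ℤ) + 1 = 2 by rfl)]
  exact congrArg _ (E.ev_injective 2 (by rw [E.ev_xy, E.ev_yx]))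

theorem mul_add_mul [CharP k 2] : Λ.mul (show (1 : ℤ) + 1 = 2 by rfl) x x +
    Λ.mul (show (1 : ℤ) + 1 = 2 by rfl) y y = Λ.mul (show (1 : ℤ) + 1 = 2 by rfl) x y :=
  E.ev_injective 2 (by
    rw [map_add, E.ev_xx, E.ev_yy, E.ev_xy]
    ext i
    fin_cases i
    · exact CharTwo.add_self_eq_zero (1 : k)
    · exact add_zero (1 : k))

theorem of_xx_add_yy [CharP k 2] : DirectSum.of Λ.X 1 x ^ 2 + DirectSum.of Λ.X 1 y ^ 2 =
    DirectSum.of Λ.X 1 x * DirectSum.of Λ.X 1 y := by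
  rw [pow_two, pow_two, ← of_mul (show (1 : ℤ) + 1 = 2 by rfl),
    ← of_mul (show (1 : ℤ) + 1 = 2 by rfl), ← of_mul (show (1 : ℤ) + 1 = 2 by rfl), ← map_add,
    E.mul_add_mul]

theorem of_xxy : DirectSum.of Λ.X 1 x ^ 2 * DirectSum.of Λ.X 1 y =
    DirectSum.of Λ.X 1 x * DirectSum.of Λ.X 1 y ^ 2 := by
  rw [pow_two, pow_two, ← _root_.mul_assoc, ← of_mul (show (1 : ℤ) + 1 = 2 by rfl),
    ← of_mul (show (1 : ℤ) + 1 = 2 by rfl), ← of_mul (show (2 : ℤ) + 1 = 3 by rfl),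
    ← of_mul (show (2 : ℤ) + 1 = 3 by rfl)]
  exact congrArg _ (E.ev_injective 3 (by rw [E.ev_xxy, E.ev_xyy]))

/-- Multiplying x² + y² = xy by x gives x³ + xy² = x²y, and x²y = xy². -/
theorem of_xxx [CharP k 2] : DirectSum.of Λ.X 1 x ^ 3 = 0 := by
  have h := congrArg (DirectSum.of Λ.X 1 x * ·) E.of_xx_add_yy
  simp only [_root_.mul_add, ← pow_succ'] at h
  rw [← _root_.mul_assoc, ← pow_two, E.of_xxy] at h
  simpa using h

theorem of_yyy [CharP k 2] : DirectSum.of Λ.X 1 y ^ 3 = 0 := by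
  have h := congrArg (· * DirectSum.of Λ.X 1 y) E.of_xx_add_yy
  simp only [_root_.add_mul, ← pow_succ] at h
  rw [_root_.mul_assoc, ← pow_two, E.of_xxy] at h
  simpa using h

theorem of_sx : DirectSum.of Λ.X 4 s * DirectSum.of Λ.X 1 x =
    DirectSum.of Λ.X 1 x * DirectSum.of Λ.X 4 s := by
  rw [← of_mul (show (4 : ℤ) + 1 = 5 by rfl), ← of_mul (show (1 : ℤ) + 4 = 5 by rfl), E.s_x]

theorem of_sy : DirectSum.of Λ.X 4 s * DirectSum.of Λ.X 1 y =
    DirectSum.of Λ.X 1 y * DirectSum.of Λ.X 4 s := by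
  rw [← of_mul (show (4 : ℤ) + 1 = 5 by rfl), ← of_mul (show (1 : ℤ) + 4 = 5 by rfl), E.s_y]

/-- Every homogeneous element is a multiple of a power of `s`. -/
theorem exists_eq_mul_zpow (m : ℤ) : ∀ {r n : ℤ} (_ : r + 4 * m = n) (a : Λ.X n), ∃ b : Λ.X r,
    DirectSum.of Λ.X n a = DirectSum.of Λ.X r b * ↑(E.unit ^ m) ∧ E.ev r b = E.ev n a := by
  induction m using Int.induction_on with
  | zero =>
    rintro r n h a
    obtain rfl : r = n := by omega
    exact ⟨a, by simp, rfl⟩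
  | succ i ih =>
    intro r n h a
    have e : Λ.mul (show n - 4 + 4 = n by ring)
        (Λ.mul (show n + -4 = n - 4 by ring) a t) s = a := by
      rw [Λ.mul_assoc _ (neg_add_cancel 4) _ (add_zero n), E.t_s, Λ.mul_one]
    obtain ⟨b, hb, hb'⟩ := ih (r := r) (n := n - 4) (by omega)
      (Λ.mul (show n + -4 = n - 4 by ring) a t)
    refine ⟨b, ?_, ?_⟩
    · rw [zpow_add, zpow_one, Units.val_mul, ← _root_.mul_assoc, ← hb]
      exact (congrArg _ e.symm).trans (of_mul _ _ _)
    · rw [hb', ← E.ev_mul_s (show n - 4 + 4 = n by ring), e]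
  | pred i ih =>
    intro r n h a
    obtain ⟨b, hb, hb'⟩ := ih (r := r) (n := n + 4) (by omega) (Λ.mul rfl a s)
    refine ⟨b, ?_, ?_⟩
    · rw [zpow_sub, zpow_one, Units.val_mul, ← _root_.mul_assoc, ← hb, of_mul]
      change _ = _ * _ * DirectSum.of Λ.X (-4) t
      rw [_root_.mul_assoc, E.of_st, _root_.mul_one]
    · rw [hb', E.ev_mul_s]

theorem exists_ev_eq (m : ℤ) : ∀ {r n : ℤ} (_ : r + 4 * m = n) (b : Λ.X r), ∃ a : Λ.X n,
    E.ev n a = E.ev r b := by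
  intro r n h b
  obtain ⟨a, -, ha⟩ := E.exists_eq_mul_zpow (-m) (show n + 4 * (-m) = r by omega) b
  exact ⟨a, ha⟩

end QuaternionCoordinates
end GrAlg

/-! ### Spanning monomials and universal property of the quotient algebra -/

section Quotient

variable (k : Type u) [Field k]

/-- The algebra `k[x, y, s, s⁻¹] / (x² + y² = xy, x³ = y³ = 0, x²y = xy²)`. -/
abbrev QuaternionAlg := MvPolynomial (Fin 4) k ⧸ quaternionIdeal k

namespace QuaternionAlg

/-- The generators. -/
noncomputable def gen (i : Fin 4) : QuaternionAlg k :=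
  Ideal.Quotient.mk _ (MvPolynomial.X i)

theorem mk_eq_zero {p : MvPolynomial (Fin 4) k}
    (hp : p ∈ ({MvPolynomial.X 0 ^ 2 + MvPolynomial.X 1 ^ 2 - MvPolynomial.X 0 * MvPolynomial.X 1,
      MvPolynomial.X 0 ^ 3, MvPolynomial.X 1 ^ 3,
      MvPolynomial.X 0 ^ 2 * MvPolynomial.X 1 - MvPolynomial.X 0 * MvPolynomial.X 1 ^ 2,
      MvPolynomial.X 2 * MvPolynomial.X 3 - 1} : Set (MvPolynomial (Fin 4) k))) :
    Ideal.Quotient.mk (quaternionIdeal k) p = 0 :=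
  Ideal.Quotient.eq_zero_iff_mem.2 (Ideal.subset_span hp)

theorem rel_two : gen k 0 ^ 2 + gen k 1 ^ 2 = gen k 0 * gen k 1 :=
  sub_eq_zero.1 (mk_eq_zero k (by simp))

theorem rel_x : gen k 0 ^ 3 = 0 := mk_eq_zero k (by simp)

theorem rel_y : gen k 1 ^ 3 = 0 := mk_eq_zero k (by simp)

theorem rel_three : gen k 0 ^ 2 * gen k 1 = gen k 0 * gen k 1 ^ 2 :=
  sub_eq_zero.1 (mk_eq_zero k (by simp))

theorem rel_s : gen k 2 * gen k 3 = 1 :=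
  sub_eq_zero.1 (mk_eq_zero k (by simp))

/-- The unit given by `s`. -/
noncomputable def unit : (QuaternionAlg k)ˣ where
  val := gen k 2
  inv := gen k 3
  val_inv := rel_s k
  inv_val := (mul_comm _ _).trans (rel_s k)

/-- The monomials in `x` and `y`. -/
noncomputable def mono : Fin 6 → QuaternionAlg k :=
  ![1, gen k 0, gen k 1, gen k 1 ^ 2, gen k 0 * gen k 1, gen k 0 ^ 2 * gen k 1]

/-- The span of the elements s^m times the six monomials contains 1 and is stable under
multiplication by each generator: a product of a monomial with x or y is zero, another monomial, or
x² = xy - y². -/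
theorem span_eq_top (N : Submodule k (QuaternionAlg k))
    (hN : ∀ (m : ℤ) (i : Fin 6), ↑(unit k ^ m) * mono k i ∈ N) : N = ⊤ := by
  let N' := Submodule.span k (Set.range fun p : ℤ × Fin 6 => ↑(unit k ^ p.1) * mono k p.2)
  have hN' : N' ≤ N := Submodule.span_le.2 (by
    rintro _ ⟨p, rfl⟩
    exact hN _ _)
  have mem : ∀ (m : ℤ) (i : Fin 6), ↑(unit k ^ m) * mono k i ∈ N' :=
    fun m i => Submodule.subset_span ⟨(m, i), rfl⟩
  have h1 := rel_two k
  have h2 := rel_x k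
  have h3 := rel_y k
  have h4 := rel_three k
  have key : ∀ (j : Fin 4) (m : ℤ) (i : Fin 6), ↑(unit k ^ m) * mono k i * gen k j ∈ N' := by
    intro j m i
    have shift : ∀ v : (QuaternionAlg k)ˣ, ↑(unit k ^ m) * mono k i * (v : QuaternionAlg k) =
        ↑(unit k ^ m * v) * mono k i := by
      intro v
      rw [Units.val_mul]
      ring
    have zero : ∀ z : QuaternionAlg k, mono k i * gen k j = z → (z = 0 ∨
        (∃ l, z = mono k l) ∨ z = mono k 4 - mono k 3) →
        ↑(unit k ^ m) * mono k i * gen k j ∈ N' := by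
      rintro z hz h
      rw [mul_assoc, hz]
      rcases h with rfl | ⟨l, rfl⟩ | rfl
      · rw [mul_zero]
        exact N'.zero_mem
      · exact mem m l
      · rw [mul_sub]
        exact N'.sub_mem (mem m 4) (mem m 3)
    fin_cases j
    · fin_cases i
      · exact zero (mono k 1) (one_mul _) (Or.inr (Or.inl ⟨1, rfl⟩))
      · exact zero (mono k 4 - mono k 3) (by simp [mono]; linear_combination h1)
          (Or.inr (Or.inr rfl))
      · exact zero (mono k 4) (by simp [mono]; ring) (Or.inr (Or.inl ⟨4, rfl⟩))
      · exact zero (mono k 5) (by simp [mono]; linear_combination -h4) (Or.inr (Or.inl ⟨5, rfl⟩))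
      · exact zero (mono k 5) (by simp [mono]; ring) (Or.inr (Or.inl ⟨5, rfl⟩))
      · exact zero 0 (by simp [mono]; linear_combination gen k 1 * h2) (Or.inl rfl)
    · fin_cases i
      · exact zero (mono k 2) (one_mul _) (Or.inr (Or.inl ⟨2, rfl⟩))
      · exact zero (mono k 4) (by simp [mono]) (Or.inr (Or.inl ⟨4, rfl⟩))
      · exact zero (mono k 3) (by simp [mono]; ring) (Or.inr (Or.inl ⟨3, rfl⟩))
      · exact zero 0 (by simp [mono]; linear_combination h3) (Or.inl rfl)
      · exact zero (mono k 5) (by simp [mono]; linear_combination -h4) (Or.inr (Or.inl ⟨5, rfl⟩))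
      · exact zero 0 (by simp [mono]; linear_combination gen k 1 * h4 + gen k 0 * h3) (Or.inl rfl)
    · change ↑(unit k ^ m) * mono k i * ((unit k : (QuaternionAlg k)ˣ) : QuaternionAlg k) ∈ N'
      rw [shift, ← zpow_add_one]
      exact mem _ _
    · change ↑(unit k ^ m) * mono k i * (((unit k)⁻¹ : (QuaternionAlg k)ˣ) : QuaternionAlg k) ∈ N'
      rw [shift, ← zpow_sub_one]
      exact mem _ _
  have closed : ∀ (j : Fin 4), ∀ z ∈ N', z * gen k j ∈ N' := by
    intro j z hz
    induction hz using Submodule.span_induction with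
    | mem z hz =>
      obtain ⟨p, rfl⟩ := hz
      exact key j p.1 p.2
    | zero =>
      rw [zero_mul]
      exact N'.zero_mem
    | add z w _ _ hz hw =>
      rw [add_mul]
      exact N'.add_mem hz hw
    | smul c z _ hz =>
      rw [smul_mul_assoc]
      exact N'.smul_mem _ hz
  rw [eq_top_iff]
  rintro z -
  apply hN'
  obtain ⟨p, rfl⟩ := Ideal.Quotient.mk_surjective z
  induction p using MvPolynomial.induction_on with
  | C c =>
    have := N'.smul_mem c (mem 0 0)
    rw [zpow_zero, Units.val_one, one_mul] at this
    convert this using 1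
    exact Algebra.algebraMap_eq_smul_one (A := QuaternionAlg k) c
  | add p q hp hq =>
    rw [map_add]
    exact N'.add_mem hp hq
  | mul_X p i hp =>
    rw [map_mul]
    exact closed i _ hp

/-- The homomorphism to an algebra given by commuting elements satisfying the relations. -/
theorem exists_lift {S : Type*} [Ring S] [Algebra k S] (v : Fin 4 → S)
    (comm : ∀ i j, v i * v j = v j * v i) (h1 : v 0 ^ 2 + v 1 ^ 2 = v 0 * v 1)
    (h2 : v 0 ^ 3 = 0) (h3 : v 1 ^ 3 = 0) (h4 : v 0 ^ 2 * v 1 = v 0 * v 1 ^ 2)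
    (h5 : v 2 * v 3 = 1) :
    ∃ φ : QuaternionAlg k →ₐ[k] S, ∀ i, φ (gen k i) = v i := by
  -- The target need not be commutative, so polynomials are evaluated in the commutative subalgebra
  -- generated by the given elements.
  let B := Algebra.adjoin k (Set.range v)
  have hB : IsMulCommutative B := Algebra.isMulCommutative_adjoin k (by
    rintro _ ⟨i, rfl⟩ _ ⟨j, rfl⟩
    exact comm i j)
  let _ : CommRing B := { B.toRing with mul_comm := hB.is_comm.comm }
  let v' : Fin 4 → B := fun i => ⟨v i, Algebra.subset_adjoin ⟨i, rfl⟩⟩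
  let ψ : MvPolynomial (Fin 4) k →ₐ[k] S := B.val.comp (MvPolynomial.aeval v')
  have hψ : ∀ i, ψ (MvPolynomial.X i) = v i := fun i =>
    congrArg Subtype.val (MvPolynomial.aeval_X v' i)
  refine ⟨Ideal.Quotient.liftₐ _ ψ fun p hp => ?_, fun i => hψ i⟩
  have : quaternionIdeal k ≤ RingHom.ker ψ.toRingHom := by
    refine Ideal.span_le.2 ?_
    rintro p (rfl | rfl | rfl | rfl | rfl) <;> change ψ _ = 0 <;>
      simp only [map_sub, map_add, map_mul, map_pow, map_one, hψ, h1, h2, h3, h4, h5, sub_self]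
  exact this hp

end QuaternionAlg
end Quotient

/-! ### The presentation obtained from coordinates -/

namespace GrAlg.QuaternionCoordinates

variable {k : Type u} [Field k] {Λ : GrAlg.{w} k}
  {x y : Λ.X 1} {s : Λ.X 4} {t : Λ.X (-4)} (E : QuaternionCoordinates Λ x y s t)
include E

/-- The linear inverse of the presentation. -/
noncomputable def toQuotient : (⨁ n, Λ.X n) →ₗ[k] QuaternionAlg k :=
  DirectSum.toModule k ℤ _ fun n =>
    (LinearMap.mulLeft k (↑(QuaternionAlg.unit k ^ (n / 4)) : QuaternionAlg k)) ∘ₗ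
    ((LinearMap.toSpanSingleton k _ (if n % 4 = 0 then 1 else if n % 4 = 1 then
        QuaternionAlg.mono k 1 else if n % 4 = 2 then QuaternionAlg.mono k 3 else
        QuaternionAlg.mono k 5)) ∘ₗ LinearMap.proj 0 +
      (LinearMap.toSpanSingleton k _ (if n % 4 = 1 then
        QuaternionAlg.mono k 2 else if n % 4 = 2 then QuaternionAlg.mono k 4 else 0)) ∘ₗ
        LinearMap.proj 1) ∘ₗ E.ev n

theorem toQuotient_of (n : ℤ) (a : Λ.X n) : E.toQuotient (DirectSum.of Λ.X n a) =
    ↑(QuaternionAlg.unit k ^ (n / 4)) *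
      (E.ev n a 0 • (if n % 4 = 0 then 1 else if n % 4 = 1 then
        QuaternionAlg.mono k 1 else if n % 4 = 2 then QuaternionAlg.mono k 3 else
        QuaternionAlg.mono k 5) + E.ev n a 1 • (if n % 4 = 1 then
        QuaternionAlg.mono k 2 else if n % 4 = 2 then QuaternionAlg.mono k 4 else 0)) :=
  DirectSum.toModule_lof k n a

theorem toQuotient_surjective : Function.Surjective E.toQuotient := by
  rw [← LinearMap.range_eq_top]
  refine QuaternionAlg.span_eq_top k _ fun m i => ?_
  have key : ∀ (r : ℤ) (b : Λ.X r) (z : QuaternionAlg k), 0 ≤ r → r < 4 →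
      (E.ev r b 0 • (if r = 0 then 1 else if r = 1 then
        QuaternionAlg.mono k 1 else if r = 2 then QuaternionAlg.mono k 3 else
        QuaternionAlg.mono k 5) + E.ev r b 1 • (if r = 1 then
        QuaternionAlg.mono k 2 else if r = 2 then QuaternionAlg.mono k 4 else 0)) = z →
      ↑(QuaternionAlg.unit k ^ m) * z ∈ LinearMap.range E.toQuotient := by
    rintro r b z h h' rfl
    obtain ⟨a, ha⟩ := E.exists_ev_eq m rfl b
    refine ⟨DirectSum.of Λ.X _ a, ?_⟩
    rw [toQuotient_of, ha, show (r + 4 * m) / 4 = m by omega, show (r + 4 * m) % 4 = r by omega]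
  fin_cases i
  · exact key 0 Λ.one _ le_rfl (by norm_num) (by simp [E.ev_one, QuaternionAlg.mono])
  · exact key 1 x _ (by norm_num) (by norm_num) (by simp [E.ev_x])
  · exact key 1 y _ (by norm_num) (by norm_num) (by simp [E.ev_y])
  · exact key 2 _ _ (by norm_num) (by norm_num) (by rw [E.ev_yy]; simp)
  · exact key 2 _ _ (by norm_num) (by norm_num) (by rw [E.ev_xy]; simp)
  · exact key 3 _ _ (by norm_num) (by norm_num) (by rw [E.ev_xxy]; simp)

/-- The relations define a homomorphism φ from the quotient. The linear map `toQuotient` is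
surjective, since the monomials span, and satisfies φ ∘ `toQuotient` = 1; so φ is bijective, and no
independence of monomials in the quotient has to be proved beforehand. -/
theorem isQuaternionPresentation [CharP k 2] : IsQuaternionPresentation Λ x y s := by
  have comm : ∀ z : ⨁ n, Λ.X n, DirectSum.of Λ.X 4 s * z = z * DirectSum.of Λ.X 4 s →
      DirectSum.of Λ.X (-4) t * z = z * DirectSum.of Λ.X (-4) t := by
    intro z hz
    calc _ = DirectSum.of Λ.X (-4) t * (z * DirectSum.of Λ.X 4 s) * DirectSum.of Λ.X (-4) t := by
          rw [_root_.mul_assoc, _root_.mul_assoc, E.of_st, _root_.mul_one]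
      _ = _ := by rw [← hz, ← _root_.mul_assoc, E.of_ts, _root_.one_mul]
  obtain ⟨φ, hφ⟩ := QuaternionAlg.exists_lift k
    ![DirectSum.of Λ.X 1 x, DirectSum.of Λ.X 1 y, DirectSum.of Λ.X 4 s, DirectSum.of Λ.X (-4) t]
    (by
      have := E.of_xy
      have hx := E.of_sx
      have hy := E.of_sy
      have hs := E.of_st.trans E.of_ts.symm
      intro i j
      fin_cases i <;> fin_cases j
      · rfl
      · exact this
      · exact hx.symm
      · exact (comm _ hx).symm
      · exact this.symm
      · rfl
      · exact hy.symm
      · exact (comm _ hy).symm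
      · exact hx
      · exact hy
      · rfl
      · exact hs
      · exact comm _ hx
      · exact comm _ hy
      · exact hs.symm
      · rfl)
    E.of_xx_add_yy E.of_xxx E.of_yyy E.of_xxy E.of_st
  have hx : φ (QuaternionAlg.gen k 0) = DirectSum.of Λ.X 1 x := hφ 0
  have hy : φ (QuaternionAlg.gen k 1) = DirectSum.of Λ.X 1 y := hφ 1
  have hu : ∀ m : ℤ, φ ↑(QuaternionAlg.unit k ^ m) = ↑(E.unit ^ m) := by
    have : Units.map (φ : QuaternionAlg k →* ⨁ n, Λ.X n) (QuaternionAlg.unit k) = E.unit :=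
      Units.ext (hφ 2)
    intro m
    rw [← this, ← map_zpow]
    rfl
  have commu : ∀ (m : ℤ) (q : QuaternionAlg k), φ q * ↑(E.unit ^ m) = ↑(E.unit ^ m) * φ q := by
    intro m q
    rw [← hu, ← map_mul, ← map_mul, mul_comm]
  have right : ∀ z, φ (E.toQuotient z) = z := by
    intro z
    induction z using DirectSum.induction_on with
    | zero => rw [map_zero, map_zero]
    | add z w hz hw => rw [map_add, map_add, hz, hw]
    | of n a =>
      obtain ⟨b, hb, hb'⟩ := E.exists_eq_mul_zpow (n / 4) (show n % 4 + 4 * (n / 4) = n by omega) a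
      rw [toQuotient_of, map_mul, hu, ← commu, hb, ← hb']
      congr 1
      have hr : n % 4 = 0 ∨ n % 4 = 1 ∨ n % 4 = 2 ∨ n % 4 = 3 := by omega
      -- An element of degree r is determined by its coordinates; the second alternative serves the
      -- degrees 0 and 3, where only one coordinate is present.
      have vec : ∀ (r : ℤ) (v w : Λ.X r) (b : Λ.X r), E.ev r v = ![1, 0] →
          (E.ev r w = ![0, 1] ∨ E.ev r b 1 = 0 ∧ w = 0) →
          b = E.ev r b 0 • v + E.ev r b 1 • w := by
        intro r v w b hv hw
        refine E.ev_injective r ?_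
        rw [map_add, map_smul, map_smul, hv]
        rcases hw with hw | ⟨hw, rfl⟩
        · rw [hw]
          ext i
          fin_cases i <;> simp
        · ext i
          fin_cases i <;> simp [hw]
      clear hb hb'
      revert b
      generalize n % 4 = r at hr
      intro b
      rcases hr with rfl | rfl | rfl | rfl
      · conv_rhs => rw [vec 0 Λ.one 0 b E.ev_one (Or.inr ⟨E.ev_snd (by simp) b, rfl⟩)]
        simp [of_smul, of_one]
      · conv_rhs => rw [vec 1 x y b E.ev_x (Or.inl E.ev_y), map_add, of_smul, of_smul]
        simp [QuaternionAlg.mono, hx, hy]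
      · conv_rhs => rw [vec 2 _ _ b E.ev_yy (Or.inl E.ev_xy), map_add, of_smul, of_smul, of_mul,
          of_mul]
        simp [QuaternionAlg.mono, hx, hy, pow_two]
      · conv_rhs => rw [vec 3 _ 0 b E.ev_xxy (Or.inr ⟨E.ev_snd (by simp) b, rfl⟩), map_add,
          of_smul, of_smul, of_mul, of_mul]
        simp [QuaternionAlg.mono, hx, hy, pow_two]
  have bij : Function.Bijective φ := by
    refine ⟨?_, fun z => ⟨_, right z⟩⟩
    intro p q h
    obtain ⟨z, rfl⟩ := E.toQuotient_surjective p
    obtain ⟨w, rfl⟩ := E.toQuotient_surjective q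
    rw [right, right] at h
    rw [h]
  exact ⟨AlgEquiv.ofBijective φ bij, hφ 0, hφ 1, hφ 2⟩

end GrAlg.QuaternionCoordinates

/-! ## Matric Massey products in characteristic two -/

theorem add_self_eq_zero_of_charTwo (k : Type*) [Field k] [CharP k 2] {M : Type*} [AddCommGroup M]
    [Module k M] (m : M) : m + m = 0 := by
  rw [← two_smul k, CharTwo.two_eq_zero, zero_smul]

theorem neg_eq_of_charTwo (k : Type*) [Field k] [CharP k 2] {M : Type*} [AddCommGroup M]
    [Module k M] (m : M) : -m = m :=
  neg_eq_of_add_eq_zero_left (add_self_eq_zero_of_charTwo k m)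

theorem units_smul_of_charTwo (k : Type*) [Field k] [CharP k 2] {M : Type*} [AddCommGroup M]
    [Module k M] (u : ℤˣ) (m : M) : u • m = m := by
  rcases Int.units_eq_one_or u with rfl | rfl
  · exact one_smul _ m
  · rw [Units.neg_smul, one_smul, neg_eq_of_charTwo k]

namespace DGAlg

variable {k : Type u} [Field k] (A : DGAlg.{w} k)

/-- The underlying graded algebra. -/
def toGrAlg : GrAlg.{w} k where
  X := A.X
  one := A.one
  mul := A.mul
  one_mul := A.one_mul
  mul_one := A.mul_one
  mul_assoc := A.mul_assoc

/-- The direct sum of the components of a differential graded algebra. -/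
abbrev Total := ⨁ n, A.toGrAlg.X n

/-- The inclusion of a component. -/
def incl (n : ℤ) : A.X n →ₗ[k] A.Total := DirectSum.lof k ℤ A.toGrAlg.X n

/-- The projection to a component. -/
def proj (n : ℤ) : A.Total →ₗ[k] A.X n := DirectSum.component k ℤ A.toGrAlg.X n

theorem incl_mul {m n p : ℤ} (h : m + n = p) (a : A.X m) (b : A.X n) :
    A.incl p (A.mul h a b) = A.incl m a * A.incl n b :=
  GrAlg.of_mul (Λ := A.toGrAlg) h a b

theorem proj_incl (n : ℤ) (a : A.X n) : A.proj n (A.incl n a) = a :=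
  DirectSum.of_eq_same (β := A.toGrAlg.X) n a

theorem proj_incl_of_ne {m n : ℤ} (h : m ≠ n) (a : A.X m) : A.proj n (A.incl m a) = 0 :=
  DirectSum.of_eq_of_ne m n a h.symm

/-- The differential on the direct sum of the components. -/
def totalD : A.Total →ₗ[k] A.Total :=
  DirectSum.toModule k ℤ _ fun n => A.incl (n + 1) ∘ₗ A.d rfl

theorem totalD_incl {m n : ℤ} (h : m + 1 = n) (a : A.X m) :
    A.totalD (A.incl m a) = A.incl n (A.d h a) := by
  subst h
  exact DirectSum.toModule_lof k m a

theorem total_induction {P : A.Total → Prop} (z : A.Total) (h0 : P 0)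
    (hi : ∀ n a, P (A.incl n a)) (ha : ∀ z w, P z → P w → P (z + w)) : P z :=
  DirectSum.induction_on z h0 hi ha

/-- In characteristic 2 the Leibniz rule has no sign, so the differential is an ordinary derivation
of the total ring. Massey computations then become identities of matrices over one ring, free of
degree bookkeeping. -/
theorem totalD_mul [CharP k 2] (z w : A.Total) :
    A.totalD (z * w) = A.totalD z * w + z * A.totalD w := by
  induction z using A.total_induction with
  | h0 => simp
  | ha z z' h h' =>
    simp only [add_mul, map_add, h, h']
    abel
  | hi m a =>
    induction w using A.total_induction with
    | h0 => simp
    | ha z z' h h' =>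
      simp only [_root_.mul_add, map_add, h, h']
      abel
    | hi n b =>
      rw [← A.incl_mul rfl, A.totalD_incl rfl, A.totalD_incl rfl, A.totalD_incl rfl,
        A.leibniz rfl rfl rfl rfl (show (m + 1) + n = m + n + 1 by ring)
          (show m + (n + 1) = m + n + 1 by ring), units_smul_of_charTwo k, map_add, A.incl_mul,
        A.incl_mul]

theorem proj_totalD {m n : ℤ} (h : m + 1 = n) (z : A.Total) :
    A.proj n (A.totalD z) = A.d h (A.proj m z) := by
  induction z using A.total_induction with
  | h0 => simp
  | ha z w hz hw => simp only [map_add, hz, hw]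
  | hi l a =>
    rw [A.totalD_incl rfl]
    by_cases hl : l = m
    · subst hl
      subst h
      rw [proj_incl, proj_incl]
    · rw [A.proj_incl_of_ne (by omega), A.proj_incl_of_ne hl, map_zero]

theorem proj_mul_incl {m n p : ℤ} (h : m + n = p) (z : A.Total) (b : A.X n) :
    A.proj p (z * A.incl n b) = A.mul h (A.proj m z) b := by
  induction z using A.total_induction with
  | h0 => simp
  | ha z w hz hw => simp only [add_mul, map_add, hz, hw, LinearMap.add_apply]
  | hi l a =>
    rw [← A.incl_mul rfl]
    by_cases hl : l = m
    · subst hl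
      subst h
      rw [proj_incl, proj_incl]
    · rw [A.proj_incl_of_ne (by omega), A.proj_incl_of_ne hl, map_zero, LinearMap.zero_apply]

theorem proj_incl_mul {m n p : ℤ} (h : m + n = p) (a : A.X m) (z : A.Total) :
    A.proj p (A.incl m a * z) = A.mul h a (A.proj n z) := by
  induction z using A.total_induction with
  | h0 => simp
  | ha z w hz hw => simp only [_root_.mul_add, map_add, hz, hw]
  | hi l b =>
    rw [← A.incl_mul rfl]
    by_cases hl : l = n
    · subst hl
      subst h
      rw [proj_incl, proj_incl]
    · rw [A.proj_incl_of_ne (by omega), A.proj_incl_of_ne hl, map_zero]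

/-- The matrix `((y, x + y), (x, y))`. -/
def quaternionEntries (Λ : GrAlg.{w} k) (x y : Λ.X 1) : Fin 2 → Fin 2 → Λ.X 1 := !![y, x + y; x, y]

/-- Products of square matrices whose entries have degree `1`. -/
def mulMat (X Y : Fin 2 → Fin 2 → A.X 1) : Fin 2 → Fin 2 → A.X 2 := fun i j =>
  ∑ l, A.mul (show (1 : ℤ) + 1 = 2 by rfl) (X i l) (Y l j)

/-- Defining systems for the Massey product `⟨C, C, C⟩`. -/
structure IsMasseySystem (C : Fin 2 → Fin 2 → A.cohomology.X 1)
    (X Y Z T U : Fin 2 → Fin 2 → A.X 1) : Prop where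
  hX : ∀ a b, A.Represents (X a b) (C a b)
  hY : ∀ a b, A.Represents (Y a b) (C a b)
  hZ : ∀ a b, A.Represents (Z a b) (C a b)
  hT : ∀ a c, A.d (show (1 : ℤ) + 1 = 2 by rfl) (T a c) = A.mulMat X Y a c
  hU : ∀ a c, A.d (show (1 : ℤ) + 1 = 2 by rfl) (U a c) = A.mulMat Y Z a c

/-- With the constant shifts 0, 1, 2, 3 all degree differences evaluate to numerals, so the general
definition unfolds to this one up to the sign, which is trivial in characteristic 2. -/
theorem mem_massey_iff [CharP k 2] (x y : A.cohomology.X 1)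
    (B : Fin 2 → Fin 2 → A.cohomology.X 2) :
    B ∈ A.massey (quaternionMatrix A.cohomology x y 0 1 rfl)
      (quaternionMatrix A.cohomology x y 1 2 rfl) (quaternionMatrix A.cohomology x y 2 3 rfl) ↔
    ∃ X Y Z T U, A.IsMasseySystem (quaternionEntries A.cohomology x y) X Y Z T U ∧
      ∀ a d, A.Represents (A.mulMat T Z a d + A.mulMat X U a d) (B a d) := by
  have h : B ∈ A.massey (quaternionMatrix A.cohomology x y 0 1 rfl)
      (quaternionMatrix A.cohomology x y 1 2 rfl) (quaternionMatrix A.cohomology x y 2 3 rfl) ↔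
    ∃ X Y Z T U, A.IsMasseySystem (quaternionEntries A.cohomology x y) X Y Z T U ∧
      ∀ a d, A.Represents (A.mulMat T Z a d -
        ∑ b, (1 : ℤ).negOnePow • A.mul (show (1 : ℤ) + 1 = 2 by rfl) (X a b) (U b d)) (B a d) := by
    constructor
    · rintro ⟨X, Y, Z, T, U, h1, h2, h3, h4, h5, h6⟩
      exact ⟨X, Y, Z, T, U, ⟨h1, h2, h3, h4, h5⟩, h6⟩
    · rintro ⟨X, Y, Z, T, U, ⟨h1, h2, h3, h4, h5⟩, h6⟩
      exact ⟨X, Y, Z, T, U, h1, h2, h3, h4, h5, h6⟩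
  rw [h]
  simp only [units_smul_of_charTwo k, sub_eq_add_neg, neg_eq_of_charTwo k, mulMat]

theorem represents_zero {n : ℤ} {a : A.X n} : A.Represents a 0 ↔ a ∈ A.B n := by
  constructor
  · rintro ⟨h, h'⟩
    exact DGSpace.cls_eq_zero.1 h'
  · intro h
    have hZ : a ∈ A.Z n := by
      obtain ⟨b, rfl⟩ := (DGSpace.mem_B (sub_add_cancel n 1)).1 h
      exact DGSpace.d_mem_Z _ _
    exact ⟨hZ, DGSpace.cls_eq_zero.2 h⟩

theorem exists_d_eq_sub {m n : ℤ} (h : m + 1 = n) {a b : A.X n} {x : A.cohomology.X n}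
    (ha : A.Represents a x) (hb : A.Represents b x) : ∃ c, A.d h c = a - b := by
  obtain ⟨ha, rfl⟩ := ha
  obtain ⟨hb, hab⟩ := hb
  exact (DGSpace.mem_B h).1 (DGSpace.cls_eq.1 hab.symm)

/-- Square matrices over the direct sum of the components. -/
abbrev TotalMat := Matrix (Fin 2) (Fin 2) A.Total

/-- A square matrix with homogeneous entries as a matrix over the direct sum. -/
def toTotal (n : ℤ) (X : Fin 2 → Fin 2 → A.X n) : A.TotalMat := Matrix.of fun i j => A.incl n (X i j)

/-- The differential of a matrix. -/
def matD : A.TotalMat →ₗ[k] A.TotalMat := A.totalD.mapMatrix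

theorem matD_mul [CharP k 2] (M N : A.TotalMat) : A.matD (M * N) = A.matD M * N + M * A.matD N := by
  ext1 i j
  change A.totalD ((M * N) i j) = (A.matD M * N) i j + (M * A.matD N) i j
  rw [Matrix.mul_apply, Matrix.mul_apply, Matrix.mul_apply, map_sum, ← Finset.sum_add_distrib]
  exact Finset.sum_congr rfl fun l _ => A.totalD_mul _ _

theorem matD_toTotal {m n : ℤ} (h : m + 1 = n) (X : Fin 2 → Fin 2 → A.X m) :
    A.matD (A.toTotal m X) = A.toTotal n fun i j => A.d h (X i j) := by
  ext1 i j
  exact A.totalD_incl h _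

theorem toTotal_mul (X Y : Fin 2 → Fin 2 → A.X 1) :
    A.toTotal 1 X * A.toTotal 1 Y = A.toTotal 2 (A.mulMat X Y) := by
  ext1 i j
  rw [Matrix.mul_apply]
  change _ = A.incl 2 (∑ l, _)
  rw [map_sum]
  exact Finset.sum_congr rfl fun l _ => (A.incl_mul _ _ _).symm

theorem toTotal_add {n : ℤ} (X Y : Fin 2 → Fin 2 → A.X n) :
    A.toTotal n (X + Y) = A.toTotal n X + A.toTotal n Y := by
  ext1 i j
  exact map_add (A.incl n) _ _

/-- Two defining systems differ by cocycles, up to a coboundary. -/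
theorem total_massey_identity [CharP k 2] {C X Y Z T U T₀ ξ η ζ θ : A.TotalMat}
    (hC : A.matD C = 0) (hX : X = C + A.matD ξ) (hY : Y = C + A.matD η) (hZ : Z = C + A.matD ζ)
    (hY' : A.matD Y = 0) (hT : A.matD T = X * Y)
    (hU : A.matD U = Y * Z) (hT₀ : A.matD T₀ = C * C) (hθ : T * Z + X * U = A.matD θ) :
    ∃ W V Θ : A.TotalMat, A.matD W = 0 ∧ A.matD V = 0 ∧
      W * C + C * V + (T₀ * C + C * T₀) = A.matD Θ := by
  have two : ∀ M : A.TotalMat, M + M = 0 := fun M => add_self_eq_zero_of_charTwo k M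
  have two' : ∀ M : A.TotalMat, (2 : ℤ) • M = 0 := fun M => by rw [two_smul, two]
  -- T + ξY + Cη has boundary C², as T₀ has, so their sum is a cocycle; the same holds for U + Yζ +
  -- ηC. The third witness collects the remaining correction terms.
  refine ⟨T + ξ * Y + C * η + T₀, U + Y * ζ + η * C + T₀, θ + T * ζ + ξ * U + ξ * Y * ζ, ?_, ?_, ?_⟩
  · simp only [map_add, matD_mul, hT, hY', hC, hT₀, mul_zero, zero_mul, add_zero, zero_add]
    rw [hX, hY]
    simp only [_root_.mul_add, add_mul]
    abel_nf
    simp only [two', add_zero]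
  · simp only [map_add, matD_mul, hU, hY', hC, hT₀, mul_zero, zero_mul, add_zero, zero_add]
    rw [hZ, hY]
    simp only [_root_.mul_add, add_mul]
    abel_nf
    simp only [two', add_zero]
  · simp only [map_add, matD_mul, hU, hY', hT, mul_zero, add_zero]
    rw [← hθ, ← sub_eq_zero, hX, hZ, hY]
    simp only [_root_.mul_add, add_mul, _root_.mul_assoc]
    abel_nf
    simp only [two', add_zero, neg_smul, neg_zero]

/-- This makes a single defining system sufficient: if some system yields zero, then the class of
T₀C' + C'T₀, for any fixed C' and T₀, has the form WC + CV. -/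
theorem exists_of_isMasseySystem [CharP k 2] {C : Fin 2 → Fin 2 → A.cohomology.X 1}
    {X Y Z T U : Fin 2 → Fin 2 → A.X 1} (h : A.IsMasseySystem C X Y Z T U)
    (h0 : ∀ a d, A.Represents (A.mulMat T Z a d + A.mulMat X U a d) 0)
    {C' T₀ : Fin 2 → Fin 2 → A.X 1} (hC : ∀ a b, A.Represents (C' a b) (C a b))
    (hT₀ : ∀ a b, A.d (show (1 : ℤ) + 1 = 2 by rfl) (T₀ a b) = A.mulMat C' C' a b) :
    ∃ W V : Fin 2 → Fin 2 → A.X 1, (∀ a b, W a b ∈ A.Z 1) ∧ (∀ a b, V a b ∈ A.Z 1) ∧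
      ∀ a b, A.mulMat W C' a b + A.mulMat C' V a b +
        (A.mulMat T₀ C' a b + A.mulMat C' T₀ a b) ∈ A.B 2 := by
  choose ξ hξ using fun a b => A.exists_d_eq_sub (zero_add 1) (h.hX a b) (hC a b)
  choose η hη using fun a b => A.exists_d_eq_sub (zero_add 1) (h.hY a b) (hC a b)
  choose ζ hζ using fun a b => A.exists_d_eq_sub (zero_add 1) (h.hZ a b) (hC a b)
  choose θ hθ using fun a d => (DGSpace.mem_B (show (1 : ℤ) + 1 = 2 by rfl)).1
    (A.represents_zero.1 (h0 a d))
  have cocycle : ∀ {M : Fin 2 → Fin 2 → A.X 1}, (∀ a b, A.Represents (M a b) (C a b)) →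
      A.matD (A.toTotal 1 M) = 0 := by
    intro M hM
    rw [A.matD_toTotal (show (1 : ℤ) + 1 = 2 by rfl)]
    ext1 i j
    change A.incl 2 (A.d _ (M i j)) = 0
    rw [(DGSpace.mem_Z _).1 (hM i j).1, map_zero]
  have diff : ∀ {M : Fin 2 → Fin 2 → A.X 1} {c : Fin 2 → Fin 2 → A.X 0},
      (∀ a b, A.d (zero_add 1) (c a b) = M a b - C' a b) →
      A.toTotal 1 M = A.toTotal 1 C' + A.matD (A.toTotal 0 c) := by
    intro M c hc
    rw [A.matD_toTotal (zero_add 1), ← toTotal_add]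
    congr 1
    funext i j
    rw [Pi.add_apply, Pi.add_apply, hc, add_sub_cancel]
  have homotopy : ∀ {M N L : Fin 2 → Fin 2 → A.X 1},
      (∀ a b, A.d (show (1 : ℤ) + 1 = 2 by rfl) (M a b) = A.mulMat N L a b) →
      A.matD (A.toTotal 1 M) = A.toTotal 1 N * A.toTotal 1 L := by
    intro M N L hM
    rw [A.matD_toTotal (show (1 : ℤ) + 1 = 2 by rfl), toTotal_mul]
    congr 1
    funext i j
    exact hM i j
  obtain ⟨W, V, Θ, hW, hV, hΘ⟩ := A.total_massey_identity (cocycle hC) (diff hξ) (diff hη)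
    (diff hζ) (cocycle h.hY) (homotopy h.hT) (homotopy h.hU) (homotopy hT₀)
    (θ := A.toTotal 1 θ) (by
      rw [toTotal_mul, toTotal_mul, A.matD_toTotal (show (1 : ℤ) + 1 = 2 by rfl), ← toTotal_add]
      congr 1
      funext i j
      exact (hθ i j).symm)
  have closed : ∀ {M : A.TotalMat}, A.matD M = 0 → ∀ i j, A.proj 1 (M i j) ∈ A.Z 1 := by
    intro M hM i j
    rw [DGSpace.mem_Z (show (1 : ℤ) + 1 = 2 by rfl), ← A.proj_totalD]
    exact (congrArg (A.proj 2) (congrFun (congrFun hM i) j)).trans (map_zero _)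
  -- The matrices found over the total ring are not known to be homogeneous; their components of
  -- degree 1 suffice, because the other terms of the identity are homogeneous.
  refine ⟨fun i j => A.proj 1 (W i j), fun i j => A.proj 1 (V i j), closed hW, closed hV,
    fun i j => ?_⟩
  rw [DGSpace.mem_B (show (1 : ℤ) + 1 = 2 by rfl)]
  refine ⟨A.proj 1 (Θ i j), ?_⟩
  rw [← A.proj_totalD]
  refine (congrArg (A.proj 2) (congrFun (congrFun hΘ i) j).symm).trans ?_
  rw [toTotal_mul, toTotal_mul, Matrix.add_apply, Matrix.add_apply, Matrix.add_apply,
    Matrix.mul_apply, Matrix.mul_apply, map_add, map_add, map_add, map_sum, map_sum]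
  refine congrArg₂ _ (congrArg₂ _ ?_ ?_) (congrArg₂ _ ?_ ?_)
  · exact Finset.sum_congr rfl fun l _ => A.proj_mul_incl _ _ _
  · exact Finset.sum_congr rfl fun l _ => A.proj_incl_mul _ _ _
  · exact A.proj_incl 2 _
  · exact A.proj_incl 2 _

end DGAlg

/-! ## Quaternion models -/

/-- For F = F₀ y² + F₁ xy the functional used is tr(F₀B) + tr(F₁A), the coefficient of x²y in tr(FD)
with D = Bx + (A + B)y. As D annihilates Ax + By on both sides, cyclicity of the trace kills the
terms with Wᵢ and Vᵢ. What is left is δ tr(A² + BA) = δ². -/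
theorem Matrix.eq_zero_of_quaternion_relations {k : Type*} [Field k] [CharP k 2]
    {A B : Matrix (Fin 2) (Fin 2) k} {δ : k} (hA : A * A = δ • 1) (hB : B * B = δ • 1)
    (hBA : B * A = δ • 1 + A * B) (htr : (A * B).trace = δ) {W₀ W₁ V₀ V₁ : Matrix (Fin 2) (Fin 2) k}
    (h₀ : W₀ * A + W₁ * B + (A * V₀ + B * V₁) = 0)
    (h₁ : W₀ * A + W₀ * B + W₁ * A + (A * V₀ + A * V₁ + B * V₀) + δ • (A + B) = 0) : δ = 0 := by
  have two : ∀ z : k, z + z = 0 := CharTwo.add_self_eq_zero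
  have c₀ : (A * V₀ * B).trace = (V₀ * (B * A)).trace := by
    rw [Matrix.mul_assoc, Matrix.trace_mul_comm, Matrix.mul_assoc]
  have c₁ : (B * V₁ * B).trace = (V₁ * (B * B)).trace := by
    rw [Matrix.mul_assoc, Matrix.trace_mul_comm, Matrix.mul_assoc]
  have c₂ : (A * V₀ * A).trace = (V₀ * (A * A)).trace := by
    rw [Matrix.mul_assoc, Matrix.trace_mul_comm, Matrix.mul_assoc]
  have c₃ : (A * V₁ * A).trace = (V₁ * (A * A)).trace := by
    rw [Matrix.mul_assoc, Matrix.trace_mul_comm, Matrix.mul_assoc]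
  have c₄ : (B * V₀ * A).trace = (V₀ * (A * B)).trace := by
    rw [Matrix.mul_assoc, Matrix.trace_mul_comm, Matrix.mul_assoc]
  have e₀ := congrArg (fun M => (M * B).trace) h₀
  have e₁ := congrArg (fun M => (M * A).trace) h₁
  simp only [Matrix.add_mul, Matrix.trace_add, c₀, c₁, c₂, c₃, c₄, Matrix.zero_mul,
    Matrix.trace_zero, Matrix.smul_mul, Matrix.trace_smul] at e₀ e₁
  simp only [Matrix.mul_assoc, hA, hB, hBA, Matrix.mul_add, Matrix.trace_add, htr, Matrix.mul_smul,
    Matrix.trace_smul, Matrix.mul_one, smul_eq_mul, Matrix.trace_one, Fintype.card_fin,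
    Nat.cast_ofNat, CharTwo.two_eq_zero, mul_zero, zero_add] at e₀ e₁
  have : δ * δ = 0 := by
    linear_combination e₀ + e₁ - (W₀ * (A * B)).trace * CharTwo.two_eq_zero (R := k)
      - δ * W₁.trace * CharTwo.two_eq_zero (R := k) - δ * V₀.trace * CharTwo.two_eq_zero (R := k)
      - δ * V₁.trace * CharTwo.two_eq_zero (R := k)
      - δ * W₀.trace * CharTwo.two_eq_zero (R := k)
      - (V₀ * (A * B)).trace * CharTwo.two_eq_zero (R := k)
  exact mul_self_eq_zero.1 this

namespace GrAlg

variable {k : Type u} [Field k] {Λ : GrAlg.{w} k} {x y : Λ.X 1} {s : Λ.X 4}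

theorem mul_add_mul_of_isQuaternionPresentation (h : IsQuaternionPresentation Λ x y s) :
    Λ.mul (show (1 : ℤ) + 1 = 2 by rfl) x x + Λ.mul (show (1 : ℤ) + 1 = 2 by rfl) y y =
      Λ.mul (show (1 : ℤ) + 1 = 2 by rfl) x y := by
  obtain ⟨Φ, hx, hy, -⟩ := h
  refine of_injective 2 ?_
  rw [map_add, of_mul, of_mul, of_mul, ← hx, ← hy, ← pow_two, ← pow_two]
  have r := congrArg Φ (QuaternionAlg.rel_two k)
  rwa [map_add, map_pow, map_pow, map_mul] at r

theorem mul_comm_of_isQuaternionPresentation (h : IsQuaternionPresentation Λ x y s) :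
    Λ.mul (show (1 : ℤ) + 1 = 2 by rfl) x y = Λ.mul (show (1 : ℤ) + 1 = 2 by rfl) y x := by
  obtain ⟨Φ, hx, hy, -⟩ := h
  refine of_injective 2 ?_
  rw [of_mul, of_mul, ← hx, ← hy]
  have r := congrArg Φ (mul_comm (QuaternionAlg.gen k 0) (QuaternionAlg.gen k 1))
  rwa [map_mul, map_mul] at r

end GrAlg

/-! ### Comparison of two presentations -/

namespace GrAlg.QuaternionCoordinates

variable {k : Type u} [Field k] {Λ : GrAlg.{w} k} {x y : Λ.X 1} {s : Λ.X 4} {t : Λ.X (-4)}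
  (E : QuaternionCoordinates Λ x y s t)
include E

theorem eq_smul_add_smul (v : Λ.X 1) : v = E.ev 1 v 0 • x + E.ev 1 v 1 • y := by
  refine E.ev_injective 1 ?_
  rw [map_add, map_smul, map_smul, E.ev_x, E.ev_y]
  ext i
  fin_cases i <;> simp

theorem ev_mul (v w : Λ.X 1) : E.ev 2 (Λ.mul (show (1 : ℤ) + 1 = 2 by rfl) v w) =
    ![E.ev 1 v 0 * E.ev 1 w 0 + E.ev 1 v 1 * E.ev 1 w 1,
      E.ev 1 v 0 * E.ev 1 w 0 + E.ev 1 v 0 * E.ev 1 w 1 + E.ev 1 v 1 * E.ev 1 w 0] := by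
  conv_lhs => rw [E.eq_smul_add_smul v, E.eq_smul_add_smul w]
  simp only [map_add, map_smul, LinearMap.add_apply, LinearMap.smul_apply, E.ev_xx, E.ev_xy,
    E.ev_yx, E.ev_yy]
  ext i
  fin_cases i <;> simp <;> ring

/-- The two coordinates of x'² + y'² = x'y' give the three quadratic equations, with δ the
determinant of the change of generators modulo 2. It is nonzero because x' and y' are linearly
independent, a fact transferred from x and y through the abstract quotient algebra. -/
theorem exists_of_isQuaternionPresentation [CharP k 2] {x' y' : Λ.X 1} {s' : Λ.X 4}
    (h : IsQuaternionPresentation Λ x' y' s') : ∃ a b c d δ : k, x' = a • x + b • y ∧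
      y' = c • x + d • y ∧ δ ≠ 0 ∧ a ^ 2 + a * c + c ^ 2 = δ ∧ b ^ 2 + b * d + d ^ 2 = δ ∧
      a * d + b * c = δ := by
  have two := CharTwo.two_eq_zero (R := k)
  have rel := mul_add_mul_of_isQuaternionPresentation h
  obtain ⟨Φ, hx, hy, -⟩ := h
  obtain ⟨Φ₀, hx₀, hy₀, -⟩ := E.isQuaternionPresentation
  have indep : ∀ l m : k, l • x' + m • y' = 0 → l = 0 ∧ m = 0 := by
    intro l m h
    have h' : l • QuaternionAlg.gen k 0 + m • QuaternionAlg.gen k 1 = 0 := by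
      refine Φ.injective ?_
      rw [map_add, map_smul, map_smul, map_zero]
      change l • Φ (Ideal.Quotient.mk _ (MvPolynomial.X 0)) +
        m • Φ (Ideal.Quotient.mk _ (MvPolynomial.X 1)) = 0
      rw [hx, hy, ← of_smul, ← of_smul, ← map_add, h, map_zero]
    have h'' : l • x + m • y = 0 := by
      refine of_injective 1 ?_
      have r := congrArg Φ₀ h'
      rw [map_add, map_smul, map_smul, map_zero] at r
      rw [map_add, of_smul, of_smul, ← hx₀, ← hy₀, map_zero]
      exact r
    have h3 := congrArg (E.ev 1) h''
    rw [map_add, map_smul, map_smul, E.ev_x, E.ev_y, map_zero] at h3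
    exact ⟨by simpa using congrFun h3 0, by simpa using congrFun h3 1⟩
  obtain ⟨a, b, ha⟩ : ∃ a b : k, x' = a • x + b • y := ⟨_, _, E.eq_smul_add_smul x'⟩
  obtain ⟨c, d, hc⟩ : ∃ c d : k, y' = c • x + d • y := ⟨_, _, E.eq_smul_add_smul y'⟩
  have e0 : E.ev 1 x' 0 = a := by rw [ha, map_add, map_smul, map_smul, E.ev_x, E.ev_y]; simp
  have e1 : E.ev 1 x' 1 = b := by rw [ha, map_add, map_smul, map_smul, E.ev_x, E.ev_y]; simp
  have e2 : E.ev 1 y' 0 = c := by rw [hc, map_add, map_smul, map_smul, E.ev_x, E.ev_y]; simp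
  have e3 : E.ev 1 y' 1 = d := by rw [hc, map_add, map_smul, map_smul, E.ev_x, E.ev_y]; simp
  have r := congrArg (E.ev 2) rel
  simp only [map_add, E.ev_mul, e0, e1, e2, e3] at r
  have r0 := congrFun r 0
  have r1 := congrFun r 1
  simp only [Pi.add_apply, Matrix.cons_val_zero, Matrix.cons_val_one] at r0 r1
  refine ⟨a, b, c, d, a * d + b * c, ha, hc, ?_, ?_, ?_, rfl⟩
  -- With δ = 0, the combinations dx' + by' and cx' + ay' vanish in characteristic 2, so all four
  -- coefficients are zero and x' = 0, against independence.
  · intro h0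
    have i1 := indep d b (by
      rw [ha, hc, show d • (a • x + b • y) + b • (c • x + d • y) =
        (a * d + b * c) • x + (b * d * 2) • y by module, h0, two]
      simp)
    have i2 := indep c a (by
      rw [ha, hc, show c • (a • x + b • y) + a • (c • x + d • y) =
        (a * c * 2) • x + (a * d + b * c) • y by module, h0, two]
      simp)
    have i3 := indep 1 0 (by
      rw [ha, i2.2, i1.2]
      simp)
    exact one_ne_zero i3.1
  · linear_combination r1 + (a * c - a * b - c * d) * two
  · linear_combination r0 - r1 + (b * d + a * b - b * c - a * d + c * d) * two

end GrAlg.QuaternionCoordinates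

/-! ### The Massey product in a quaternion model -/

namespace DGAlg

variable {k : Type u} [Field k] (A : DGAlg.{w} k)

/-- The matrix with entries `M i j • u`. -/
def tensor {n : ℤ} (M : Matrix (Fin 2) (Fin 2) k) (u : A.X n) : Fin 2 → Fin 2 → A.X n :=
  fun i j => M i j • u

theorem mulMat_add (X Y Y' : Fin 2 → Fin 2 → A.X 1) :
    A.mulMat X (Y + Y') = A.mulMat X Y + A.mulMat X Y' := by
  ext i j
  simp only [mulMat, Pi.add_apply, map_add, Finset.sum_add_distrib]

theorem add_mulMat (X X' Y : Fin 2 → Fin 2 → A.X 1) :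
    A.mulMat (X + X') Y = A.mulMat X Y + A.mulMat X' Y := by
  ext i j
  simp only [mulMat, Pi.add_apply, map_add, Finset.sum_add_distrib, LinearMap.add_apply]

theorem mulMat_tensor (M N : Matrix (Fin 2) (Fin 2) k) (u v : A.X 1) :
    A.mulMat (A.tensor M u) (A.tensor N v) =
      A.tensor (M * N) (A.mul (show (1 : ℤ) + 1 = 2 by rfl) u v) := by
  ext i j
  simp only [mulMat, tensor, map_smul, LinearMap.smul_apply, Matrix.mul_apply, Finset.sum_smul,
    smul_smul]
  exact Finset.sum_congr rfl fun l _ => by rw [mul_comm]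

variable {A} in
theorem mulMat_mem_Z {X Y : Fin 2 → Fin 2 → A.X 1} (hX : ∀ i j, X i j ∈ A.Z 1)
    (hY : ∀ i j, Y i j ∈ A.Z 1) (i j : Fin 2) : A.mulMat X Y i j ∈ A.Z 2 :=
  Submodule.sum_mem _ fun l _ => A.pairing.mem_Z (show (1 : ℤ) + 1 = 2 by rfl) (hX i l) (hY l j)

/-- Elements of a differential graded algebra that determine the cohomology algebra of the
quaternion group together with its secondary multiplication. -/
structure QuaternionModel where
  ev : ∀ n, A.X n →ₗ[k] (Fin 2 → k)
  ev_of_mem_B : ∀ {n : ℤ} {b : A.X n}, b ∈ A.B n → ev n b = 0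
  mem_B_of_ev : ∀ {n : ℤ} {b : A.X n}, b ∈ A.Z n → ev n b = 0 → b ∈ A.B n
  ev_snd : ∀ {n : ℤ}, n % 4 = 0 ∨ n % 4 = 3 → ∀ b : A.X n, ev n b 1 = 0
  x : A.X 1
  y : A.X 1
  s : A.X 4
  t : A.X (-4)
  q : A.X 1
  e : A.X 1
  x_mem : x ∈ A.Z 1
  y_mem : y ∈ A.Z 1
  s_mem : s ∈ A.Z 4
  t_mem : t ∈ A.Z (-4)
  ev_mul_s : ∀ {m n : ℤ} (h : m + 4 = n) (b : A.X m), ev n (A.mul h b s) = ev m b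
  -- Inverse only up to coboundaries: conjugation by a homotopy retraction does not preserve the
  -- unit strictly.
  s_t : A.mul (add_neg_cancel 4) s t - A.one ∈ A.B 0
  t_s : A.mul (neg_add_cancel 4) t s - A.one ∈ A.B 0
  s_x : A.mul (show (4 : ℤ) + 1 = 5 by rfl) s x = A.mul (show (1 : ℤ) + 4 = 5 by rfl) x s
  s_y : A.mul (show (4 : ℤ) + 1 = 5 by rfl) s y = A.mul (show (1 : ℤ) + 4 = 5 by rfl) y s
  d_q : A.d (show (1 : ℤ) + 1 = 2 by rfl) q = A.mul (show (1 : ℤ) + 1 = 2 by rfl) x x +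
    A.mul (show (1 : ℤ) + 1 = 2 by rfl) y y + A.mul (show (1 : ℤ) + 1 = 2 by rfl) y x
  d_e : A.d (show (1 : ℤ) + 1 = 2 by rfl) e = A.mul (show (1 : ℤ) + 1 = 2 by rfl) x y +
    A.mul (show (1 : ℤ) + 1 = 2 by rfl) y x
  ev_one : ev 0 A.one = ![1, 0]
  ev_x : ev 1 x = ![1, 0]
  ev_y : ev 1 y = ![0, 1]
  ev_xx : ev 2 (A.mul (show (1 : ℤ) + 1 = 2 by rfl) x x) = ![1, 1]
  ev_xy : ev 2 (A.mul (show (1 : ℤ) + 1 = 2 by rfl) x y) = ![0, 1]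
  ev_yx : ev 2 (A.mul (show (1 : ℤ) + 1 = 2 by rfl) y x) = ![0, 1]
  ev_yy : ev 2 (A.mul (show (1 : ℤ) + 1 = 2 by rfl) y y) = ![1, 0]
  ev_xxy : ev 3 (A.mul (show (2 : ℤ) + 1 = 3 by rfl)
    (A.mul (show (1 : ℤ) + 1 = 2 by rfl) x x) y) = ![1, 0]
  ev_xyy : ev 3 (A.mul (show (2 : ℤ) + 1 = 3 by rfl)
    (A.mul (show (1 : ℤ) + 1 = 2 by rfl) x y) y) = ![1, 0]
  -- This element and the next are the coefficients of δM and δN in T₀C + CT₀, for C = Mx + Ny and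
  -- T₀ = δq + MN e. Both represent the class xy.
  ev_secondary_x : ev 2 (A.mul (show (1 : ℤ) + 1 = 2 by rfl) x q +
    A.mul (show (1 : ℤ) + 1 = 2 by rfl) q x + A.mul (show (1 : ℤ) + 1 = 2 by rfl) e x +
    A.mul (show (1 : ℤ) + 1 = 2 by rfl) e y + A.mul (show (1 : ℤ) + 1 = 2 by rfl) y e) = ![0, 1]
  ev_secondary_y : ev 2 (A.mul (show (1 : ℤ) + 1 = 2 by rfl) y q +
    A.mul (show (1 : ℤ) + 1 = 2 by rfl) q y + A.mul (show (1 : ℤ) + 1 = 2 by rfl) e x +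
    A.mul (show (1 : ℤ) + 1 = 2 by rfl) x e + A.mul (show (1 : ℤ) + 1 = 2 by rfl) y e) = ![0, 1]

namespace QuaternionModel

variable {A} (m : A.QuaternionModel)

/-- The coordinates on the cohomology algebra given by a quaternion model. -/
def coordinates : GrAlg.QuaternionCoordinates A.cohomology (A.hcls ⟨m.x, m.x_mem⟩)
    (A.hcls ⟨m.y, m.y_mem⟩) (A.hcls ⟨m.s, m.s_mem⟩) (A.hcls ⟨m.t, m.t_mem⟩) where
  ev n := Submodule.liftQ _ (m.ev n ∘ₗ (A.Z n).subtype) fun _ hb => m.ev_of_mem_B hb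
  ev_injective n := by
    intro v w h
    obtain ⟨a, rfl⟩ := DGSpace.cls_surjective v
    obtain ⟨b, rfl⟩ := DGSpace.cls_surjective w
    refine DGSpace.cls_eq.2 (m.mem_B_of_ev (Submodule.sub_mem _ a.2 b.2) ?_)
    rw [map_sub]
    exact sub_eq_zero.2 h
  ev_mul_s h v := by
    obtain ⟨b, rfl⟩ := DGSpace.cls_surjective v
    exact m.ev_mul_s h b
  ev_snd h v := by
    obtain ⟨b, rfl⟩ := DGSpace.cls_surjective v
    exact m.ev_snd h b
  s_t := DGSpace.cls_eq.2 m.s_t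
  t_s := DGSpace.cls_eq.2 m.t_s
  s_x := congrArg A.cls (Subtype.ext m.s_x)
  s_y := congrArg A.cls (Subtype.ext m.s_y)
  ev_one := m.ev_one
  ev_x := m.ev_x
  ev_y := m.ev_y
  ev_xx := m.ev_xx
  ev_xy := m.ev_xy
  ev_yx := m.ev_yx
  ev_yy := m.ev_yy
  ev_xxy := m.ev_xxy
  ev_xyy := m.ev_xyy

theorem ev_mul {v w : A.X 1} (hv : v ∈ A.Z 1) (hw : w ∈ A.Z 1) :
    m.ev 2 (A.mul (show (1 : ℤ) + 1 = 2 by rfl) v w) =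
    ![m.ev 1 v 0 * m.ev 1 w 0 + m.ev 1 v 1 * m.ev 1 w 1,
      m.ev 1 v 0 * m.ev 1 w 0 + m.ev 1 v 0 * m.ev 1 w 1 + m.ev 1 v 1 * m.ev 1 w 0] :=
  m.coordinates.ev_mul (A.hcls ⟨v, hv⟩) (A.hcls ⟨w, hw⟩)

theorem ev_mulMat {X Y : Fin 2 → Fin 2 → A.X 1} (hX : ∀ i j, X i j ∈ A.Z 1)
    (hY : ∀ i j, Y i j ∈ A.Z 1) {X₀ X₁ Y₀ Y₁ : Matrix (Fin 2) (Fin 2) k}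
    (hX₀ : ∀ i j, m.ev 1 (X i j) 0 = X₀ i j) (hX₁ : ∀ i j, m.ev 1 (X i j) 1 = X₁ i j)
    (hY₀ : ∀ i j, m.ev 1 (Y i j) 0 = Y₀ i j) (hY₁ : ∀ i j, m.ev 1 (Y i j) 1 = Y₁ i j)
    (i j : Fin 2) : m.ev 2 (A.mulMat X Y i j) =
      ![(X₀ * Y₀ + X₁ * Y₁) i j, (X₀ * Y₀ + X₀ * Y₁ + X₁ * Y₀) i j] := by
  rw [mulMat, map_sum]
  simp only [m.ev_mul (hX _ _) (hY _ _), Matrix.add_apply, Matrix.mul_apply, hX₀, hX₁, hY₀, hY₁,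
    ← Finset.sum_add_distrib]
  ext l
  fin_cases l <;> simp

/-- The matrices in which the coordinates of `((y, x + y), (x, y))` are arranged. -/
theorem not_exists_of_relations [CharP k 2] {M N : Matrix (Fin 2) (Fin 2) k} {δ : k} (hδ : δ ≠ 0)
    (hM : M * M = δ • 1) (hN : N * N = δ • 1) (hNM : N * M = δ • 1 + M * N)
    (htr : (M * N).trace = δ) :
    ∃ T₀ : Fin 2 → Fin 2 → A.X 1,
      (∀ i j, A.d (show (1 : ℤ) + 1 = 2 by rfl) (T₀ i j) =
        A.mulMat (A.tensor M m.x + A.tensor N m.y) (A.tensor M m.x + A.tensor N m.y) i j) ∧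
      ¬ ∃ W V : Fin 2 → Fin 2 → A.X 1, (∀ a b, W a b ∈ A.Z 1) ∧ (∀ a b, V a b ∈ A.Z 1) ∧
        ∀ a b, A.mulMat W (A.tensor M m.x + A.tensor N m.y) a b +
          A.mulMat (A.tensor M m.x + A.tensor N m.y) V a b +
          (A.mulMat T₀ (A.tensor M m.x + A.tensor N m.y) a b +
            A.mulMat (A.tensor M m.x + A.tensor N m.y) T₀ a b) ∈ A.B 2 := by
  have e₁ : M * N * M = δ • M + δ • N := by
    rw [Matrix.mul_assoc, hNM, Matrix.mul_add, ← Matrix.mul_assoc, hM]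
    simp
  have e₂ : N * (M * N) = δ • N + δ • M := by
    rw [← Matrix.mul_assoc, hNM, Matrix.add_mul, Matrix.mul_assoc, hN]
    simp
  have e₃ : M * (M * N) = δ • N := by
    rw [← Matrix.mul_assoc, hM]
    simp
  have e₄ : M * N * N = δ • M := by
    rw [Matrix.mul_assoc, hN]
    simp
  -- The relations give C² = δ(x² + y² + yx) + MN(xy + yx), whose two brackets are dq and de.
  refine ⟨A.tensor (δ • 1) m.q + A.tensor (M * N) m.e, fun i j => ?_, ?_⟩
  · simp only [mulMat_add, add_mulMat, mulMat_tensor, hM, hN, hNM]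
    simp only [Pi.add_apply, tensor, map_add, map_smul, m.d_q, m.d_e, Matrix.add_apply]
    module
  rintro ⟨W, V, hW, hV, h⟩
  let W₀ : Matrix (Fin 2) (Fin 2) k := fun i j => m.ev 1 (W i j) 0
  let W₁ : Matrix (Fin 2) (Fin 2) k := fun i j => m.ev 1 (W i j) 1
  let V₀ : Matrix (Fin 2) (Fin 2) k := fun i j => m.ev 1 (V i j) 0
  let V₁ : Matrix (Fin 2) (Fin 2) k := fun i j => m.ev 1 (V i j) 1
  have hC : ∀ i j, (A.tensor M m.x + A.tensor N m.y) i j ∈ A.Z 1 := fun i j =>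
    Submodule.add_mem _ (Submodule.smul_mem _ _ m.x_mem) (Submodule.smul_mem _ _ m.y_mem)
  have hC₀ : ∀ i j, m.ev 1 ((A.tensor M m.x + A.tensor N m.y) i j) 0 = M i j := fun i j => by
    simp [tensor, m.ev_x, m.ev_y]
  have hC₁ : ∀ i j, m.ev 1 ((A.tensor M m.x + A.tensor N m.y) i j) 1 = N i j := fun i j => by
    simp [tensor, m.ev_x, m.ev_y]
  have key : ∀ i j, A.mulMat (A.tensor (δ • 1) m.q + A.tensor (M * N) m.e)
      (A.tensor M m.x + A.tensor N m.y) i j + A.mulMat (A.tensor M m.x + A.tensor N m.y)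
        (A.tensor (δ • 1) m.q + A.tensor (M * N) m.e) i j =
      (δ * M i j) • (A.mul (show (1 : ℤ) + 1 = 2 by rfl) m.x m.q +
        A.mul (show (1 : ℤ) + 1 = 2 by rfl) m.q m.x +
        A.mul (show (1 : ℤ) + 1 = 2 by rfl) m.e m.x + A.mul (show (1 : ℤ) + 1 = 2 by rfl) m.e m.y +
        A.mul (show (1 : ℤ) + 1 = 2 by rfl) m.y m.e) +
      (δ * N i j) • (A.mul (show (1 : ℤ) + 1 = 2 by rfl) m.y m.q +
        A.mul (show (1 : ℤ) + 1 = 2 by rfl) m.q m.y +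
        A.mul (show (1 : ℤ) + 1 = 2 by rfl) m.e m.x + A.mul (show (1 : ℤ) + 1 = 2 by rfl) m.x m.e +
        A.mul (show (1 : ℤ) + 1 = 2 by rfl) m.y m.e) := by
    intro i j
    simp only [mulMat_add, add_mulMat, mulMat_tensor, e₁, e₂, e₃, e₄, Matrix.smul_mul,
      Matrix.mul_smul, Matrix.one_mul, Matrix.mul_one]
    simp only [Pi.add_apply, tensor, Matrix.add_apply, Matrix.smul_apply, smul_eq_mul]
    module
  have h' := fun i j => m.ev_of_mem_B (h i j)
  simp only [key, map_add, map_smul, m.ev_secondary_x, m.ev_secondary_y,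
    m.ev_mulMat hW hC (X₀ := W₀) (X₁ := W₁) (fun _ _ => rfl) (fun _ _ => rfl) hC₀ hC₁,
    m.ev_mulMat hC hV (Y₀ := V₀) (Y₁ := V₁) hC₀ hC₁ (fun _ _ => rfl) (fun _ _ => rfl)] at h'
  -- The coordinates of WC + CV + δ(M + N)xy along y² and xy are the two matrix equations required.
  refine hδ (Matrix.eq_zero_of_quaternion_relations hM hN hNM htr (W₀ := W₀) (W₁ := W₁) (V₀ := V₀)
    (V₁ := V₁) ?_ ?_)
  · ext i j
    simpa using congrFun (h' i j) 0
  · ext i j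
    simpa [_root_.mul_add] using congrFun (h' i j) 1

/-- Any presentation is a linear change of the generators of the model, so C becomes Mx + Ny in
these generators. The quadratic equations for the coefficients are exactly the matrix relations
needed for the trace argument. -/
theorem zero_notMem_massey [CharP k 2] (m : A.QuaternionModel) {x y : A.cohomology.X 1} {s : A.cohomology.X 4}
    (h : IsQuaternionPresentation A.cohomology x y s) :
    0 ∉ A.massey (quaternionMatrix A.cohomology x y 0 1 rfl)
      (quaternionMatrix A.cohomology x y 1 2 rfl) (quaternionMatrix A.cohomology x y 2 3 rfl) := by
  have two := CharTwo.two_eq_zero (R := k)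
  obtain ⟨a, b, c, d, δ, rfl, rfl, hδ, h₁, h₂, h₃⟩ := m.coordinates.exists_of_isQuaternionPresentation h
  -- The coefficients in C of the model's x and y, for the generators ax + by and cx + dy.
  obtain ⟨T₀, hT₀, hnot⟩ := m.not_exists_of_relations (M := !![c, a + c; a, c])
    (N := !![d, b + d; b, d]) hδ
    (by
      ext i j
      fin_cases i <;> fin_cases j <;> simp [Matrix.mul_apply, Fin.sum_univ_two]
      · linear_combination h₁
      · linear_combination c * (a + c) * two
      · linear_combination c * a * two
      · linear_combination h₁)
    (by
      ext i j
      fin_cases i <;> fin_cases j <;> simp [Matrix.mul_apply, Fin.sum_univ_two]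
      · linear_combination h₂
      · linear_combination d * (b + d) * two
      · linear_combination d * b * two
      · linear_combination h₂)
    (by
      ext i j
      fin_cases i <;> fin_cases j <;> simp [Matrix.mul_apply, Fin.sum_univ_two]
      · linear_combination h₃ - b * c * two
      · ring
      · ring
      · linear_combination h₃ - a * d * two)
    (by
      simp [Matrix.trace, Fin.sum_univ_two]
      linear_combination h₃ + (c * d + a * b) * two)
  rintro h0
  obtain ⟨X, Y, Z, T, U, hS, h0⟩ := (A.mem_massey_iff _ _ _).1 h0
  refine hnot (A.exists_of_isMasseySystem hS h0 (fun i j => ?_) hT₀)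
  refine ⟨Submodule.add_mem _ (Submodule.smul_mem _ _ m.x_mem)
    (Submodule.smul_mem _ _ m.y_mem), ?_⟩
  refine (map_add A.hcls ((_ : k) • (⟨m.x, m.x_mem⟩ : A.Z 1)) ((_ : k) • (⟨m.y, m.y_mem⟩ : A.Z 1))).trans ?_
  rw [map_smul, map_smul]
  fin_cases i <;> fin_cases j <;> simp [quaternionEntries]
  module

end QuaternionModel
end DGAlg

/-! ## Consequences of the Massey product for the canonical class and for realisability -/

namespace GrAlg

variable {k : Type u} [Field k] {Λ : GrAlg.{w} k}

/-- The square of the matrix `((y, x + y), (x, y))` vanishes. -/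
theorem quaternionEntries_mul [CharP k 2] {x y : Λ.X 1} {s : Λ.X 4}
    (h : IsQuaternionPresentation Λ x y s) (i j : Fin 2) :
    ∑ l, Λ.mul (show (1 : ℤ) + 1 = 2 by rfl) (DGAlg.quaternionEntries Λ x y i l)
      (DGAlg.quaternionEntries Λ x y l j) = 0 := by
  have two : ∀ v : Λ.X 2, v + v = 0 := add_self_eq_zero_of_charTwo k
  have rel := mul_add_mul_of_isQuaternionPresentation h
  have comm := mul_comm_of_isQuaternionPresentation h
  rw [Fin.sum_univ_two]
  fin_cases i <;> fin_cases j <;>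
    simp only [DGAlg.quaternionEntries, Fin.zero_eta, Fin.mk_one, Matrix.of_apply,
      Matrix.cons_val_zero, Matrix.cons_val_one, map_add, LinearMap.add_apply]
  · rw [← comm, ← rel, add_left_comm, ← add_assoc, two]
  · rw [← comm, add_comm (Λ.mul _ x y), two]
  · rw [← comm, two]
  · rw [← rel, add_assoc, add_assoc, two, add_zero, two]

/-- Generators and relations of the cokernel of `((y, x + y), (x, y))`. -/
theorem exists_generators_coker (x y : Λ.X 1) :
    ∃ e : Fin 2 → (GrMod.coker (quaternionMatrix Λ x y 0 1 rfl).toHom).X 0,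
      (∀ j, ∑ i, (GrMod.coker (quaternionMatrix Λ x y 0 1 rfl).toHom).act (zero_add 1) (e i)
        (DGAlg.quaternionEntries Λ x y i j) = 0) ∧
      (∀ z : (GrMod.coker (quaternionMatrix Λ x y 0 1 rfl).toHom).X 1, ∃ W : Fin 2 → Λ.X 1,
        z = ∑ i, (GrMod.coker (quaternionMatrix Λ x y 0 1 rfl).toHom).act (zero_add 1) (e i)
          (W i)) ∧
      ∀ B : Fin 2 → Λ.X 2, ∑ i, (GrMod.coker (quaternionMatrix Λ x y 0 1 rfl).toHom).act
          (zero_add 2) (e i) (B i) = 0 →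
        ∃ V : Fin 2 → Λ.X 1, ∀ i, B i = ∑ j, Λ.mul (show (1 : ℤ) + 1 = 2 by rfl)
          (DGAlg.quaternionEntries Λ x y i j) (V j) := by
  let f := (quaternionMatrix Λ x y 0 1 rfl).toHom
  let e : Fin 2 → (GrMod.free Λ fun _ : Fin 2 => 0).X 0 := fun i =>
    Pi.single (M := fun _ : Fin 2 => Λ.X 0) i Λ.one
  have expand₁ : ∀ v : Fin 2 → Λ.X 1, ∑ i, (GrMod.free Λ fun _ : Fin 2 => 0).act (zero_add 1)
      (e i) (v i) = v := by
    intro v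
    funext l
    refine (Finset.sum_apply (M := fun _ : Fin 2 => Λ.X 1) l Finset.univ _).trans ?_
    rw [Finset.sum_eq_single l]
    · change Λ.mul _ (Pi.single (M := fun _ : Fin 2 => Λ.X 0) l Λ.one l) (v l) = v l
      rw [Pi.single_eq_same]
      exact Λ.one_mul _ _
    · intro i _ hi
      change Λ.mul _ (Pi.single (M := fun _ : Fin 2 => Λ.X 0) i Λ.one l) (v i) = 0
      rw [Pi.single_eq_of_ne hi.symm]
      exact LinearMap.map_zero₂ _ _
    · simp
  have expand₂ : ∀ v : Fin 2 → Λ.X 2, ∑ i, (GrMod.free Λ fun _ : Fin 2 => 0).act (zero_add 2)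
      (e i) (v i) = v := by
    intro v
    funext l
    refine (Finset.sum_apply (M := fun _ : Fin 2 => Λ.X 2) l Finset.univ _).trans ?_
    rw [Finset.sum_eq_single l]
    · change Λ.mul _ (Pi.single (M := fun _ : Fin 2 => Λ.X 0) l Λ.one l) (v l) = v l
      rw [Pi.single_eq_same]
      exact Λ.one_mul _ _
    · intro i _ hi
      change Λ.mul _ (Pi.single (M := fun _ : Fin 2 => Λ.X 0) i Λ.one l) (v i) = 0
      rw [Pi.single_eq_of_ne hi.symm]
      exact LinearMap.map_zero₂ _ _
    · simp
  refine ⟨fun i => (LinearMap.range (f.f 0)).mkQ (e i), fun j => ?_, fun z => ?_, fun B hB => ?_⟩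
  · change ∑ i, (LinearMap.range (f.f 1)).mkQ ((GrMod.free Λ fun _ : Fin 2 => 0).act (zero_add 1)
      (e i) (DGAlg.quaternionEntries Λ x y i j)) = 0
    rw [← map_sum, expand₁ fun i => DGAlg.quaternionEntries Λ x y i j]
    refine (Submodule.Quotient.mk_eq_zero _).2
      ⟨Pi.single (M := fun _ : Fin 2 => Λ.X 0) j Λ.one, ?_⟩
    funext i
    change ∑ l, Λ.mul (show (1 : ℤ) + 0 = 1 by rfl) (DGAlg.quaternionEntries Λ x y i l)
      (Pi.single (M := fun _ : Fin 2 => Λ.X 0) j Λ.one l) = _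
    rw [Finset.sum_eq_single j]
    · rw [Pi.single_eq_same, Λ.mul_one]
    · intro l _ hl
      rw [Pi.single_eq_of_ne hl, map_zero]
    · simp
  · obtain ⟨v, rfl⟩ := Submodule.mkQ_surjective _ z
    refine ⟨v, ?_⟩
    change _ = ∑ i, (LinearMap.range (f.f 1)).mkQ ((GrMod.free Λ fun _ : Fin 2 => 0).act
      (zero_add 1) (e i) (v i))
    rw [← map_sum, expand₁ v]
  · change ∑ i, (LinearMap.range (f.f 2)).mkQ ((GrMod.free Λ fun _ : Fin 2 => 0).act (zero_add 2)
      (e i) (B i)) = 0 at hB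
    rw [← map_sum, expand₂ B] at hB
    obtain ⟨V, hV⟩ := (Submodule.Quotient.mk_eq_zero _).1 hB
    exact ⟨V, fun i => (congrFun hV i).symm⟩

end GrAlg

namespace GrMod

variable {k : Type u} [Field k] {Λ : GrAlg.{w} k}

theorem IsSummandOf.trans_isIsoTo {M N L : GrMod Λ} (h : M.IsSummandOf N) (h' : N.IsIsoTo L) :
    M.IsSummandOf L := by
  obtain ⟨i, r, hir⟩ := h
  obtain ⟨f, g, hgf, -⟩ := h'
  refine ⟨⟨fun n => f.f n ∘ₗ i.f n, fun h a b => ?_⟩, ⟨fun n => r.f n ∘ₗ g.f n, fun h a b => ?_⟩,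
    fun n a => ?_⟩
  · simp only [LinearMap.comp_apply, i.map_act, f.map_act]
  · simp only [LinearMap.comp_apply, g.map_act, r.map_act]
  · simp only [LinearMap.comp_apply, hgf, hir]

end GrMod

namespace DGAlg

variable {k : Type u} [Field k] (A : DGAlg.{w} k)

/-- The class of the product of two matrices of cocycles. -/
theorem represents_mulMat {X Y : Fin 2 → Fin 2 → A.X 1} {C D : Fin 2 → Fin 2 → A.cohomology.X 1}
    (hX : ∀ i j, A.Represents (X i j) (C i j)) (hY : ∀ i j, A.Represents (Y i j) (D i j))
    (i j : Fin 2) : A.Represents (A.mulMat X Y i j)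
      (∑ l, A.cohomology.mul (show (1 : ℤ) + 1 = 2 by rfl) (C i l) (D l j)) := by
  refine ⟨mulMat_mem_Z (fun i j => (hX i j).1) (fun i j => (hY i j).1) i j, ?_⟩
  have : ∀ l, A.cohomology.mul (show (1 : ℤ) + 1 = 2 by rfl) (C i l) (D l j) =
      A.hcls ⟨A.mul (show (1 : ℤ) + 1 = 2 by rfl) (X i l) (Y l j),
        A.pairing.mem_Z (show (1 : ℤ) + 1 = 2 by rfl) (hX i l).1 (hY l j).1⟩ := by
    intro l
    rw [← (hX i l).2, ← (hY l j).2]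
    rfl
  simp only [this]
  rw [← map_sum]
  refine congrArg A.hcls (Subtype.ext ?_)
  rw [AddSubmonoidClass.coe_finsetSum]
  rfl

variable {A} in
theorem Represents.add {n : ℤ} {a b : A.X n} {x y : A.cohomology.X n} (ha : A.Represents a x)
    (hb : A.Represents b y) : A.Represents (a + b) (x + y) := by
  obtain ⟨ha, rfl⟩ := ha
  obtain ⟨hb, rfl⟩ := hb
  exact ⟨Submodule.add_mem _ ha hb, map_add A.hcls ⟨a, ha⟩ ⟨b, hb⟩⟩

theorem exists_represents {n : ℤ} (x : A.cohomology.X n) : ∃ a, A.Represents a x := by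
  obtain ⟨a, rfl⟩ := DGSpace.cls_surjective x
  exact ⟨a, a.2, rfl⟩

variable {x y : A.cohomology.X 1} {s : A.cohomology.X 4}

theorem exists_d_eq_mulMat [CharP k 2] (h : IsQuaternionPresentation A.cohomology x y s)
    {C : Fin 2 → Fin 2 → A.X 1}
    (hC : ∀ i j, A.Represents (C i j) (quaternionEntries A.cohomology x y i j)) :
    ∃ T : Fin 2 → Fin 2 → A.X 1, ∀ i j, A.d (show (1 : ℤ) + 1 = 2 by rfl) (T i j) =
      A.mulMat C C i j := by
  have : ∀ i j, ∃ T : A.X 1, A.d (show (1 : ℤ) + 1 = 2 by rfl) T = A.mulMat C C i j := by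
    intro i j
    have := A.represents_mulMat hC hC i j
    rw [GrAlg.quaternionEntries_mul h, represents_zero] at this
    exact (DGSpace.mem_B _).1 this
  choose T hT using this
  exact ⟨T, hT⟩

/-- Both summands have boundary C³, and these cancel in characteristic 2. -/
theorem secondary_mem_Z [CharP k 2] {C T : Fin 2 → Fin 2 → A.X 1} (hC : ∀ i j, C i j ∈ A.Z 1)
    (hT : ∀ i j, A.d (show (1 : ℤ) + 1 = 2 by rfl) (T i j) = A.mulMat C C i j) (i j : Fin 2) :
    A.mulMat T C i j + A.mulMat C T i j ∈ A.Z 2 := by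
  have two : ∀ v : A.X 3, (2 : ℤ) • v = 0 := fun v => by
    rw [two_smul, add_self_eq_zero_of_charTwo k]
  have hd : ∀ i j, A.d (show (1 : ℤ) + 1 = 2 by rfl) (C i j) = 0 := fun i j =>
    (DGSpace.mem_Z _).1 (hC i j)
  have leib : ∀ u v : A.X 1, A.d (show (2 : ℤ) + 1 = 3 by rfl)
      (A.mul (show (1 : ℤ) + 1 = 2 by rfl) u v) =
        A.mul (show (2 : ℤ) + 1 = 3 by rfl) (A.d (show (1 : ℤ) + 1 = 2 by rfl) u) v +
        A.mul (show (1 : ℤ) + 2 = 3 by rfl) u (A.d (show (1 : ℤ) + 1 = 2 by rfl) v) := by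
    intro u v
    rw [A.leibniz _ (show (1 : ℤ) + 1 = 2 by rfl) (show (1 : ℤ) + 1 = 2 by rfl) _
      (show (2 : ℤ) + 1 = 3 by rfl) (show (1 : ℤ) + 2 = 3 by rfl), units_smul_of_charTwo k]
  rw [DGSpace.mem_Z (show (2 : ℤ) + 1 = 3 by rfl)]
  simp only [mulMat, Fin.sum_univ_two] at hT
  simp only [mulMat, Fin.sum_univ_two, map_add, leib, hd, hT, map_zero, LinearMap.zero_apply,
    zero_add, add_zero, LinearMap.add_apply, A.mul_assoc (show (1 : ℤ) + 1 = 2 by rfl)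
      (show (1 : ℤ) + 1 = 2 by rfl) (show (2 : ℤ) + 1 = 3 by rfl) (show (1 : ℤ) + 2 = 3 by rfl)]
  abel_nf
  simp only [two, add_zero]

/-- Since C² = 0 in cohomology, one null-homotopy of the square of a matrix of representatives
serves as both T and U. -/
theorem massey_nonempty [CharP k 2] (h : IsQuaternionPresentation A.cohomology x y s) :
    (A.massey (quaternionMatrix A.cohomology x y 0 1 rfl)
      (quaternionMatrix A.cohomology x y 1 2 rfl)
      (quaternionMatrix A.cohomology x y 2 3 rfl)).Nonempty := by
  choose C hC using fun i j => A.exists_represents (quaternionEntries A.cohomology x y i j)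
  obtain ⟨T, hT⟩ := A.exists_d_eq_mulMat h hC
  exact ⟨fun i j => A.hcls ⟨_, A.secondary_mem_Z (fun i j => (hC i j).1) hT i j⟩,
    (A.mem_massey_iff _ _ _).2 ⟨C, C, C, T, T, ⟨hC, hC, hC, hT, hT⟩, fun i j => ⟨_, rfl⟩⟩⟩

/-- Adding cocycles representing W and V to the two copies of T gives another defining system, whose
class differs by WC + CV. A class of that very form would thus be moved to zero. -/
theorem not_exists_of_zero_notMem_massey [CharP k 2]
    (h0 : 0 ∉ A.massey (quaternionMatrix A.cohomology x y 0 1 rfl)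
      (quaternionMatrix A.cohomology x y 1 2 rfl) (quaternionMatrix A.cohomology x y 2 3 rfl))
    {C T : Fin 2 → Fin 2 → A.X 1}
    (hC : ∀ i j, A.Represents (C i j) (quaternionEntries A.cohomology x y i j))
    (hT : ∀ i j, A.d (show (1 : ℤ) + 1 = 2 by rfl) (T i j) = A.mulMat C C i j)
    (W V : Fin 2 → Fin 2 → A.cohomology.X 1)
    (h : ∀ i j, A.Represents (A.mulMat T C i j + A.mulMat C T i j)
      (∑ l, A.cohomology.mul (show (1 : ℤ) + 1 = 2 by rfl) (W i l)
          (quaternionEntries A.cohomology x y l j) +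
        ∑ l, A.cohomology.mul (show (1 : ℤ) + 1 = 2 by rfl)
          (quaternionEntries A.cohomology x y i l) (V l j))) : False := by
  choose W' hW using fun i j => A.exists_represents (W i j)
  choose V' hV using fun i j => A.exists_represents (V i j)
  refine h0 ((A.mem_massey_iff _ _ _).2 ⟨C, C, C, T + W', T + V', ⟨hC, hC, hC, fun i j => ?_,
    fun i j => ?_⟩, fun i j => ?_⟩)
  · rw [Pi.add_apply, Pi.add_apply, map_add, hT, (DGSpace.mem_Z _).1 (hW i j).1, add_zero]
  · rw [Pi.add_apply, Pi.add_apply, map_add, hT, (DGSpace.mem_Z _).1 (hV i j).1, add_zero]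
  · rw [mulMat_add, add_mulMat]
    have := (h i j).add ((A.represents_mulMat hW hC i j).add (A.represents_mulMat hC hV i j))
    rw [add_self_eq_zero_of_charTwo k] at this
    convert this using 1
    · simp only [Pi.add_apply]
      abel
    · rfl

/-- Summing the secondary multiplication over the entries of C gives an element of the Massey
product, because C² = 0 removes the terms f₂(ab, c) and f₂(a, bc). Were it a coboundary of g, the
same cancellation would leave GC + CG with G the matrix of sums of g over the entries. -/
theorem gamma_ne_zero [CharP k 2] (h : IsQuaternionPresentation A.cohomology x y s)
    (h0 : 0 ∉ A.massey (quaternionMatrix A.cohomology x y 0 1 rfl)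
      (quaternionMatrix A.cohomology x y 1 2 rfl) (quaternionMatrix A.cohomology x y 2 3 rfl))
    (c : A.Choices) : c.gamma ≠ 0 := by
  intro hc
  obtain ⟨g, hg⟩ : c.m ∈ A.cohomology.hochschildCoboundaries (-1) :=
    (Submodule.Quotient.mk_eq_zero ((A.cohomology.hochschildCoboundaries (-1)).submoduleOf
      (A.cohomology.hochschildCocycles (-1)))).1 hc
  let C := quaternionEntries A.cohomology x y
  have hCC : ∀ i j, A.cohomology.mul (show (1 : ℤ) + 1 = 2 by rfl) (C i 0) (C 0 j) +
      A.cohomology.mul (show (1 : ℤ) + 1 = 2 by rfl) (C i 1) (C 1 j) = 0 := by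
    intro i j
    have := GrAlg.quaternionEntries_mul h i j
    rwa [Fin.sum_univ_two] at this
  -- Here dT = f₁(C²) - f₁(C)f₁(C), and f₁(C²) = 0.
  let T : Fin 2 → Fin 2 → A.X 1 := fun i j =>
    ∑ l, c.f₂ (show (1 : ℤ) + 1 - 1 = 1 by rfl) (C i l) (C l j)
  let G : Fin 2 → Fin 2 → A.cohomology.X 1 := fun i j =>
    ∑ l, GrAlg.C2.app g (show (1 : ℤ) + 1 + -1 = 1 by rfl) (C i l) (C l j)
  refine A.not_exists_of_zero_notMem_massey h0 (C := fun i j => c.f₁ (C i j)) (T := T)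
    (fun i j => c.represents_f₁ _) (fun i j => ?_) G G (fun i j => ?_)
  · rw [map_sum]
    simp only [c.d_f₂ (show (1 : ℤ) + 1 - 1 = 1 by rfl) (show (1 : ℤ) + 1 = 2 by rfl)
      (show (1 : ℤ) + 1 = 2 by rfl)]
    rw [Finset.sum_sub_distrib, ← map_sum, GrAlg.quaternionEntries_mul h, map_zero, zero_sub,
      neg_eq_of_charTwo k]
    rfl
  · have hT : ∀ u v w : A.cohomology.X 1, A.Represents
        (A.mul (show (1 : ℤ) + 1 = 2 by rfl) (c.f₂ (show (1 : ℤ) + 1 - 1 = 1 by rfl) u v) (c.f₁ w) +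
          c.f₂ (show (1 : ℤ) + 2 - 1 = 2 by rfl) u
            (A.cohomology.mul (show (1 : ℤ) + 1 = 2 by rfl) v w) +
          c.f₂ (show (2 : ℤ) + 1 - 1 = 2 by rfl)
            (A.cohomology.mul (show (1 : ℤ) + 1 = 2 by rfl) u v) w +
          A.mul (show (1 : ℤ) + 1 = 2 by rfl) (c.f₁ u) (c.f₂ (show (1 : ℤ) + 1 - 1 = 1 by rfl) v w))
        (A.cohomology.mul (show (1 : ℤ) + 1 = 2 by rfl) u
            (GrAlg.C2.app g (show (1 : ℤ) + 1 + -1 = 1 by rfl) v w) +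
          GrAlg.C2.app g (show (2 : ℤ) + 1 + -1 = 2 by rfl)
            (A.cohomology.mul (show (1 : ℤ) + 1 = 2 by rfl) u v) w +
          GrAlg.C2.app g (show (1 : ℤ) + 2 + -1 = 2 by rfl) u
            (A.cohomology.mul (show (1 : ℤ) + 1 = 2 by rfl) v w) +
          A.cohomology.mul (show (1 : ℤ) + 1 = 2 by rfl)
            (GrAlg.C2.app g (show (1 : ℤ) + 1 + -1 = 1 by rfl) u v) w) := by
      intro u v w
      have e : A.Represents
          (A.mul (show (1 : ℤ) + 1 = 2 by rfl) (c.f₂ (show (1 : ℤ) + 1 - 1 = 1 by rfl) u v)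
              (c.f₁ w) -
            c.f₂ (show (1 : ℤ) + 2 - 1 = 2 by rfl) u
              (A.cohomology.mul (show (1 : ℤ) + 1 = 2 by rfl) v w) +
            c.f₂ (show (2 : ℤ) + 1 - 1 = 2 by rfl)
              (A.cohomology.mul (show (1 : ℤ) + 1 = 2 by rfl) u v) w -
            (1 : ℤ).negOnePow • A.mul (show (1 : ℤ) + 1 = 2 by rfl) (c.f₁ u)
              (c.f₂ (show (1 : ℤ) + 1 - 1 = 1 by rfl) v w))
          ((-1 * 1 : ℤ).negOnePow • A.cohomology.mul (show (1 : ℤ) + 1 = 2 by rfl) u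
              (GrAlg.C2.app g (show (1 : ℤ) + 1 + -1 = 1 by rfl) v w) -
            GrAlg.C2.app g (show (2 : ℤ) + 1 + -1 = 2 by rfl)
              (A.cohomology.mul (show (1 : ℤ) + 1 = 2 by rfl) u v) w +
            GrAlg.C2.app g (show (1 : ℤ) + 2 + -1 = 2 by rfl) u
              (A.cohomology.mul (show (1 : ℤ) + 1 = 2 by rfl) v w) -
            A.cohomology.mul (show (1 : ℤ) + 1 = 2 by rfl)
              (GrAlg.C2.app g (show (1 : ℤ) + 1 + -1 = 1 by rfl) u v) w) :=
        ⟨c.cochain_mem_Z (show (1 : ℤ) + 1 + 1 - 1 = 2 by rfl) u v w,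
          (c.app_m (show (1 : ℤ) + 1 + 1 + -1 = 2 by rfl) u v w).symm.trans (hg 1 1 1 u v w)⟩
      simpa only [units_smul_of_charTwo k, sub_eq_add_neg, neg_eq_of_charTwo k (M := A.X 2),
        neg_eq_of_charTwo k (M := A.cohomology.X 2)] using e
    -- In this and the next three sums an inner product of entries adds up to an entry of C² = 0.
    have f_right : ∀ l, c.f₂ (show (1 : ℤ) + 2 - 1 = 2 by rfl) (C i l)
          (A.cohomology.mul (show (1 : ℤ) + 1 = 2 by rfl) (C l 0) (C 0 j)) +
        c.f₂ (show (1 : ℤ) + 2 - 1 = 2 by rfl) (C i l)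
          (A.cohomology.mul (show (1 : ℤ) + 1 = 2 by rfl) (C l 1) (C 1 j)) = 0 := fun l => by
      rw [← map_add, hCC, map_zero]
    have f_left : ∀ l, c.f₂ (show (2 : ℤ) + 1 - 1 = 2 by rfl)
          (A.cohomology.mul (show (1 : ℤ) + 1 = 2 by rfl) (C i 0) (C 0 l)) (C l j) +
        c.f₂ (show (2 : ℤ) + 1 - 1 = 2 by rfl)
          (A.cohomology.mul (show (1 : ℤ) + 1 = 2 by rfl) (C i 1) (C 1 l)) (C l j) = 0 :=
      fun l => by rw [← LinearMap.add_apply, ← map_add, hCC, map_zero, LinearMap.zero_apply]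
    have g_right : ∀ l, GrAlg.C2.app g (show (1 : ℤ) + 2 + -1 = 2 by rfl) (C i l)
          (A.cohomology.mul (show (1 : ℤ) + 1 = 2 by rfl) (C l 0) (C 0 j)) +
        GrAlg.C2.app g (show (1 : ℤ) + 2 + -1 = 2 by rfl) (C i l)
          (A.cohomology.mul (show (1 : ℤ) + 1 = 2 by rfl) (C l 1) (C 1 j)) = 0 := fun l => by
      rw [GrAlg.C2.app, GrAlg.C2.app, ← map_add, ← map_add, hCC, map_zero, map_zero]
    have g_left : ∀ l, GrAlg.C2.app g (show (2 : ℤ) + 1 + -1 = 2 by rfl)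
          (A.cohomology.mul (show (1 : ℤ) + 1 = 2 by rfl) (C i 0) (C 0 l)) (C l j) +
        GrAlg.C2.app g (show (2 : ℤ) + 1 + -1 = 2 by rfl)
          (A.cohomology.mul (show (1 : ℤ) + 1 = 2 by rfl) (C i 1) (C 1 l)) (C l j) = 0 :=
      fun l => by
        rw [GrAlg.C2.app, GrAlg.C2.app, ← map_add, ← LinearMap.add_apply, ← map_add, hCC,
          map_zero, LinearMap.zero_apply, map_zero]
    have total := ((hT (C i 0) (C 0 0) (C 0 j)).add (hT (C i 0) (C 0 1) (C 1 j))).add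
      ((hT (C i 1) (C 1 0) (C 0 j)).add (hT (C i 1) (C 1 1) (C 1 j)))
    convert total using 1
    · simp only [mulMat, T, Fin.sum_univ_two, map_add, LinearMap.add_apply]
      linear_combination (norm := abel) (-1 : ℤ) • f_right 0 + (-1 : ℤ) • f_right 1 +
        (-1 : ℤ) • f_left 0 + (-1 : ℤ) • f_left 1
    · simp only [G, Fin.sum_univ_two, map_add, LinearMap.add_apply]
      linear_combination (norm := abel) (-1 : ℤ) • g_right 0 + (-1 : ℤ) • g_right 1 +
        (-1 : ℤ) • g_left 0 + (-1 : ℤ) • g_left 1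

/-- The cohomology class of a cocycle of a differential graded module. -/
def _root_.DGMod.hcls {A : DGAlg.{w} k} (N : DGMod A) {n : ℤ} : N.Z n →ₗ[k] N.cohomology.X n :=
  N.cls

variable {A} in
theorem _root_.DGMod.sum_act_hcls {N : DGMod A} {m n p : ℤ} (h : m + n = p) (u : Fin 2 → N.Z m)
    {v : Fin 2 → A.X n} {z : Fin 2 → A.cohomology.X n} (hv : ∀ a, A.Represents (v a) (z a)) :
    ∃ hm : ∑ a, N.act h (u a) (v a) ∈ N.Z p,
      ∑ a, N.cohomology.act h (N.hcls (u a)) (z a) = N.hcls ⟨_, hm⟩ := by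
  have hm : ∀ a, N.act h (u a) (v a) ∈ N.Z p := fun a =>
    (DGSpace.Pairing.mk N.act N.leibniz : DGSpace.Pairing N.toDGSpace A.toDGSpace
      N.toDGSpace).mem_Z h (u a).2 (hv a).1
  refine ⟨Submodule.sum_mem _ fun a _ => hm a, ?_⟩
  have : ∀ a, N.cohomology.act h (N.hcls (u a)) (z a) = N.hcls ⟨_, hm a⟩ := by
    intro a
    rw [← (hv a).2]
    rfl
  simp only [this]
  rw [← map_sum]
  refine congrArg N.hcls (Subtype.ext ?_)
  rw [AddSubmonoidClass.coe_finsetSum]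

/-- The relation eC = 0 among the generators of the cokernel is lifted to cochains of N. The
resulting secondary operation shows that e times the Massey class lies in the right multiples of C
up to boundaries; retracting to the cokernel turns this into an equation over the algebra itself. -/
theorem not_isSummandOf_cohomology [CharP k 2] (h : IsQuaternionPresentation A.cohomology x y s)
    (h0 : 0 ∉ A.massey (quaternionMatrix A.cohomology x y 0 1 rfl)
      (quaternionMatrix A.cohomology x y 1 2 rfl) (quaternionMatrix A.cohomology x y 2 3 rfl))
    (N : DGMod A) :
    ¬ (GrMod.coker (quaternionMatrix A.cohomology x y 0 1 rfl).toHom).IsSummandOf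
      N.cohomology := by
  rintro ⟨i, r, hir⟩
  obtain ⟨e, he, hgen, hrel⟩ := GrAlg.exists_generators_coker x y
  choose C hC using fun i j => A.exists_represents (quaternionEntries A.cohomology x y i j)
  obtain ⟨T, hT⟩ := A.exists_d_eq_mulMat h hC
  obtain ⟨μ, hμ⟩ : ∃ μ : Fin 2 → N.Z 0, ∀ a, N.hcls (μ a) = i.f 0 (e a) :=
    ⟨_, fun a => (DGSpace.cls_surjective (C := N.toDGSpace) (i.f 0 (e a))).choose_spec⟩
  have hdμ : ∀ a, N.d (show (0 : ℤ) + 1 = 1 by rfl) (μ a) = 0 := fun a =>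
    (DGSpace.mem_Z _).1 (μ a).2
  have leib₀ : ∀ (u : N.X 0) (v : A.X 1), N.d (show (1 : ℤ) + 1 = 2 by rfl)
      (N.act (show (0 : ℤ) + 1 = 1 by rfl) u v) =
        N.act (show (1 : ℤ) + 1 = 2 by rfl) (N.d (show (0 : ℤ) + 1 = 1 by rfl) u) v +
        N.act (show (0 : ℤ) + 2 = 2 by rfl) u (A.d (show (1 : ℤ) + 1 = 2 by rfl) v) := by
    intro u v
    rw [N.leibniz _ (show (0 : ℤ) + 1 = 1 by rfl) (show (1 : ℤ) + 1 = 2 by rfl) _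
      (show (1 : ℤ) + 1 = 2 by rfl) (show (0 : ℤ) + 2 = 2 by rfl), units_smul_of_charTwo k]
  have assoc : ∀ (u : N.X 0) (v w : A.X 1), N.act (show (1 : ℤ) + 1 = 2 by rfl)
      (N.act (show (0 : ℤ) + 1 = 1 by rfl) u v) w = N.act (show (0 : ℤ) + 2 = 2 by rfl) u
        (A.mul (show (1 : ℤ) + 1 = 2 by rfl) v w) := fun u v w => N.act_mul _ _ _ _ u v w
  have two : ∀ v : N.X 2, (2 : ℤ) • v = 0 := fun v => by
    rw [two_smul, add_self_eq_zero_of_charTwo k]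
  -- The relation eC = 0 holds in H^*N after applying `i`, so μC is a boundary.
  have hν : ∀ j, ∃ ν : N.X 0, N.d (show (0 : ℤ) + 1 = 1 by rfl) ν =
      ∑ a, N.act (show (0 : ℤ) + 1 = 1 by rfl) (μ a) (C a j) := by
    intro j
    refine (DGSpace.mem_B _).1 ?_
    obtain ⟨hm, hm'⟩ := DGMod.sum_act_hcls (show (0 : ℤ) + 1 = 1 by rfl) μ
      (fun a => hC a j)
    refine DGSpace.cls_eq_zero.1 (hm'.symm.trans ?_)
    have := congrArg (i.f 1) (he j)
    simp only [map_sum, map_zero, i.map_act, ← hμ] at this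
    exact this
  choose ν hν using hν
  -- The bracket cocycle νC + μT: both terms have boundary μC².
  let w : Fin 2 → N.X 1 := fun l => ∑ j, N.act (show (0 : ℤ) + 1 = 1 by rfl) (ν j) (C j l) +
    ∑ a, N.act (show (0 : ℤ) + 1 = 1 by rfl) (μ a) (T a l)
  have hdC : ∀ i j, A.d (show (1 : ℤ) + 1 = 2 by rfl) (C i j) = 0 := fun i j =>
    (DGSpace.mem_Z _).1 (hC i j).1
  have hw : ∀ l, w l ∈ N.Z 1 := by
    intro l
    rw [DGSpace.mem_Z (show (1 : ℤ) + 1 = 2 by rfl)]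
    simp only [w, mulMat, Fin.sum_univ_two, map_add, leib₀, hν, hdμ, hdC, hT, map_zero,
      LinearMap.zero_apply, LinearMap.add_apply, assoc, zero_add, add_zero]
    abel_nf
    simp only [two, add_zero]
  choose W hW using fun l => hgen (r.f 1 (N.hcls ⟨w l, hw l⟩))
  have hB := A.secondary_mem_Z (fun i j => (hC i j).1) hT
  -- Expanding d(νT) = μCT + νC² and wC = νC² + μTC gives μ(TC + CT) + wC = d(νT).
  have bound : ∀ j, ∑ a, N.act (show (0 : ℤ) + 2 = 2 by rfl) (μ a)
        (A.mulMat T C a j + A.mulMat C T a j) +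
      ∑ l, N.act (show (1 : ℤ) + 1 = 2 by rfl) (w l) (C l j) =
      N.d (show (1 : ℤ) + 1 = 2 by rfl) (∑ l, N.act (show (0 : ℤ) + 1 = 1 by rfl) (ν l) (T l j)) := by
    intro j
    rw [← sub_eq_zero, sub_eq_add_neg, neg_eq_of_charTwo k]
    simp only [w, mulMat, Fin.sum_univ_two, map_add, leib₀, hν, hT,
      LinearMap.add_apply, assoc]
    abel_nf
    simp only [two, add_zero]
  have classes : ∀ j, ∑ a, N.cohomology.act (show (0 : ℤ) + 2 = 2 by rfl) (i.f 0 (e a))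
        (A.hcls ⟨_, hB a j⟩) + ∑ l, N.cohomology.act (show (1 : ℤ) + 1 = 2 by rfl)
        (N.hcls ⟨w l, hw l⟩) (quaternionEntries A.cohomology x y l j) = 0 := by
    intro j
    obtain ⟨hm, hm'⟩ := DGMod.sum_act_hcls (show (0 : ℤ) + 2 = 2 by rfl) μ
      (fun a => (⟨hB a j, rfl⟩ : A.Represents _ (A.hcls ⟨_, hB a j⟩)))
    obtain ⟨hn, hn'⟩ := DGMod.sum_act_hcls (show (1 : ℤ) + 1 = 2 by rfl)
      (fun l => (⟨w l, hw l⟩ : N.Z 1)) (fun a => hC a j)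
    simp only [hμ] at hm'
    rw [hm', hn', ← map_add]
    refine DGSpace.cls_eq_zero.2 ?_
    refine (DGSpace.mem_B (show (1 : ℤ) + 1 = 2 by rfl)).2 ⟨_, (bound j).symm⟩
  have relation : ∀ j, ∑ a, (GrMod.coker (quaternionMatrix A.cohomology x y 0 1 rfl).toHom).act
      (zero_add 2) (e a) (A.hcls ⟨_, hB a j⟩ + ∑ l, A.cohomology.mul
        (show (1 : ℤ) + 1 = 2 by rfl) (W l a) (quaternionEntries A.cohomology x y l j)) = 0 := by
    intro j
    have := congrArg (r.f 2) (classes j)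
    simp only [map_add, map_sum, map_zero, r.map_act, hir, hW, LinearMap.sum_apply] at this
    rw [← this]
    simp only [map_add, map_sum, Finset.sum_add_distrib]
    congr 1
    rw [Finset.sum_comm]
    exact Finset.sum_congr rfl fun l _ => Finset.sum_congr rfl fun a _ =>
      ((GrMod.coker (quaternionMatrix A.cohomology x y 0 1 rfl).toHom).act_mul _ _ _ _ _ _ _).symm
  -- A combination of the generators that vanishes in the cokernel has coefficients in the column
  -- space of C. This supplies V, so the Massey class equals WC + CV, where W appears transposed in
  -- its indices.
  choose V hV using fun j => hrel _ (relation j)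
  refine A.not_exists_of_zero_notMem_massey h0 hC hT (fun a l => W l a) (fun l j => V j l)
    fun a j => ⟨hB a j, ?_⟩
  rw [← hV j a, add_left_comm, add_self_eq_zero_of_charTwo k, add_zero]

end DGAlg

/-! ## The quaternion model of the periodic resolution -/

namespace QuaternionResolution

open QuaternionGroup

variable {k : Type u} [Field k]

theorem tableMap_eq_of_isZero_add [CharP k 2] {S T : Table} {m n : ℕ}
    (h : (S.add T).IsZero m n) : tableMap k S m n = tableMap k T m n := by
  have e := tableMap_eq_zero (k := k) h
  rw [tableMap_add] at e
  have two : tableMap k T m n + tableMap k T m n = 0 := by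
    rw [← tableMap_add]
    refine tableMap_eq_zero fun i j g _ => ?_
    rw [Table.add, List.count_append]
    exact Even.add_self _
  exact add_right_cancel (e.trans two.symm)

theorem tableMap_idTable : ∀ {c c' : ZMod 4}, c = c' → ∀ (i : ℕ) (h : i < rk c) (h' : i < rk c'),
    tableMap k idTable (rk c) (rk c') (Pi.single ⟨i, h⟩ 1) = Pi.single ⟨i, h'⟩ 1 := by
  rintro c _ rfl i h h'
  have key : ∀ (c : ZMod 4) (i j : Fin (rk c)), idTable i j = if j = i then [a 0] else [] := by
    decide
  funext j
  rw [tableMap_single, one_mul, key, Pi.single_apply]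
  split_ifs
  · rw [listSum_singleton]
    exact map_one _
  · rfl

theorem tableMap_idTable_eq_id (c : ZMod 4) :
    tableMap k idTable (rk c) (rk c) = LinearMap.id := by
  refine LinearMap.pi_ext' fun i => LinearMap.ext_ring ?_
  exact tableMap_idTable rfl i i.2 i.2

/-- The augmentations of the coefficients of a linear form. -/
noncomputable def coefficients (m : ℕ) :
    ((Fin m → MonoidAlgebra k Q8) →ₗ[MonoidAlgebra k Q8] (Fin 1 → MonoidAlgebra k Q8)) →ₗ[k]
      (Fin 2 → k) where
  toFun f i := if h : (i : ℕ) < m then augmentation k (f (Pi.single ⟨i, h⟩ 1) 0) else 0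
  map_add' f g := by
    funext i
    by_cases h : (i : ℕ) < m
    · simp [h]
    · simp [h]
  map_smul' r f := by
    funext i
    by_cases h : (i : ℕ) < m
    · simp [h]
    · simp [h]

theorem coefficients_apply {m : ℕ}
    (f : (Fin m → MonoidAlgebra k Q8) →ₗ[MonoidAlgebra k Q8] (Fin 1 → MonoidAlgebra k Q8))
    (i : Fin 2) (h : (i : ℕ) < m) :
    coefficients m f i = augmentation k (f (Pi.single ⟨i, h⟩ 1) 0) := dif_pos h

theorem coefficients_of_not_lt {m : ℕ}
    (f : (Fin m → MonoidAlgebra k Q8) →ₗ[MonoidAlgebra k Q8] (Fin 1 → MonoidAlgebra k Q8))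
    (i : Fin 2) (h : ¬ (i : ℕ) < m) : coefficients m f i = 0 := dif_neg h

theorem coefficients_tableMap [CharP k 2] {c : ZMod 4} {T : Table} (v : Fin 2 → ℕ)
    (hv : ∀ i : Fin 2, (if (i : ℕ) < rk c then (T i 0).length else 0) % 2 = v i) :
    coefficients (rk c) (tableMap k T (rk c) 1) = fun i => (v i : k) := by
  funext i
  rw [← hv i, ← CharP.cast_eq_mod k 2]
  by_cases h : (i : ℕ) < rk c
  · rw [coefficients_apply _ i h, if_pos h, tableMap_single, one_mul, augmentation_listSum]
    rfl
  · rw [coefficients_of_not_lt _ i h, if_neg h, Nat.cast_zero]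

theorem coefficients_eq_zero {m : ℕ}
    {f : (Fin m → MonoidAlgebra k Q8) →ₗ[MonoidAlgebra k Q8] (Fin 1 → MonoidAlgebra k Q8)}
    (h : ∀ i, IsSmall (f (Pi.single i 1))) : coefficients m f = 0 := by
  funext i
  by_cases hi : (i : ℕ) < m
  · rw [coefficients_apply _ i hi]
    exact h _ 0
  · exact coefficients_of_not_lt _ i hi

theorem augmentation_eq_zero_of_coefficients {m : ℕ} (hm : m ≤ 2)
    {f : (Fin m → MonoidAlgebra k Q8) →ₗ[MonoidAlgebra k Q8] (Fin 1 → MonoidAlgebra k Q8)}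
    (h : coefficients m f = 0) (v : Fin m → MonoidAlgebra k Q8) :
    augmentationSum k 1 (f v) = 0 := by
  refine augmentationSum_eq_zero fun j => ?_
  rw [augmentation_apply]
  refine Finset.sum_eq_zero fun i _ => ?_
  rw [Subsingleton.elim j 0, ← coefficients_apply f ⟨i, i.2.trans_le hm⟩ i.2, h, Pi.zero_apply,
    mul_zero]

theorem coefficients_comp_idTable {c c' : ZMod 4} (e : c = c')
    (f : (Fin (rk c') → MonoidAlgebra k Q8) →ₗ[MonoidAlgebra k Q8] (Fin 1 → MonoidAlgebra k Q8)) :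
    coefficients (rk c) (f ∘ₗ tableMap k idTable (rk c) (rk c')) = coefficients (rk c') f := by
  funext i
  by_cases hi : (i : ℕ) < rk c
  · have hi' : (i : ℕ) < rk c' := by rwa [← e]
    rw [coefficients_apply _ i hi, coefficients_apply _ i hi', LinearMap.comp_apply,
      tableMap_idTable e i hi hi']
  · rw [coefficients_of_not_lt _ i hi, coefficients_of_not_lt _ i (by rwa [← e])]

variable [CharP k 2]

variable (k) in
/-- The endomorphism algebra of the periodic resolution. -/
noncomputable abbrev endAlg : DGAlg.{u} k := endDGAlg k (complex k)

variable (k) in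
/-- The homogeneous map of a given degree given by tables of the entries of matrices. -/
noncomputable def periodic (T : ZMod 4 → Table) (n : ℤ) : (endAlg k).X n :=
  Cochain.mk fun p q _ => ModuleCat.ofHom (tableMap k (T p) (rk p) (rk q))

/-- The components of an element of the endomorphism algebra. -/
noncomputable def component {n : ℤ} (b : (endAlg k).X n) {p q : ℤ} (h : p + n = q) :
    (Fin (rk p) → MonoidAlgebra k Q8) →ₗ[MonoidAlgebra k Q8] (Fin (rk q) → MonoidAlgebra k Q8) :=
  (Cochain.v b p q h).hom

theorem ext_component {n : ℤ} {b b' : (endAlg k).X n}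
    (h : ∀ (p q : ℤ) (hpq : p + n = q), component b hpq = component b' hpq) : b = b' :=
  Cochain.ext _ _ fun p q hpq => ModuleCat.hom_ext (h p q hpq)

theorem component_add {n : ℤ} (b b' : (endAlg k).X n) {p q : ℤ}
    (h : p + n = q) : component (b + b') h = component b h + component b' h := rfl

theorem component_smul {n : ℤ} (r : k) (b : (endAlg k).X n) {p q : ℤ}
    (h : p + n = q) : component (r • b) h = r • component b h := by
  refine LinearMap.ext fun v => ?_
  change algebraMap k (MonoidAlgebra k Q8) r • component b h v = r • component b h v
  rw [algebraMap_smul]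

theorem component_mul {m n l : ℤ} (h : m + n = l) (a : (endAlg k).X m) (b : (endAlg k).X n)
    {p q r : ℤ} (hpq : p + n = q) (hqr : q + m = r) (hpr : p + l = r) :
    component ((endAlg k).mul h a b) hpr = component a hqr ∘ₗ component b hpq :=
  congrArg ModuleCat.Hom.hom (Cochain.comp_v b a ((add_comm n m).trans h) p q r hpq hqr)

theorem component_one (p : ℤ) : component (endAlg k).one (add_zero p) = LinearMap.id :=
  congrArg ModuleCat.Hom.hom (Cochain.ofHom_v (𝟙 (complex k)) p)

theorem component_d {n m : ℤ} (h : n + 1 = m) (b : (endAlg k).X n)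
    {p q r s : ℤ} (hpq : p + n = q) (hqs : q + 1 = s) (hpr : p + 1 = r) (hrs : r + n = s)
    (hps : p + m = s) : component ((endAlg k).d h b) hps =
      tableMap k (diffTable q) (rk q) (rk s) ∘ₗ component b hpq +
        component b hrs ∘ₗ tableMap k (diffTable p) (rk p) (rk r) := by
  have e := δ_v n m h b p s hps q r (by omega) hpr
  rw [units_smul_of_charTwo k, complex_d k hqs, complex_d k hpr] at e
  exact congrArg ModuleCat.Hom.hom e

theorem component_periodic (T : ZMod 4 → Table) (n : ℤ) {p q : ℤ} (h : p + n = q) :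
    component (periodic k T n) h = tableMap k (T p) (rk p) (rk q) := rfl

theorem component_mul_periodic {m n l : ℤ} (h : m + n = l) (S T : ZMod 4 → Table)
    {p q r : ℤ} (hpq : p + n = q) (hqr : q + m = r) (hpr : p + l = r) :
    component ((endAlg k).mul h (periodic k S m) (periodic k T n)) hpr =
      tableMap k ((T p).mul (rk q) (S q)) (rk p) (rk r) := by
  rw [component_mul h _ _ hpq hqr, component_periodic, component_periodic, tableMap_comp]

theorem periodic_mem_Z (T : ZMod 4 → Table) {n : ℤ} {d : ZMod 4} (hn : (n : ZMod 4) = d)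
    (hT : ∀ c, (((diffTable c).mul (rk (c + 1)) (T (c + 1))).add
      ((T c).mul (rk (c + d)) (diffTable (c + d)))).IsZero (rk c) (rk (c + d + 1))) :
    periodic k T n ∈ (endAlg k).Z n := by
  refine (DGSpace.mem_Z rfl).2 (ext_component fun p q hpq => ?_)
  rw [component_d rfl _ (rfl : p + n = p + n) (by omega) (rfl : p + 1 = p + 1) (by omega) hpq,
    component_periodic, component_periodic, tableMap_comp, tableMap_comp, add_comm, ← tableMap_add]
  have hz : ∀ c', c' = (p : ZMod 4) + d + 1 → tableMap k (((diffTable p).mul (rk (p + 1))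
      (T (p + 1))).add ((T p).mul (rk (p + d)) (diffTable (p + d)))) (rk p) (rk c') = 0 := by
    rintro _ rfl
    exact tableMap_eq_zero (hT p)
  have e₁ : ((p + 1 : ℤ) : ZMod 4) = (p : ZMod 4) + 1 := cast_succ rfl
  have e₂ : ((p + n : ℤ) : ZMod 4) = (p : ZMod 4) + d := by rw [Int.cast_add, hn]
  rw [e₁, e₂]
  exact hz q (by rw [← e₂, ← cast_succ]; omega)

variable (k) in
/-- The coordinates of a cochain: the augmentations of the values on the basis vectors. -/
noncomputable def ev (n : ℤ) : (endAlg k).X n →ₗ[k] (Fin 2 → k) where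
  toFun b := coefficients (rk (-n : ℤ)) (component b (neg_add_cancel n))
  map_add' b b' := by rw [component_add]; exact map_add (coefficients (rk (-n : ℤ))) _ _
  map_smul' r b := by rw [component_smul]; exact map_smul (coefficients (rk (-n : ℤ))) _ _

theorem ev_apply {n : ℤ} (b : (endAlg k).X n) {p : ℤ} (hp : p + n = 0) :
    ev k n b = coefficients (rk p) (component b hp) := by
  obtain rfl : p = -n := by omega
  rfl

theorem ev_of_table {n : ℤ} (b : (endAlg k).X n) {p : ℤ} (hp : p + n = 0)
    {T : Table} (hb : component b hp = tableMap k T (rk p) 1) (v : Fin 2 → ℕ)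
    (hv : ∀ i : Fin 2, (if (i : ℕ) < rk p then (T i 0).length else 0) % 2 = v i) :
    ev k n b = ![(v 0 : k), (v 1 : k)] := by
  rw [ev_apply b hp, hb, coefficients_tableMap v hv]
  ext i
  fin_cases i <;> rfl

/-- `ev_of_table` for a component that factors through tables, with the residues of the degrees
given explicitly. -/
theorem ev_mul_of_tables {m n l : ℤ} (h : m + n = l) (f : (endAlg k).X m) (g : (endAlg k).X n)
    {p q : ℤ} (hpq : p + n = q) (hq : q + m = 0) {c c' : ZMod 4} (hc : (p : ZMod 4) = c)
    (hc' : (q : ZMod 4) = c') {S T : Table} (hf : component f hq = tableMap k S (rk q) 1)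
    (hg : component g hpq = tableMap k T (rk p) (rk q)) (v : Fin 2 → ℕ)
    (hv : ∀ i : Fin 2, (if (i : ℕ) < rk c then (T.mul (rk c') S i 0).length else 0) % 2 = v i) :
    ev k l ((endAlg k).mul h f g) = ![(v 0 : k), (v 1 : k)] := by
  subst hc hc'
  have hp : p + l = 0 := by omega
  refine ev_of_table _ hp (T := T.mul (rk q) S) ?_ v hv
  exact (component_mul h f g hpq hq hp).trans ((congrArg₂ _ hf hg).trans (tableMap_comp k _ _ _ _ _))

theorem component_periodic_zero (T : ZMod 4 → Table) {n p : ℤ} (hp : p + n = 0) {c : ZMod 4}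
    (hc : (p : ZMod 4) = c) : component (periodic k T n) hp = tableMap k (T c) (rk p) 1 := by
  subst hc
  rfl

theorem ev_periodic (T : ZMod 4 → Table) {n p : ℤ} (hp : p + n = 0) {c : ZMod 4}
    (hc : (p : ZMod 4) = c) (v : Fin 2 → ℕ)
    (hv : ∀ i : Fin 2, (if (i : ℕ) < rk c then (T c i 0).length else 0) % 2 = v i) :
    ev k n (periodic k T n) = ![(v 0 : k), (v 1 : k)] := by
  subst hc
  exact ev_of_table _ hp (component_periodic_zero T hp rfl) v hv

theorem ev_mul_periodic (S T : ZMod 4 → Table) {m n l : ℤ} (h : m + n = l) {p q : ℤ}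
    (hpq : p + n = q) (hq : q + m = 0) {c c' : ZMod 4} (hc : (p : ZMod 4) = c)
    (hc' : (q : ZMod 4) = c') (v : Fin 2 → ℕ)
    (hv : ∀ i : Fin 2,
      (if (i : ℕ) < rk c then ((T c).mul (rk c') (S c') i 0).length else 0) % 2 = v i) :
    ev k l ((endAlg k).mul h (periodic k S m) (periodic k T n)) = ![(v 0 : k), (v 1 : k)] :=
  ev_mul_of_tables h _ _ hpq hq hc hc' (component_periodic_zero S hq hc')
    (hc ▸ component_periodic T n hpq) v hv

theorem ev_mul_mul_periodic (R S T : ZMod 4 → Table) {i m n l o : ℤ} (h : i + m = l)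
    (h' : l + n = o) {p q r : ℤ} (hpq : p + n = q) (hqr : q + m = r) (hr : r + i = 0)
    {c c' c'' : ZMod 4} (hc : (p : ZMod 4) = c) (hc' : (q : ZMod 4) = c')
    (hc'' : (r : ZMod 4) = c'') (v : Fin 2 → ℕ)
    (hv : ∀ i : Fin 2, (if (i : ℕ) < rk c then
      ((T c).mul (rk c') ((S c').mul (rk c'') (R c'')) i 0).length else 0) % 2 = v i) :
    ev k o ((endAlg k).mul h' ((endAlg k).mul h (periodic k R i) (periodic k S m))
      (periodic k T n)) = ![(v 0 : k), (v 1 : k)] := by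
  refine ev_mul_of_tables h' _ _ hpq (show q + l = 0 by omega) hc hc' ?_
    (hc ▸ component_periodic T n hpq) v hv
  subst hc' hc''
  exact (component_mul h _ _ hqr hr _).trans ((congrArg₂ _ (component_periodic_zero R hr rfl)
    (component_periodic S m hqr)).trans (tableMap_comp k _ _ _ _ _))

/-- Minimality: both terms of the differential contain a matrix with entries of augmentation zero.
-/
theorem ev_d {m n : ℤ} (h : m + 1 = n) (c : (endAlg k).X m) : ev k n ((endAlg k).d h c) = 0 := by
  rw [ev_apply _ (neg_add_cancel n), component_d h c (show -n + m = -1 by omega)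
    (show (-1 : ℤ) + 1 = 0 by rfl) rfl (by omega)]
  refine coefficients_eq_zero fun i => ?_
  exact (isSmall_diff (by rfl) _).add ((isSmall_diff (cast_succ rfl) _).map _)

/-- The ranks are at most 2, so the two coordinates determine the composite of the component P̂_n →
P̂_0 with the augmentation. When it vanishes, the component lifts through P̂_1 → P̂_0 and starts a
null-homotopy. -/
theorem mem_B_of_ev {n : ℤ} {b : (endAlg k).X n} (hb : b ∈ (endAlg k).Z n) (hev : ev k n b = 0) :
    b ∈ (endAlg k).B n :=
  (DGSpace.mem_B (sub_add_cancel n 1)).2 (CompleteResolution.exists_primitive (P := resolution k)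
    (Q := resolution k) (sub_add_cancel n 1) b ((DGSpace.mem_Z rfl).1 hb)
    (neg_add_cancel n) (augmentation_eq_zero_of_coefficients (by
      have : ∀ c : ZMod 4, rk c ≤ 2 := by decide
      exact this _) hev))

theorem ev_mul_periodic_idTable {m n : ℤ} (h : m + 4 = n) (b : (endAlg k).X m) :
    ev k n ((endAlg k).mul h b (periodic k (fun _ => idTable) 4)) = ev k m b := by
  have e : ((-n : ℤ) : ZMod 4) = ((-m : ℤ) : ZMod 4) := by
    rw [← h]
    push_cast
    rw [show (4 : ZMod 4) = 0 by rfl]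
    ring
  rw [ev_apply _ (neg_add_cancel n), ev_apply _ (neg_add_cancel m), component_mul _ _ _
    (show -n + 4 = -m by omega) (neg_add_cancel m), component_periodic]
  exact coefficients_comp_idTable e _

theorem periodic_idTable_mul {m n : ℤ} (h : m + n = 0) (hm : (m : ZMod 4) = 0) :
    (endAlg k).mul h (periodic k (fun _ => idTable) m) (periodic k (fun _ => idTable) n) =
      (endAlg k).one := by
  refine ext_component fun p q hpq => ?_
  obtain rfl : p = q := by omega
  rw [component_one, component_mul h _ _ (rfl : p + n = p + n) (by omega), component_periodic,
    component_periodic]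
  have e : ((p + n : ℤ) : ZMod 4) = (p : ZMod 4) := by
    have := congrArg (Int.cast (R := ZMod 4)) h
    push_cast at this ⊢
    rw [hm, zero_add] at this
    rw [this, add_zero]
  generalize ((p + n : ℤ) : ZMod 4) = c at e
  subst e
  rw [tableMap_idTable_eq_id]
  rfl

theorem periodic_idTable_mul_comm (T : ZMod 4 → Table)
    (hT : ∀ c, (((T c).mul (rk (c + 1)) idTable).add (idTable.mul (rk c) (T c))).IsZero
      (rk c) (rk (c + 1))) :
    (endAlg k).mul (show (4 : ℤ) + 1 = 5 by rfl) (periodic k (fun _ => idTable) 4)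
      (periodic k T 1) = (endAlg k).mul (show (1 : ℤ) + 4 = 5 by rfl)
        (periodic k T 1) (periodic k (fun _ => idTable) 4) := by
  refine ext_component fun p q hpq => ?_
  rw [component_mul_periodic _ _ _ (rfl : p + 1 = p + 1) (by omega),
    component_mul_periodic _ _ _ (rfl : p + 4 = p + 4) (by omega)]
  have key : ∀ c c₁ c₄ c₅ : ZMod 4, c₁ = c + 1 → c₄ = c → c₅ = c + 1 →
      tableMap k ((T c).mul (rk c₁) idTable) (rk c) (rk c₅) =
        tableMap k (idTable.mul (rk c₄) (T c₄)) (rk c) (rk c₅) := by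
    rintro c _ _ _ rfl rfl rfl
    exact tableMap_eq_of_isZero_add (hT _)
  have four : (4 : ZMod 4) = 0 := rfl
  refine key _ _ _ _ (cast_succ rfl) ?_ ?_
  · push_cast
    rw [four, add_zero]
  · rw [← hpq, show p + 5 = p + 1 + 4 by ring]
    push_cast
    rw [four, add_zero]

/-- A null-homotopy of a cocycle of degree two, with given components. -/
theorem exists_d_eq (b : (endAlg k).X 2) (hb : b ∈ (endAlg k).Z 2)
    (hb' : component b (show (-2 : ℤ) + 2 = 0 by rfl) =
      tableMap k (qTable.mul 2 (diffTable 3)) 2 1) :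
    ∃ c : (endAlg k).X 1, (endAlg k).d (show (1 : ℤ) + 1 = 2 by rfl) c = b ∧
      component c (show (-2 : ℤ) + 1 = -1 by rfl) = tableMap k qTable 2 2 ∧
      component c (show (-1 : ℤ) + 1 = 0 by rfl) = 0 := by
  have H : Cochain.v b (-2) 0 rfl = ModuleCat.ofHom (tableMap k qTable 2 2) ≫
      ModuleCat.ofHom (tableMap k (diffTable 3) 2 1) := by
    rw [← ModuleCat.ofHom_comp, tableMap_comp]
    exact ModuleCat.hom_ext hb'
  obtain ⟨c, h1, h2, h3⟩ := CompleteResolution.exists_primitive_of_components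
    (P := resolution k) (Q := resolution k) (show (1 : ℤ) + 1 = 2 by rfl) b
    ((DGSpace.mem_Z (C := (endAlg k).toDGSpace) rfl).1 hb) (show (-2 : ℤ) + 1 = -1 by rfl)
    (show (-2 : ℤ) + 1 = -1 by rfl) (show (-2 : ℤ) + 2 = 0 by rfl)
    (ModuleCat.ofHom (tableMap k qTable 2 2)) 0 (by
      rw [Limits.comp_zero, smul_zero, add_zero]
      refine H.trans ?_
      have : ModuleCat.ofHom (tableMap k (diffTable 3) 2 1) = (complex k).d (-1) 0 :=
        (complex_d k (show (-1 : ℤ) + 1 = 0 by rfl)).symm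
      rw [this]
      rfl)
  exact ⟨c, h1, congrArg ModuleCat.Hom.hom h2, congrArg ModuleCat.Hom.hom h3⟩

end QuaternionResolution

/-! ### The explicit quaternion model -/

namespace QuaternionResolution

open QuaternionGroup

variable {k : Type u} [Field k] [CharP k 2]

-- Only the composite P̂_2 → P̂_1 → P̂_0 contributes to `ev` in degree 2. The null-homotopies q and
-- e are both chosen with `qTable` as component P̂_2 → P̂_1 and with zero component P̂_1 → P̂_0, so
-- their other components never have to be known.
variable (k) in
theorem exists_quaternionModel : Nonempty (endAlg k).QuaternionModel := by
  have two : (1 : ℤ) + 1 = 2 := rfl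
  obtain ⟨x, hx⟩ : ∃ x, x = periodic k xTable 1 := ⟨_, rfl⟩
  obtain ⟨y, hy⟩ : ∃ y, y = periodic k yTable 1 := ⟨_, rfl⟩
  have x_mem : x ∈ (endAlg k).Z 1 := hx ▸ periodic_mem_Z xTable rfl x_diff
  have y_mem : y ∈ (endAlg k).Z 1 := hy ▸ periodic_mem_Z yTable rfl y_diff
  have id_diff : ∀ c, (((diffTable c).mul (rk (c + 1)) idTable).add
      (idTable.mul (rk (c + 0)) (diffTable (c + 0)))).IsZero (rk c) (rk (c + 0 + 1)) := by
    decide +kernel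
  obtain ⟨q, hq, hq₂, hq₁⟩ := exists_d_eq ((endAlg k).mul two x x +
      (endAlg k).mul two y y +
      (endAlg k).mul two y x)
    (Submodule.add_mem _ (Submodule.add_mem _ ((endAlg k).pairing.mem_Z two x_mem x_mem)
      ((endAlg k).pairing.mem_Z two y_mem y_mem)) ((endAlg k).pairing.mem_Z two y_mem x_mem)) (by
      rw [hx, hy, component_add, component_add, component_mul_periodic _ _ _ (q := -1) rfl rfl,
        component_mul_periodic _ _ _ (q := -1) rfl rfl,
        component_mul_periodic _ _ _ (q := -1) rfl rfl, ← tableMap_add, ← tableMap_add]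
      exact tableMap_eq_of_isZero_add (by decide +kernel))
  obtain ⟨e, he, he₂, he₁⟩ := exists_d_eq ((endAlg k).mul two x y +
      (endAlg k).mul two y x)
    (Submodule.add_mem _ ((endAlg k).pairing.mem_Z two x_mem y_mem)
      ((endAlg k).pairing.mem_Z two y_mem x_mem)) (by
      rw [hx, hy, component_add, component_mul_periodic _ _ _ (q := -1) rfl rfl,
        component_mul_periodic _ _ _ (q := -1) rfl rfl, ← tableMap_add]
      exact tableMap_eq_of_isZero_add (by decide +kernel))
  -- The left factor of a product acts last, through its component P̂_1 → P̂_0; so products with q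
  -- or e on the left contribute nothing.
  have left : ∀ u : (endAlg k).X 1, component u (show (-1 : ℤ) + 1 = 0 by rfl) = 0 →
      ∀ v, ev k 2 ((endAlg k).mul two u v) = 0 := by
    intro u hu v
    rw [ev_apply _ (show (-2 : ℤ) + 2 = 0 by rfl), component_mul _ _ _
      (show (-2 : ℤ) + 1 = -1 by rfl) (show (-1 : ℤ) + 1 = 0 by rfl), hu, LinearMap.zero_comp]
    exact map_zero (coefficients _)
  -- With q or e on the right only the table of its component P̂_2 → P̂_1 enters.
  have right : ∀ u : (endAlg k).X 1, component u (show (-2 : ℤ) + 1 = -1 by rfl) =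
        tableMap k qTable 2 2 → ∀ T, ∀ v : Fin 2 → ℕ,
      (∀ i : Fin 2, (if (i : ℕ) < rk 2 then (qTable.mul (rk 3) (T 3) i 0).length else 0) % 2 = v i) →
      ev k 2 ((endAlg k).mul two (periodic k T 1) u) =
        ![(v 0 : k), (v 1 : k)] := by
    intro u hu T v hv
    exact ev_mul_of_tables _ _ _ (show (-2 : ℤ) + 1 = -1 by rfl) (show (-1 : ℤ) + 1 = 0 by rfl)
      (c := 2) (c' := 3) rfl rfl (component_periodic_zero T _ rfl) hu v hv
  have ev_xq := right q hq₂ xTable ![0, 1] (by decide)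
  have ev_ye := right e he₂ yTable ![0, 0] (by decide)
  have ev_yq := right q hq₂ yTable ![0, 0] (by decide)
  have ev_xe := right e he₂ xTable ![0, 1] (by decide)
  rw [← hx] at ev_xq ev_xe
  rw [← hy] at ev_yq ev_ye
  exact ⟨{
    ev := ev k
    ev_of_mem_B := fun {n b} hb => by
      obtain ⟨c, rfl⟩ := (DGSpace.mem_B (sub_add_cancel n 1)).1 hb
      exact ev_d _ c
    mem_B_of_ev := mem_B_of_ev
    ev_snd := fun {n} hn b => by
      -- In these degrees P̂_n has rank 1, so the second coordinate is the default value 0.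
      have h : ∀ c : ZMod 4, c = 0 ∨ c = 3 → rk (-c) = 1 := by decide
      refine coefficients_of_not_lt _ _ ?_
      have e : (n : ZMod 4) = ((n % 4 : ℤ) : ZMod 4) := by
        rw [ZMod.intCast_eq_intCast_iff_dvd_sub]
        omega
      rw [Int.cast_neg, h]
      · exact lt_irrefl 1
      · rw [e]
        rcases hn with hn | hn <;> rw [hn]
        · exact Or.inl rfl
        · exact Or.inr rfl
    x := x
    y := y
    s := periodic k (fun _ => idTable) 4
    t := periodic k (fun _ => idTable) (-4)
    q := q
    e := e
    x_mem := x_mem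
    y_mem := y_mem
    s_mem := periodic_mem_Z _ rfl id_diff
    t_mem := periodic_mem_Z _ rfl id_diff
    ev_mul_s := ev_mul_periodic_idTable
    s_t := by
      rw [periodic_idTable_mul _ rfl, sub_self]
      exact Submodule.zero_mem _
    t_s := by
      rw [periodic_idTable_mul _ rfl, sub_self]
      exact Submodule.zero_mem _
    s_x := hx ▸ periodic_idTable_mul_comm xTable (by decide +kernel)
    s_y := hy ▸ periodic_idTable_mul_comm yTable (by decide +kernel)
    d_q := hq
    d_e := he
    ev_one := by
      rw [ev_apply _ (show (0 : ℤ) + 0 = 0 by rfl), component_one]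
      refine (congrArg (coefficients 1) (tableMap_idTable_eq_id 0).symm).trans ?_
      refine (coefficients_tableMap (c := 0) ![1, 0] (by decide)).trans ?_
      ext i
      fin_cases i <;> simp
    ev_x := by
      rw [hx]
      exact (ev_periodic xTable (p := -1) rfl (c := 3) rfl ![1, 0] (by decide)).trans (by simp)
    ev_y := by
      rw [hy]
      exact (ev_periodic yTable (p := -1) rfl (c := 3) rfl ![0, 1] (by decide)).trans (by simp)
    ev_xx := by
      rw [hx]
      exact (ev_mul_periodic xTable xTable _ (p := -2) (q := -1) rfl rfl (c := 2) (c' := 3) rfl rfl ![1, 1]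
        (by decide)).trans (by simp)
    ev_xy := by
      rw [hx, hy]
      exact (ev_mul_periodic xTable yTable _ (p := -2) (q := -1) rfl rfl (c := 2) (c' := 3) rfl rfl ![0, 1]
        (by decide)).trans (by simp)
    ev_yx := by
      rw [hx, hy]
      exact (ev_mul_periodic yTable xTable _ (p := -2) (q := -1) rfl rfl (c := 2) (c' := 3) rfl rfl ![0, 1]
        (by decide)).trans (by simp)
    ev_yy := by
      rw [hy]
      exact (ev_mul_periodic yTable yTable _ (p := -2) (q := -1) rfl rfl (c := 2) (c' := 3) rfl rfl ![1, 0]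
        (by decide)).trans (by simp)
    ev_xxy := by
      rw [hx, hy]
      exact (ev_mul_mul_periodic xTable xTable yTable _ _ (p := -3) (q := -2) (r := -1) rfl rfl rfl
      (c := 1) (c' := 2) (c'' := 3) rfl rfl rfl ![1, 0]
        (by decide)).trans (by simp)
    ev_xyy := by
      rw [hx, hy]
      exact (ev_mul_mul_periodic xTable yTable yTable _ _ (p := -3) (q := -2) (r := -1) rfl rfl rfl
      (c := 1) (c' := 2) (c'' := 3) rfl rfl rfl ![1, 0]
        (by decide)).trans (by simp)
    ev_secondary_x := by
      simp [left q hq₁, left e he₁, ev_xq, ev_ye]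
    ev_secondary_y := by
      simp [left q hq₁, left e he₁, ev_yq, ev_xe, ev_ye] }⟩

end QuaternionResolution

/-! ## Transfer along homotopy retractions -/

section Conjugation

variable (k : Type u) [Field k] {C : Type*} [Category.{w} C] [Preadditive C] [Linear k C]
  {K L : CochainComplex C ℤ}

/-- Composition of homogeneous maps with a morphism of complexes on either side. -/
def conjugate (f : K ⟶ L) (g : L ⟶ K) (n : ℤ) :
    (endDGAlg k K).X n →ₗ[k] (endDGAlg k L).X n :=
  cochainMul k L K L (zero_add n) (Cochain.ofHom f) ∘ₗ
    (cochainMul k L K K (add_zero n)).flip (Cochain.ofHom g)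

theorem conjugate_v (f : K ⟶ L) (g : L ⟶ K) {n : ℤ} (a : (endDGAlg k K).X n) {p q : ℤ}
    (h : p + n = q) :
    Cochain.v (conjugate k f g n a) p q h = g.f p ≫ Cochain.v a p q h ≫ f.f q := by
  refine (Cochain.comp_zero_cochain_v _ (Cochain.ofHom f) p q h).trans ?_
  refine (congrArg (· ≫ _) (Cochain.zero_cochain_comp_v (Cochain.ofHom g) a p q h)).trans ?_
  rw [Cochain.ofHom_v, Cochain.ofHom_v, Category.assoc]

theorem endDGAlg_mul_v {m n l : ℤ} (h : m + n = l) (a : (endDGAlg k K).X m)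
    (b : (endDGAlg k K).X n) {p q r : ℤ} (hpq : p + n = q) (hqr : q + m = r) (hpr : p + l = r) :
    Cochain.v ((endDGAlg k K).mul h a b) p r hpr = Cochain.v b p q hpq ≫ Cochain.v a q r hqr :=
  Cochain.comp_v b a ((add_comm n m).trans h) p q r hpq hqr

theorem conjugate_d (f : K ⟶ L) (g : L ⟶ K) {m n : ℤ} (h : m + 1 = n)
    (a : (endDGAlg k K).X m) :
    (endDGAlg k L).d h (conjugate k f g m a) = conjugate k f g n ((endDGAlg k K).d h a) := by
  refine (δ_comp_ofHom (Cochain.comp (Cochain.ofHom g) a (zero_add m)) f n).trans ?_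
  exact congrArg (fun b => Cochain.comp b (Cochain.ofHom f) (add_zero n)) (δ_ofHom_comp g a n)

theorem conjugate_conjugate {f : K ⟶ L} {g : L ⟶ K} (hfg : f ≫ g = 𝟙 K) {n : ℤ}
    (a : (endDGAlg k K).X n) : conjugate k g f n (conjugate k f g n a) = a := by
  refine Cochain.ext _ _ fun p q h => ?_
  have e (p : ℤ) : f.f p ≫ g.f p = 𝟙 _ := by
    rw [← HomologicalComplex.comp_f, hfg, HomologicalComplex.id_f]
  rw [conjugate_v, conjugate_v, Category.assoc, Category.assoc, e, Category.comp_id,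
    ← Category.assoc, e, Category.id_comp]

/-- The inner factor f ≫ g is the identity, so this direction of conjugation is strictly
multiplicative, which keeps secondary products intact. -/
theorem conjugate_mul {f : K ⟶ L} {g : L ⟶ K} (hfg : f ≫ g = 𝟙 K) {m n l : ℤ} (h : m + n = l)
    (a : (endDGAlg k K).X m) (b : (endDGAlg k K).X n) :
    conjugate k f g l ((endDGAlg k K).mul h a b) =
      (endDGAlg k L).mul h (conjugate k f g m a) (conjugate k f g n b) := by
  refine Cochain.ext _ _ fun p r hpr => ?_
  have e (p : ℤ) : f.f p ≫ g.f p = 𝟙 _ := by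
    rw [← HomologicalComplex.comp_f, hfg, HomologicalComplex.id_f]
  rw [conjugate_v, endDGAlg_mul_v k h _ _ (rfl : p + n = p + n) (by omega),
    endDGAlg_mul_v k h _ _ (rfl : p + n = p + n) (by omega), conjugate_v, conjugate_v]
  simp only [Category.assoc]
  rw [← Category.assoc (f.f _) (g.f _), e, Category.id_comp]

/-- The way back would insert g ≫ f, which is only homotopic to the identity; it respects a product
as soon as one factor comes from K. -/
theorem conjugate_mul_conjugate {f : K ⟶ L} {g : L ⟶ K} (hfg : f ≫ g = 𝟙 K) {m n l : ℤ}
    (h : m + n = l) (b : (endDGAlg k L).X m) (a : (endDGAlg k K).X n) :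
    conjugate k g f l ((endDGAlg k L).mul h b (conjugate k f g n a)) =
      (endDGAlg k K).mul h (conjugate k g f m b) a := by
  refine Cochain.ext _ _ fun p r hpr => ?_
  have e (p : ℤ) : f.f p ≫ g.f p = 𝟙 _ := by
    rw [← HomologicalComplex.comp_f, hfg, HomologicalComplex.id_f]
  rw [conjugate_v, endDGAlg_mul_v k h _ _ (rfl : p + n = p + n) (by omega),
    endDGAlg_mul_v k h _ _ (rfl : p + n = p + n) (by omega), conjugate_v, conjugate_v]
  simp only [Category.assoc]
  rw [← Category.assoc (f.f _) (g.f _), e, Category.id_comp]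

theorem conjugate_one {f : K ⟶ L} {g : L ⟶ K} (hfg : f ≫ g = 𝟙 K) :
    conjugate k g f 0 (endDGAlg k L).one = (endDGAlg k K).one := by
  refine Cochain.ext _ _ fun p q h => ?_
  obtain rfl : p = q := by omega
  rw [conjugate_v]
  change f.f p ≫ Cochain.v (Cochain.ofHom (𝟙 L)) p p h ≫ g.f p = Cochain.v (Cochain.ofHom (𝟙 K)) p p h
  rw [Cochain.ofHom_v, Cochain.ofHom_v, HomologicalComplex.id_f, Category.id_comp,
    ← HomologicalComplex.comp_f, hfg]

/-- Conjugation with a homotopy equivalence detects coboundaries. -/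
theorem mem_B_of_conjugate_mem_B {f : K ⟶ L} {g : L ⟶ K} {c : Cochain L L (-1)}
    (hc : δ (-1) 0 c = Cochain.ofHom (g ≫ f) - Cochain.ofHom (𝟙 L)) {n : ℤ}
    {b : (endDGAlg k L).X n} (hb : b ∈ (endDGAlg k L).Z n)
    (hB : conjugate k g f n b ∈ (endDGAlg k K).B n) : b ∈ (endDGAlg k L).B n := by
  -- Conjugating back and forth turns b into EbE, and E differs from 1 by a coboundary. So b differs
  -- from the coboundary EbE by the coboundaries (E - 1)bE and b(E - 1).
  obtain ⟨E, hE⟩ : ∃ E : (endDGAlg k L).X 0, E = Cochain.ofHom (g ≫ f) := ⟨_, rfl⟩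
  have hE_one : E - (endDGAlg k L).one ∈ (endDGAlg k L).B 0 := (DGSpace.mem_B (show (-1 : ℤ) + 1 = 0 by rfl)).2
    ⟨c, hc.trans (by rw [hE]; rfl)⟩
  have hEZ : E ∈ (endDGAlg k L).Z 0 := (DGSpace.mem_Z (zero_add 1)).2 (by rw [hE]; exact δ_ofHom (g ≫ f))
  have h₁ : (endDGAlg k L).mul (zero_add n) E ((endDGAlg k L).mul (add_zero n) b E) ∈ (endDGAlg k L).B n := by
    have e : (endDGAlg k L).mul (zero_add n) E ((endDGAlg k L).mul (add_zero n) b E) =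
        conjugate k f g n (conjugate k g f n b) := by
      refine Cochain.ext _ _ fun p q h => ?_
      rw [conjugate_v, conjugate_v, endDGAlg_mul_v k _ _ _ h (add_zero q),
        endDGAlg_mul_v k _ _ _ (add_zero p) h, hE, Cochain.ofHom_v, Cochain.ofHom_v,
        HomologicalComplex.comp_f, HomologicalComplex.comp_f]
      simp only [Category.assoc]
    rw [e]
    obtain ⟨u, hu⟩ := (DGSpace.mem_B (sub_add_cancel n 1)).1 hB
    rw [← hu, ← conjugate_d]
    exact DGSpace.d_mem_B _ _
  have h₂ : (endDGAlg k L).mul (zero_add n) (E - (endDGAlg k L).one) ((endDGAlg k L).mul (add_zero n) b E) ∈ (endDGAlg k L).B n :=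
    (endDGAlg k L).pairing.left_mem_B (zero_add n) hE_one ((endDGAlg k L).pairing.mem_Z (add_zero n) hb hEZ)
  have h₃ : (endDGAlg k L).mul (add_zero n) b (E - (endDGAlg k L).one) ∈ (endDGAlg k L).B n := (endDGAlg k L).pairing.right_mem_B (add_zero n) hb hE_one
  rw [map_sub, LinearMap.sub_apply, (endDGAlg k L).one_mul] at h₂
  rw [map_sub, (endDGAlg k L).mul_one] at h₃
  have := Submodule.sub_mem _ (Submodule.sub_mem _ h₁ h₂) h₃
  rwa [sub_sub_cancel, sub_sub_cancel] at this

end Conjugation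

namespace DGAlg.QuaternionModel

variable {k : Type u} [Field k] {C : Type*} [Category.{w} C] [Preadditive C] [Linear k C]
  {K L : CochainComplex C ℤ}

/-- Elements of the model are moved to L by conjugation, and cochains on L are evaluated after
moving them to K. Equations between products survive strictly; the homotopy is needed only for
detecting coboundaries and for the two inverse relations. -/
theorem nonempty_of_retraction {f : K ⟶ L} {g : L ⟶ K} (hfg : f ≫ g = 𝟙 K)
    {c : Cochain L L (-1)} (hc : δ (-1) 0 c = Cochain.ofHom (g ≫ f) - Cochain.ofHom (𝟙 L))
    (m : (endDGAlg k K).QuaternionModel) : Nonempty (endDGAlg k L).QuaternionModel := by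
  have back : ∀ {n : ℤ} (a : (endDGAlg k K).X n),
    conjugate k g f n (conjugate k f g n a) = a := conjugate_conjugate k hfg
  have hZ : ∀ {n : ℤ} {a : (endDGAlg k K).X n}, a ∈ (endDGAlg k K).Z n →
      conjugate k f g n a ∈ (endDGAlg k L).Z n := fun {n a} ha => by
    rw [DGSpace.mem_Z rfl] at ha ⊢
    exact (conjugate_d k f g rfl a).trans ((congrArg _ ha).trans (map_zero _))
  have hB : ∀ {n : ℤ} {b : (endDGAlg k L).X n}, b ∈ (endDGAlg k L).B n →
      conjugate k g f n b ∈ (endDGAlg k K).B n := fun {n b} hb => by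
    obtain ⟨u, rfl⟩ := (DGSpace.mem_B (sub_add_cancel n 1)).1 hb
    rw [← conjugate_d]
    exact DGSpace.d_mem_B _ _
  have hZ' : ∀ {n : ℤ} {b : (endDGAlg k L).X n}, b ∈ (endDGAlg k L).Z n →
      conjugate k g f n b ∈ (endDGAlg k K).Z n := fun {n b} hb => by
    rw [DGSpace.mem_Z rfl] at hb ⊢
    exact (conjugate_d k g f rfl b).trans ((congrArg _ hb).trans (map_zero _))
  have mul := fun {m n l : ℤ} (h : m + n = l) a b => (conjugate_mul k hfg h a b).symm
  have inv : ∀ {i j : ℤ} (h : i + j = 0) {a : (endDGAlg k K).X i} {b : (endDGAlg k K).X j},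
      a ∈ (endDGAlg k K).Z i → b ∈ (endDGAlg k K).Z j →
      (endDGAlg k K).mul h a b - (endDGAlg k K).one ∈ (endDGAlg k K).B 0 →
      (endDGAlg k L).mul h (conjugate k f g i a) (conjugate k f g j b) - (endDGAlg k L).one ∈
        (endDGAlg k L).B 0 := by
    intro i j h a b ha hb hab
    -- Being a coboundary may be tested in K, where the unit of L becomes the unit of K.
    refine mem_B_of_conjugate_mem_B k hc (Submodule.sub_mem _
      ((endDGAlg k L).pairing.mem_Z h (hZ ha) (hZ hb)) (endDGAlg k L).one_mem_Z) ?_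
    rwa [mul, map_sub, back, conjugate_one k hfg]
  exact ⟨{
    ev := fun n => m.ev n ∘ₗ conjugate k g f n
    ev_of_mem_B := fun hb => m.ev_of_mem_B (hB hb)
    mem_B_of_ev := fun hb h => mem_B_of_conjugate_mem_B k hc hb (m.mem_B_of_ev (hZ' hb) h)
    ev_snd := fun hn b => m.ev_snd hn _
    x := conjugate k f g 1 m.x
    y := conjugate k f g 1 m.y
    s := conjugate k f g 4 m.s
    t := conjugate k f g (-4) m.t
    q := conjugate k f g 1 m.q
    e := conjugate k f g 1 m.e
    x_mem := hZ m.x_mem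
    y_mem := hZ m.y_mem
    s_mem := hZ m.s_mem
    t_mem := hZ m.t_mem
    ev_mul_s := fun h b => by
      rw [LinearMap.comp_apply, conjugate_mul_conjugate k hfg, m.ev_mul_s, LinearMap.comp_apply]
    s_t := inv _ m.s_mem m.t_mem m.s_t
    t_s := inv _ m.t_mem m.s_mem m.t_s
    s_x := by rw [mul, mul, m.s_x]
    s_y := by rw [mul, mul, m.s_y]
    d_q := by rw [conjugate_d, m.d_q, map_add, map_add, mul, mul, mul]
    d_e := by rw [conjugate_d, m.d_e, map_add, mul, mul]
    ev_one := by rw [LinearMap.comp_apply, conjugate_one k hfg, m.ev_one]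
    ev_x := by rw [LinearMap.comp_apply, back, m.ev_x]
    ev_y := by rw [LinearMap.comp_apply, back, m.ev_y]
    ev_xx := by rw [LinearMap.comp_apply, mul, back, m.ev_xx]
    ev_xy := by rw [LinearMap.comp_apply, mul, back, m.ev_xy]
    ev_yx := by rw [LinearMap.comp_apply, mul, back, m.ev_yx]
    ev_yy := by rw [LinearMap.comp_apply, mul, back, m.ev_yy]
    ev_xxy := by rw [LinearMap.comp_apply, mul, mul, back, m.ev_xxy]
    ev_xyy := by rw [LinearMap.comp_apply, mul, mul, back, m.ev_xyy]
    ev_secondary_x := by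
      rw [LinearMap.comp_apply, mul, mul, mul, mul, mul, ← map_add, ← map_add, ← map_add,
        ← map_add, back, m.ev_secondary_x]
    ev_secondary_y := by
      rw [LinearMap.comp_apply, mul, mul, mul, mul, mul, ← map_add, ← map_add, ← map_add,
        ← map_add, back, m.ev_secondary_y] }⟩

end DGAlg.QuaternionModel

/-- The Tate cohomology of the quaternion group is computed by a quaternion model. -/
theorem CompleteResolution.exists_quaternionModel {k : Type u} [Field k] [CharP k 2]
    (P : CompleteResolution k (QuaternionGroup 2)) : Nonempty P.dga.QuaternionModel := by
  obtain ⟨f, g, hfg, c, hc⟩ := QuaternionResolution.exists_retraction P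
  obtain ⟨m⟩ := QuaternionResolution.exists_quaternionModel k
  exact DGAlg.QuaternionModel.nonempty_of_retraction hfg hc m

theorem theorem2p1 {k : Type u} [Field k] [CharP k 2] :
    Nonempty (CompleteResolution k (QuaternionGroup 2)) ∧
    ∀ P : CompleteResolution k (QuaternionGroup 2),
      (∀ c : P.dga.Choices, c.gamma ≠ 0) ∧
      (∃ x y s, IsQuaternionPresentation P.tate x y s) ∧
      ∀ x y s, IsQuaternionPresentation P.tate x y s →
        (P.dga.massey (quaternionMatrix P.tate x y 0 1 rfl) (quaternionMatrix P.tate x y 1 2 rfl)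
          (quaternionMatrix P.tate x y 2 3 rfl)).Nonempty ∧
        0 ∉ P.dga.massey (quaternionMatrix P.tate x y 0 1 rfl)
          (quaternionMatrix P.tate x y 1 2 rfl) (quaternionMatrix P.tate x y 2 3 rfl) ∧
        ¬ ∃ X : GrMod P.tate, P.IsRealisable X ∧
          (GrMod.coker (quaternionMatrix P.tate x y 0 1 rfl).toHom).IsSummandOf X := by
  refine ⟨⟨QuaternionResolution.resolution k⟩, fun P => ?_⟩
  obtain ⟨m⟩ := P.exists_quaternionModel
  have h := m.coordinates.isQuaternionPresentation
  refine ⟨DGAlg.gamma_ne_zero P.dga h (m.zero_notMem_massey h), ⟨_, _, _, h⟩, fun x y s h => ?_⟩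
  refine ⟨P.dga.massey_nonempty h, m.zero_notMem_massey h, ?_⟩
  rintro ⟨X, ⟨M, hX⟩, hs⟩
  -- Ĥ^*(Q, M) is the cohomology of the differential graded module Hom(P̂, M), so no property of M
  -- is involved.
  exact P.dga.not_isSummandOf_cohomology h (m.zero_notMem_massey h) (homDGMod k P.K
    ((HomologicalComplex.single _ (ComplexShape.up ℤ) 0).obj M)) (hs.trans_isIsoTo hX)
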